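/- Let $K$ be a number field of degree $d$ with ring of integers $\mathcal O_K$. For $r\ge 1$ let $D(r)$ be the number of ideals of $\mathcal O_K$ of norm $r$, let $\Omega_d(r)$ be the number of prime factors $p>d$ of $r$, with multiplicity, and for $n\ge 1$ let $\overline n\in\{1,\dots,d\}$ denote the representative of $n$ modulo $d$. Let $\psi(r)$ be obtained from $r$ by replacing each prime factor $p>d$ by $p-\overline p+1$. For $N\ge 1$ put $\alpha=\binom{d+\lfloor\log_2 N\rfloor-1}{\lfloor\log_2 N\rfloor}^{-1}$ and $M_d(r)=\prod_{p\le d}\alpha\,(p-1)^{-v_p(r)}$ (product over primes), put $k=\lfloor N/d\rfloor$, and let $N'=kd+d-1$ be the least integer $\ge N$ with $N'\equiv d-1 \pmod d$. The algorithm, on input $N\ge 1$, repeats the following round. 1. For each residue $b$ in the set $B$, where $B=\{1,3,\dots,d-1\}$ if $d$ is even, $B=\{1,2,\dots,d-1\}$ if $d\ge 3$ is odd, and $B=\{1\}$ if $d=1$, generate a list $s_{1,b}\ge s_{2,b}\ge\dots\ge s_{l,b}=1$: let $J=\lfloor (N'-b)/d\rfloor$; the first entry is drawn from $\{1,d+b,2d+b,\dots,Jd+b\}$,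 being $1$ with probability $\frac1{Jd+1}$ and each other element with probability $\frac d{Jd+1}$; after an entry $s=jd+b>1$ the next one is drawn from $\{1,d+b,\dots,s\}$, being $1$ with probability $\frac1{jd+1}$ and each other element with probability $\frac d{jd+1}$; the list stops at $1$. 2. Let $r$ be the product of all prime entries $s_{i,b}$ (found by primality tests). 3. For each prime $p\le d$, multiply $r$ by $p$ with probability $\frac{p-1}p$, repeatedly, until the first failure. 4. If $r>N$, reject. If $r\le N$, factor $p\mathcal O_K$ for each prime $p\mid r$, compute $D(r)$ by counting, for each $p^e\,\|\,r$, the solutions $(c_i)$ of $\sum_i c_if_i=e$ in nonnegative integers, where $f_i$ are the residue degrees of the primes $\mathfrak p_i$ above $p$, and accept $r$ with probability $M_d(r)\frac{\psi(r)D(r)}{d^{\Omega_d(r)}N}$. When some $r$ is accepted, a solution $(c_i)$ of $\sum_i c_if_i=e$ is chosen uniformly at random for each $p^e\,\|\,r$, and the algorithm outputs $r$ and the ideal $\prod_{p\mid r}\prod_i\mathfrak p_i^{c_i}$ in factored form. Then for every $N\ge1$: (a) For $1\le r\le N$ the number $M_d(r)\frac{\psi(r)D(r)}{d^{\Omega_d(r)}N}$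 lies in $[0,1]$, and it is the probability with which step 4 accepts $r$. One round accepts $r$ (with its correct prime factorization) with probability $c_N D(r)$, where $$c_N=\frac1N\prod_{p\le d}\frac{\alpha}{p}\prod_{d<p\le N'}\Bigl(1-\frac{d}{p-\overline p+1}\Bigr)>0 .$$ (b) The repetition of rounds halts with probability $1$, and the accepted integer is $r$ (with its correct prime factorization) with probability $D(r)/\sum_{s\le N}D(s)$, for each $1\le r\le N$. (c) The whole algorithm halts with probability $1$, and each nonzero ideal of $\mathcal O_K$ of norm at most $N$ is output, together with its norm and its correct prime factorization, with the same probability, one over the number of such ideals. (d) For fixed $K$, the expected number of primality tests and the expected number of factorizations of ideals $p\mathcal O_K$ are $O((\log N)^{d^2+d+1})$ for $N\ge2$. (e) Suppose that a primality test of an integer $m$ takes time $O((\log m)^6)$, that a factorization of $p\mathcal O_K$ takes time $O((\log p)^6)$, that drawing a uniform element of $\{0,\dots,n-1\}$ takes time linear in the bit length of $n$, and that integer arithmetic has schoolbook bit cost. Then for fixed $K$ the expected total time is $O((\log N)^{d^2+d+7})$ for $N\ge2$. -/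

import Mathlib

open scoped ENNReal NumberField
open Filter Asymptotics

noncomputable section

namespace FactoredIdeals

universe u v w

/-! ## Randomized computations with a step count -/

/-- What a run has spent: primality tests, factorizations of `p𝓞_K`, and time (bit operations). -/
structure Cost where
  tests : ℕ
  splittings : ℕ
  time : ℕ

instance : Zero Cost := ⟨⟨0, 0, 0⟩⟩

instance : Add Cost :=
  ⟨fun a b => ⟨a.tests + b.tests, a.splittings + b.splittings, a.time + b.time⟩⟩

/-- A randomized computation: `m a c` is the probability that it halts with result `a`, having
spent exactly `c`. The mass that is missing from `1` is the probability of running forever. -/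
def RandComp (α : Type u) : Type u := α → Cost → ℝ≥0∞

namespace RandComp

variable {α : Type u} {β : Type v} {σ : Type w}

open Classical in
/-- Spend `c₀` and return `a`. -/
def pay (c₀ : Cost) (a : α) : RandComp α := fun x c => if x = a ∧ c = c₀ then 1 else 0

/-- Return `a` at no cost. -/
def ret (a : α) : RandComp α := pay 0 a

/-- Spend `t` units of time and return `a`. -/
def charge (t : ℕ) (a : α) : RandComp α := pay ⟨0, 0, t⟩ a

open Classical in
/-- Run `m`, then run `f` on its result with fresh randomness; the costs add up. -/
def bind (m : RandComp α) (f : α → RandComp β) : RandComp β := fun b c =>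
  ∑' (a : α) (c₁ : Cost) (c₂ : Cost), if c₁ + c₂ = c then m a c₁ * f a b c₂ else 0

/-- At most `n` passes of `loop`; runs that need more passes count as not halting. -/
def loopFuel (body : σ → RandComp (σ ⊕ α)) : ℕ → σ → RandComp α
  | 0, _ => fun _ _ => 0
  | n + 1, s => (charge 1 s).bind fun s => (body s).bind fun x =>
      Sum.elim (fun s' => loopFuel body n s') (fun a => ret a) x

/-- Repeat `body`, from state `s`, until it returns a result (`Sum.inr`). Each pass costs one
unit of time on top of the cost of `body`. -/
def loop (body : σ → RandComp (σ ⊕ α)) (s : σ) : RandComp α :=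
  fun a c => ⨆ n, loopFuel body n s a c

/-- Go through a list, updating a state; one unit of time per entry on top of the updates. -/
def foldList (f : β → α → RandComp β) : β → List α → RandComp β
  | b, [] => charge 1 b
  | b, a :: l => (charge 1 b).bind fun b => (f b a).bind fun b' => foldList f b' l

/-- The probability that the computation halts with a result satisfying `E`. -/
def pr (m : RandComp α) (E : α → Prop) : ℝ≥0∞ := ∑' (a : {a : α // E a}) (c : Cost), m a c

/-- The computation halts with probability one. -/
def Halts (m : RandComp α) : Prop := m.pr (fun _ => True) = 1

/-- The expected value of a cost, for a computation that halts with probability one. -/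
def expected (m : RandComp α) (g : Cost → ℕ) : ℝ≥0∞ := ∑' (a : α) (c : Cost), m a c * (g c : ℝ≥0∞)

/-! Integer operations, charged by the bit lengths of the operands (schoolbook arithmetic). -/

def add (a b : ℕ) : RandComp ℕ := charge (a.size + b.size + 1) (a + b)

def sub (a b : ℕ) : RandComp ℕ := charge (a.size + b.size + 1) (a - b)

def mul (a b : ℕ) : RandComp ℕ := charge ((a.size + 1) * (b.size + 1)) (a * b)

def div (a b : ℕ) : RandComp ℕ := charge ((a.size + 1) * (b.size + 1)) (a / b)

def mod (a b : ℕ) : RandComp ℕ := charge ((a.size + 1) * (b.size + 1)) (a % b)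

def le (a b : ℕ) : RandComp Bool := charge (a.size + b.size + 1) (decide (a ≤ b))

def eq (a b : ℕ) : RandComp Bool := charge (a.size + b.size + 1) (decide (a = b))

/-- `⌊log₂ a⌋`, the bit length minus one. -/
def log2 (a : ℕ) : RandComp ℕ := charge (a.size + 1) (Nat.log 2 a)

/-- `a ^ e` by repeated multiplication. -/
def pow (a e : ℕ) : RandComp ℕ := foldList (fun x b => mul x b) 1 (List.replicate e a)

/-- Read entry `i` of an array. -/
def read (l : List ℕ) (i : ℕ) : RandComp ℕ := charge (i.size + 1) (l.getD i 0)

/-- A uniformly random element of `{0, …, n - 1}`. -/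
def uniform (n : ℕ) : RandComp ℕ := fun x c =>
  open Classical in if x < n ∧ c = ⟨0, 0, n.size + 1⟩ then (n : ℝ≥0∞)⁻¹ else 0

end RandComp

open RandComp

/-- The time charged for one primality test of `m`, and for one factorization of `p𝓞_K`. -/
structure Prices where
  test : ℕ → ℕ
  split : ℕ → ℕ

/-- A primality test. -/
def primalityTest (P : Prices) (m : ℕ) : RandComp Bool := pay ⟨1, 0, P.test m⟩ (decide m.Prime)

/-! ## Step 1: the decreasing lists -/

/-- The residues `b` modulo `d` that get a list: the odd ones below `d` if `d` is even, all of
`1, …, d - 1` if `d ≥ 3` is odd, and the single list `b = 1` if `d = 1`. -/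
def residues (d : ℕ) : List ℕ :=
  (List.range' 1 (max 1 (d - 1))).filter fun b => decide (Even d → Odd b)

/-- The least `N' ≥ N` with `N' ≡ d - 1 (mod d)`. -/
def roundUp (d N : ℕ) : ℕ := N / d * d + (d - 1)

/-- A random index in `{0, …, j}`: `0` with probability `1 / (j d + 1)` and every other index
with probability `d / (j d + 1)`. -/
def nextIndex (d j : ℕ) : RandComp ℕ :=
  (mul j d).bind fun jd => (add jd 1).bind fun m => (uniform m).bind fun x =>
  (add x (d - 1)).bind fun y => div y d

/-- The list `s₁ ≥ s₂ ≥ ⋯ ≥ s_l = 1` for the residue `b`, written from its last entry to its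
first. The index `j = 0` stands for the entry `1`, and `j ≥ 1` for the entry `j d + b`. The first
index is drawn from `{0, …, J}`, where `J d + b` is the largest entry that is at most `N'`. -/
def generateList (d N b : ℕ) : RandComp (List ℕ) :=
  (div N d).bind fun k => (mul k d).bind fun kd => (add kd (d - 1)).bind fun N' =>
  (sub N' b).bind fun x => (div x d).bind fun J =>
  loop (fun st : ℕ × List ℕ => (nextIndex d st.1).bind fun j =>
      if j = 0 then charge 1 (Sum.inr (1 :: st.2))
      else (mul j d).bind fun jd => (add jd b).bind fun s =>
        charge 1 (Sum.inl (j, s :: st.2)))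
    (J, [])

/-! ## Steps 2 and 3: the random integer and its prime factorization -/

/-- Multiply an integer, given with its list of pairs (prime, exponent), by the prime `p`. Equal
primes always arrive one after the other. -/
def multiplyBy (x : ℕ × List (ℕ × ℕ)) (p : ℕ) : RandComp (ℕ × List (ℕ × ℕ)) :=
  (mul x.1 p).bind fun r =>
    match x.2 with
    | [] => charge 1 (r, [(p, 1)])
    | (q, e) :: l => (eq q p).bind fun same =>
        if same then (add e 1).bind fun e' => charge 1 (r, (q, e') :: l)
        else charge 1 (r, (p, 1) :: (q, e) :: l)

/-- Multiply by those entries of a list that are prime. -/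
def multiplyByPrimes (P : Prices) (x : ℕ × List (ℕ × ℕ)) (l : List ℕ) :
    RandComp (ℕ × List (ℕ × ℕ)) :=
  foldList (fun x s => (primalityTest P s).bind fun isPrime =>
    if isPrime then multiplyBy x s else ret x) x l

/-- Keep multiplying by `p` with probability `(p - 1) / p`, until the first failure. -/
def multiplySmall (p : ℕ) (x : ℕ × List (ℕ × ℕ)) : RandComp (ℕ × List (ℕ × ℕ)) :=
  loop (fun x => (uniform p).bind fun y => (eq y 0).bind fun failure =>
    if failure then ret (Sum.inr x) else (multiplyBy x p).bind fun x' => ret (Sum.inl x')) x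

/-- Steps 1 to 3: a random integer `r` with its prime factorization. -/
def generate (P : Prices) (d N : ℕ) : RandComp (ℕ × List (ℕ × ℕ)) :=
  (foldList (fun x b => (generateList d N b).bind fun l => multiplyByPrimes P x l)
    (1, []) (residues d)).bind fun x =>
  foldList (fun x p => (primalityTest P p).bind fun isPrime =>
    if isPrime then multiplySmall p x else ret x) x (List.range' 2 (d - 1))

/-! ## Step 4: acceptance -/

/-- The representative of `n` modulo `d` in `{1, …, d}`. If `d ≥ 2` and `n > d` is prime, this is
the residue of `n` modulo `d`. -/
def residue (d n : ℕ) : ℕ := (n - 1) % d + 1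

section

variable (K : Type u) [Field K] [NumberField K]

/-- A prime ideal `𝔭` above a rational prime, its exponent in the factorization of `p𝓞_K`, and
its residue degree `f`, so that `𝔭` has norm `p ^ f`. -/
structure PrimeAbove where
  ideal : Ideal (𝓞 K)
  ramification : ℕ
  degree : ℕ

open Classical in
/-- The factorization of `p𝓞_K`. -/
def splittingData (p : ℕ) : List (PrimeAbove K) :=
  let F := UniqueFactorizationMonoid.normalizedFactors (Ideal.span {(p : 𝓞 K)})
  F.toFinset.toList.map fun 𝔭 => ⟨𝔭, F.count 𝔭, Ideal.inertiaDeg' (Ideal.span {(p : ℤ)}) 𝔭⟩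

/-- Factor `p𝓞_K`. -/
def factorPrime (P : Prices) (p : ℕ) : RandComp (List (PrimeAbove K)) :=
  pay ⟨0, 1, P.split p⟩ (splittingData K p)

end

/-- One step of the dynamic program: from the numbers of solutions `row[j]` for `j ≤ e`, allow one
more summand `f`. -/
def solutionRow (e : ℕ) (row : List ℕ) (f : ℕ) : RandComp (List ℕ) :=
  foldList (fun new j => (read row j).bind fun x => (le f j).bind fun fits =>
    if fits then (sub j f).bind fun i => (read new i).bind fun y => (add x y).bind fun z =>
      charge 1 (new ++ [z])
    else charge 1 (new ++ [x])) [] (List.range (e + 1))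

/-- The number of solutions `(c₁, …, c_m)` of `∑ cᵢ fᵢ = e` in natural numbers. -/
def countSolutions (fs : List ℕ) (e : ℕ) : RandComp ℕ :=
  (charge (e + 1) (1 :: List.replicate e 0)).bind fun row =>
  (foldList (solutionRow e) row fs).bind fun row => read row e

/-- A prime power `p ^ e` and the factorization of `p𝓞_K`. -/
structure PrimePower (K : Type u) [Field K] [NumberField K] where
  prime : ℕ
  exponent : ℕ
  above : List (PrimeAbove K)

/-- An integer, its prime factorization, and the splitting data of its prime factors. -/
structure FactoredNorm (K : Type u) [Field K] [NumberField K] where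
  norm : ℕ
  factors : List (PrimePower K)

/-- The binomial coefficient `(d + ⌊log₂ N⌋ - 1 choose ⌊log₂ N⌋)`. -/
def alphaInv (d N : ℕ) : RandComp ℕ :=
  (log2 N).bind fun L =>
  (foldList (fun x i => (add L i).bind fun y => mul x y) 1 (List.range' 1 (d - 1))).bind fun x =>
  (foldList (fun y i => mul y i) 1 (List.range' 1 (d - 1))).bind fun y => div x y

/-- `N` times one factor `α⁻¹` for every prime `p ≤ d`. -/
def baseDenominator (P : Prices) (d N : ℕ) : RandComp ℕ :=
  (alphaInv d N).bind fun a =>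
  foldList (fun x p => (primalityTest P p).bind fun isPrime =>
    if isPrime then mul x a else ret x) N (List.range' 2 (d - 1))

section

variable (K : Type u) [Field K] [NumberField K]

/-- The numerator `ψ(r) D(r)` and the denominator `base * ∏_{p ≤ d} (p - 1)^{v_p(r)} * d^{Ω_d(r)}`
of the acceptance probability of `r`, from the prime factorization of `r`, with the splitting
data that was used. -/
def acceptanceRatio (P : Prices) (d base : ℕ) (l : List (ℕ × ℕ)) :
    RandComp (ℕ × ℕ × List (PrimePower K)) :=
  foldList (fun x q =>
      (factorPrime K P q.1).bind fun S =>
      (charge S.length (S.map PrimeAbove.degree)).bind fun fs =>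
      (countSolutions fs q.2).bind fun D =>
      (le q.1 d).bind fun small =>
      (if small then
        (sub q.1 1).bind fun b => ret (q.1, b)
      else
        (sub q.1 1).bind fun y => (mod y d).bind fun z => (add z 1).bind fun t =>
        (sub q.1 t).bind fun a => (add a 1).bind fun a => ret (a, d)).bind fun ab =>
      (pow ab.1 q.2).bind fun a => (pow ab.2 q.2).bind fun b =>
      (mul x.1 D).bind fun num => (mul num a).bind fun num =>
      (mul x.2.1 b).bind fun den =>
      charge 1 (num, den, ⟨q.1, q.2, S⟩ :: x.2.2))
    (1, base, []) l

/-- Step 4: reject `r > N`; otherwise accept `r` with the acceptance probability. -/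
def acceptStep (P : Prices) (d N : ℕ) (x : ℕ × List (ℕ × ℕ)) :
    RandComp (Option (FactoredNorm K)) :=
  (le x.1 N).bind fun fits =>
    if fits then
      (baseDenominator P d N).bind fun base =>
      (acceptanceRatio K P d base x.2).bind fun y =>
      (uniform y.2.1).bind fun t => (le y.1 t).bind fun reject =>
        ret (if reject then none else some ⟨x.1, y.2.2⟩)
    else ret none

/-- One round, steps 1 to 4; the result is `none` if the integer is rejected. -/
def round (P : Prices) (N : ℕ) : RandComp (Option (FactoredNorm K)) :=
  (generate P (Module.finrank ℚ K) N).bind fun x =>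
    acceptStep K P (Module.finrank ℚ K) N x

/-- The algorithm for random factored norms: repeat rounds until one accepts. -/
def randomNorm (P : Prices) (N : ℕ) : RandComp (FactoredNorm K) :=
  loop (fun _ : Unit => (round K P N).bind fun x =>
    ret (x.elim (Sum.inl ()) fun r => Sum.inr r)) ()

end

/-! ## From the norm to the ideal -/

/-- All solutions `(c₁, …, c_m)` of `∑ cᵢ fᵢ = e` in natural numbers. -/
def solutions : List ℕ → ℕ → RandComp (List (List ℕ))
  | [], e => charge 1 (if e = 0 then [[]] else [])
  | f :: fs, e => (div e f).bind fun q =>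
      foldList (fun acc c => (mul c f).bind fun cf => (sub e cf).bind fun e' =>
        (solutions fs e').bind fun l =>
          charge (l.length + 1) (l.map (fun cs => c :: cs) ++ acc)) [] (List.range (q + 1))

section

variable (K : Type u) [Field K] [NumberField K]

/-- A uniformly random solution of `∑ cᵢ fᵢ = e` for every prime power `p ^ e`, giving the ideal
`∏ 𝔭ᵢ ^ cᵢ`; the result is the list of all pairs `(𝔭ᵢ, cᵢ)` with `cᵢ > 0`. -/
def pickIdeal (l : List (PrimePower K)) : RandComp (List (Ideal (𝓞 K) × ℕ)) :=
  foldList (fun acc q =>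
    (charge q.above.length (q.above.map PrimeAbove.degree)).bind fun fs =>
    (solutions fs q.exponent).bind fun sols =>
    (uniform sols.length).bind fun i =>
    charge (i.size + q.above.length + 1)
      ((((q.above.map PrimeAbove.ideal).zip (sols.getD i [])).filter fun y => decide (0 < y.2))
        ++ acc)) [] l

/-- The whole algorithm: a random norm, then a random ideal of that norm, with its prime
factorization. -/
def randomIdeal (P : Prices) (N : ℕ) : RandComp (ℕ × List (Ideal (𝓞 K) × ℕ)) :=
  (randomNorm K P N).bind fun r => (pickIdeal K r.factors).bind fun I => ret (r.norm, I)

end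

/-! ## The quantities in the analysis -/

/-- `l` is the prime factorization of `x`: distinct primes with positive exponents. -/
def IsFactorizationOf {M : Type v} [CommMonoidWithZero M] (l : List (M × ℕ)) (x : M) : Prop :=
  (l.map Prod.fst).Nodup ∧ (∀ q ∈ l, Prime q.1 ∧ 0 < q.2) ∧
    (l.map fun q => q.1 ^ q.2).prod = x

/-- The number `D(r)` of ideals of `𝓞_K` of norm `r`, for `r ≥ 1`. -/
def idealCount (K : Type u) [Field K] [NumberField K] (r : ℕ) : ℕ :=
  Nat.card {I : Ideal (𝓞 K) // Ideal.absNorm I = r}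

/-- The number of nonzero ideals of `𝓞_K` of norm at most `N`. -/
def idealCountLE (K : Type u) [Field K] [NumberField K] (N : ℕ) : ℕ :=
  Nat.card {I : Ideal (𝓞 K) // I ≠ ⊥ ∧ Ideal.absNorm I ≤ N}

/-- The primes `p` with `a < p ≤ b`. -/
def primesIoc (a b : ℕ) : Finset ℕ := (Finset.Ioc a b).filter Nat.Prime

/-- `α`, the inverse of the binomial coefficient `(d + ⌊log₂ N⌋ - 1 choose ⌊log₂ N⌋)`. -/
def alpha (d N : ℕ) : ℝ := ((d + Nat.log 2 N - 1).choose (Nat.log 2 N) : ℝ)⁻¹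

/-- `M_d(r)`. -/
def smallPrimeFactor (d N r : ℕ) : ℝ :=
  ∏ p ∈ primesIoc 0 d, alpha d N * (1 / ((p : ℝ) - 1)) ^ r.factorization p

/-- `ψ(r)`: every prime factor `p > d` of `r` is replaced by `p - p̄ + 1`. -/
def psi (d r : ℕ) : ℕ :=
  r.factorization.prod fun p e => (if p ≤ d then p else p - residue d p + 1) ^ e

/-- `Ω_d(r)`: the number of prime factors of `r` greater than `d`, with multiplicity. -/
def bigOmegaAbove (d r : ℕ) : ℕ := ∑ p ∈ r.primeFactors with d < p, r.factorization p

/-- The probability with which a generated integer `r ≤ N` is to be kept. -/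
def acceptProb (K : Type u) [Field K] [NumberField K] (N r : ℕ) : ℝ :=
  let d := Module.finrank ℚ K
  smallPrimeFactor d N r * (psi d r * idealCount K r) / (d ^ bigOmegaAbove d r * N)

/-- The factor of proportionality between `D(r)` and the probability that one round ends with the
acceptance of `r`. -/
def roundFactor (d N : ℕ) : ℝ :=
  1 / N * (∏ p ∈ primesIoc 0 d, alpha d N / p) *
    ∏ p ∈ primesIoc d (roundUp d N), (1 - d / ((p : ℝ) - residue d p + 1))

/-- `x` is the integer `r`, given with its prime factorization. -/
def IsFactoredNorm {K : Type u} [Field K] [NumberField K] (r : ℕ) (x : FactoredNorm K) : Prop :=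
  x.norm = r ∧ IsFactorizationOf (x.factors.map fun q => (q.prime, q.exponent)) r

end FactoredIdeals

end

open FactoredIdeals RandComp

namespace FactoredIdeals

universe u v w

/-! Write `q_p = d / (p - p̄ + 1)` for primes `p > d` and `q_p = (p - 1) / p` for `p ≤ d`. The
random integer is a product of independent geometric powers: `p` occurs exactly `e` times with
probability `(1 - q_p) q_p ^ e`. For small primes this is step 3. For large ones it comes from one
identity: a draw from the indices up to `J + 1` hits `J + 1` with probability `d / ((J + 1) d + 1)`
and, given that it does not, is distributed like a draw from the indices up to `J`
(`mean_listLoop_succ`). So the multiplicities of the values of a list are independent geometric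
variables, and composite values drop out. Every prime in `(d, N']` lies in exactly one of the
residue classes that get a list.

For `r ≤ N` the acceptance probability cancels all powers `q_p ^ v_p(r)`: the factor `ψ(r) / d ^
Ω_d(r)` removes those with `p > d`, and `p ^ v / (p - 1) ^ v` those with `p ≤ d`. What remains is a
constant times `D(r)` (`geometricWeight_mul_acceptProb`). The acceptance probability is at most `1`
because `D` is multiplicative and `D(p ^ e)` counts the solutions of `∑ cᵢ fᵢ = e` with `∑ fᵢ ≤ d`.
This number is at most the multiset coefficient `d.multichoose e`, hence at most `d ^ e`, and at
most `α⁻¹` when `e ≤ log₂ N`. Repeating rounds conditions on acceptance. Given `r`, independent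
uniform solutions for the prime powers of `r` give a uniform ideal of norm `r`, since such an ideal
is uniquely a product of ideals of the coprime norms `p ^ e`. The factors `D(r)` and `1 / D(r)`
cancel.

For the cost, the acceptance rate of a round is `c_N ∑_{s ≤ N} D(s)`. The sum is at least a constant
times `N`, by the density of ideals and the positivity of the residue of the Dedekind zeta function.
A Chebyshev bound on dyadic intervals gives `∑ 1 / p ≤ 2 log log N + O(1)`, hence `∏ (1 - q_p) ≫
(log N) ^ (-2d)`. The at most `d - 1` small primes cost a factor `(log N) ^ (-(d - 1)²)`. Since `(d
- 1)² + 2d ≤ d² + d`, the expected number of rounds is `O((log N) ^ (d² + d))`. One round makes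
`O(log N)` expected calls and `O((log N) ^ 4)` arithmetic steps.

Formally, `mean` is the expectation of a function of the result and `ert` adds the cost, measured by
an additive map `g`; one analysis with unit prices `w`, `τ`, `σ` then yields all three cost bounds.
Loops are suprema over their fuel. Their means are found by solving the loop recursion, whose
bounded solution is unique (`eq_of_contracting`), and their costs by exhibiting a potential
(`ert_loop_le`). -/

theorem Cost.add_def (a b : Cost) :
    a + b = ⟨a.tests + b.tests, a.splittings + b.splittings, a.time + b.time⟩ := rfl

theorem Cost.zero_def : (0 : Cost) = ⟨0, 0, 0⟩ := rfl

instance : AddCommMonoid Cost where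
  add_assoc a b c := by simp only [Cost.add_def, Nat.add_assoc]
  zero_add a := by simp only [Cost.add_def, Cost.zero_def, Nat.zero_add]
  add_zero a := by simp only [Cost.add_def, Cost.zero_def, Nat.add_zero]
  add_comm a b := by simp only [Cost.add_def, Nat.add_comm]
  nsmul := nsmulRec

/-! ### Expectations over results and costs -/

namespace RandComp

variable {α : Type u} {β : Type v} {σ : Type w}

/-- The expectation of a function of the result and the cost, over the halting runs. -/
noncomputable def lexp (m : RandComp α) (φ : α → Cost → ℝ≥0∞) : ℝ≥0∞ :=
  ∑' a, ∑' c, m a c * φ a c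

theorem lexp_pay (c₀ : Cost) (a : α) (φ : α → Cost → ℝ≥0∞) : lexp (pay c₀ a) φ = φ a c₀ := by
  unfold lexp pay
  rw [tsum_eq_single a, tsum_eq_single c₀]
  · simp
  · intro c hc; simp [hc]
  · intro b hb; simp [hb]

theorem lexp_bind (m : RandComp α) (f : α → RandComp β) (φ : β → Cost → ℝ≥0∞) :
    lexp (m.bind f) φ = lexp m fun a c₁ => lexp (f a) fun b c₂ => φ b (c₁ + c₂) := by
  classical
  unfold lexp bind
  simp_rw [← ENNReal.tsum_mul_right, ← ENNReal.tsum_mul_left]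
  have h1 : ∀ b : β, (∑' (c : Cost) (a : α) (c₁ : Cost) (c₂ : Cost),
      (if c₁ + c₂ = c then m a c₁ * f a b c₂ else 0) * φ b c) =
      ∑' (a : α) (c₁ : Cost) (c₂ : Cost), m a c₁ * (f a b c₂ * φ b (c₁ + c₂)) := by
    intro b
    rw [ENNReal.tsum_comm]
    refine tsum_congr fun a => ?_
    rw [ENNReal.tsum_comm]
    refine tsum_congr fun c₁ => ?_
    rw [ENNReal.tsum_comm]
    refine tsum_congr fun c₂ => ?_
    rw [tsum_eq_single (c₁ + c₂)]
    · simp [mul_assoc]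
    · intro c hc
      simp [Ne.symm hc]
  have h2 : ∀ b : β, (∑' (c : Cost) (a : α) (c₁ : Cost) (c₂ : Cost),
      (if c₁ + c₂ = c then m a c₁ * f a b c₂ else 0) * φ b c) =
      ∑' (a : α) (c₁ : Cost) (c₂ : Cost), m a c₁ * (f a b c₂ * φ b (c₁ + c₂)) := h1
  calc _ = ∑' (b : β) (a : α) (c₁ : Cost) (c₂ : Cost),
        m a c₁ * (f a b c₂ * φ b (c₁ + c₂)) := by
        refine tsum_congr fun b => ?_
        rw [← h2 b]
    _ = _ := by
        rw [ENNReal.tsum_comm]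
        refine tsum_congr fun a => ?_
        rw [ENNReal.tsum_comm]

theorem lexp_uniform (n : ℕ) (φ : ℕ → Cost → ℝ≥0∞) :
    lexp (uniform n) φ = (n : ℝ≥0∞)⁻¹ * ∑ x ∈ Finset.range n, φ x ⟨0, 0, n.size + 1⟩ := by
  unfold lexp uniform
  rw [tsum_eq_sum (s := Finset.range n), Finset.mul_sum]
  · refine Finset.sum_congr rfl fun x hx => ?_
    rw [tsum_eq_single ⟨0, 0, n.size + 1⟩]
    · simp [Finset.mem_range.1 hx]
    · intro c hc; simp [hc]
  · intro x hx
    have : ¬ x < n := by simpa using hx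
    simp [this]

theorem lexp_mono_of (m : RandComp α) {φ ψ : α → Cost → ℝ≥0∞}
    (h : ∀ a c, m a c ≠ 0 → φ a c ≤ ψ a c) : lexp m φ ≤ lexp m ψ := by
  refine ENNReal.tsum_le_tsum fun a => ENNReal.tsum_le_tsum fun c => ?_
  by_cases h0 : m a c = 0
  · simp [h0]
  · gcongr; exact h a c h0

theorem lexp_mono (m : RandComp α) {φ ψ : α → Cost → ℝ≥0∞} (h : ∀ a c, φ a c ≤ ψ a c) :
    lexp m φ ≤ lexp m ψ := lexp_mono_of m fun a c _ => h a c

theorem lexp_mono_left {m m' : RandComp α} (h : ∀ a c, m a c ≤ m' a c) (φ : α → Cost → ℝ≥0∞) :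
    lexp m φ ≤ lexp m' φ := by
  refine ENNReal.tsum_le_tsum fun a => ENNReal.tsum_le_tsum fun c => ?_
  gcongr; exact h a c

theorem lexp_add (m : RandComp α) (φ ψ : α → Cost → ℝ≥0∞) :
    lexp m (fun a c => φ a c + ψ a c) = lexp m φ + lexp m ψ := by
  simp only [lexp, mul_add, ENNReal.tsum_add]

theorem lexp_const_mul (m : RandComp α) (k : ℝ≥0∞) (φ : α → Cost → ℝ≥0∞) :
    lexp m (fun a c => k * φ a c) = k * lexp m φ := by
  simp only [lexp, mul_left_comm _ k, ENNReal.tsum_mul_left]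

@[simp] theorem lexp_zero (m : RandComp α) : lexp m (fun _ _ => 0) = 0 := by
  simp [lexp]

theorem lexp_sum {ι : Type*} (s : Finset ι) (m : RandComp α) (φ : ι → α → Cost → ℝ≥0∞) :
    lexp m (fun a c => ∑ i ∈ s, φ i a c) = ∑ i ∈ s, lexp m (φ i) := by
  classical
  induction s using Finset.induction_on with
  | empty => simp
  | insert i s hi ih => simp only [Finset.sum_insert hi, lexp_add, ih]

/-- Monotone convergence for sums. It carries statements about `loopFuel` over to `loop`, which is
the supremum over the fuel. -/
theorem tsum_iSup_of_monotone {ι : Type*} {f : ℕ → ι → ℝ≥0∞} (hf : Monotone f) :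
    ∑' i, ⨆ n, f n i = ⨆ n, ∑' i, f n i := by
  refine le_antisymm ?_ ?_
  · rw [ENNReal.tsum_eq_iSup_sum]
    refine iSup_le fun s => ?_
    rw [ENNReal.finsetSum_iSup_of_monotone fun i => fun a b hab => hf hab i]
    exact iSup_mono fun n => ENNReal.sum_le_tsum s
  · exact iSup_le fun n => ENNReal.tsum_le_tsum fun i => le_iSup (fun n => f n i) n

theorem lexp_iSup (m : RandComp α) {φ : ℕ → α → Cost → ℝ≥0∞} (h : Monotone φ) :
    lexp m (fun a c => ⨆ n, φ n a c) = ⨆ n, lexp m (φ n) := by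
  unfold lexp
  simp_rw [ENNReal.mul_iSup]
  rw [← tsum_iSup_of_monotone]
  · refine tsum_congr fun a => ?_
    rw [← tsum_iSup_of_monotone]
    intro n k hnk c
    exact mul_le_mul_right (h hnk a c) _
  · intro n k hnk a
    exact ENNReal.tsum_le_tsum fun c => mul_le_mul_right (h hnk a c) _

theorem lexp_iSup_left {m : ℕ → RandComp α} (h : ∀ n k, n ≤ k → ∀ a c, m n a c ≤ m k a c)
    (φ : α → Cost → ℝ≥0∞) : lexp (fun a c => ⨆ n, m n a c) φ = ⨆ n, lexp (m n) φ := by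
  unfold lexp
  simp_rw [ENNReal.iSup_mul]
  rw [← tsum_iSup_of_monotone]
  · refine tsum_congr fun a => ?_
    rw [← tsum_iSup_of_monotone]
    intro n k hnk c
    exact mul_le_mul_left (h n k hnk a c) _
  · intro n k hnk a
    exact ENNReal.tsum_le_tsum fun c => mul_le_mul_left (h n k hnk a c) _

theorem bind_mono_right {m : RandComp α} {f f' : α → RandComp β} (h : ∀ a b c, f a b c ≤ f' a b c)
    (b : β) (c : Cost) : m.bind f b c ≤ m.bind f' b c := by
  unfold bind
  refine ENNReal.tsum_le_tsum fun a => ENNReal.tsum_le_tsum fun c₁ =>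
    ENNReal.tsum_le_tsum fun c₂ => ?_
  split_ifs
  · gcongr; exact h a b c₂
  · rfl

theorem loopFuel_le_succ (body : σ → RandComp (σ ⊕ α)) (n : ℕ) (s : σ) (a : α) (c : Cost) :
    loopFuel body n s a c ≤ loopFuel body (n + 1) s a c := by
  induction n generalizing s a c with
  | zero => exact zero_le
  | succ n ih =>
    rw [loopFuel, loopFuel]
    refine bind_mono_right (fun s => bind_mono_right fun x => ?_) a c
    rcases x with s' | a'
    · exact fun b c => ih s' b c
    · exact fun b c => le_rfl

theorem loopFuel_mono (body : σ → RandComp (σ ⊕ α)) (s : σ) {n k : ℕ} (h : n ≤ k) (a : α)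
    (c : Cost) : loopFuel body n s a c ≤ loopFuel body k s a c :=
  monotone_nat_of_le_succ (f := fun n => loopFuel body n s a c)
    (fun n => loopFuel_le_succ body n s a c) h

theorem lexp_loop (body : σ → RandComp (σ ⊕ α)) (s : σ) (φ : α → Cost → ℝ≥0∞) :
    lexp (loop body s) φ = ⨆ n, lexp (loopFuel body n s) φ :=
  lexp_iSup_left (fun _ _ h a c => loopFuel_mono body s h a c) φ

theorem lexp_loopFuel_succ (body : σ → RandComp (σ ⊕ α)) (n : ℕ) (s : σ)
    (φ : α → Cost → ℝ≥0∞) :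
    lexp (loopFuel body (n + 1) s) φ = lexp (body s) fun x c =>
      Sum.elim (fun s' => lexp (loopFuel body n s') fun a c' => φ a (⟨0, 0, 1⟩ + (c + c')))
        (fun a => φ a (⟨0, 0, 1⟩ + c)) x := by
  rw [loopFuel, lexp_bind, charge, lexp_pay, lexp_bind]
  congr 1
  funext x c
  rcases x with s' | a
  · rfl
  · simp [ret, lexp_pay]

/-! ## Expectations of functions of the result -/

/-- The expectation of a function of the result. -/
noncomputable def mean (m : RandComp α) (φ : α → ℝ≥0∞) : ℝ≥0∞ := lexp m fun a _ => φ a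

@[simp] theorem mean_pay (c : Cost) (a : α) (φ : α → ℝ≥0∞) : (pay c a).mean φ = φ a :=
  lexp_pay ..

@[simp] theorem mean_ret (a : α) (φ : α → ℝ≥0∞) : (ret a).mean φ = φ a := lexp_pay ..

@[simp] theorem mean_charge (t : ℕ) (a : α) (φ : α → ℝ≥0∞) : (charge t a).mean φ = φ a :=
  lexp_pay ..

@[simp] theorem mean_bind (m : RandComp α) (f : α → RandComp β) (φ : β → ℝ≥0∞) :
    (m.bind f).mean φ = m.mean fun a => (f a).mean φ := lexp_bind ..

theorem mean_uniform (n : ℕ) (φ : ℕ → ℝ≥0∞) :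
    (uniform n).mean φ = (n : ℝ≥0∞)⁻¹ * ∑ x ∈ Finset.range n, φ x := lexp_uniform ..

theorem mean_mono (m : RandComp α) {φ ψ : α → ℝ≥0∞} (h : ∀ a, φ a ≤ ψ a) :
    m.mean φ ≤ m.mean ψ := lexp_mono m fun a _ => h a

theorem mean_iSup (m : RandComp α) {φ : ℕ → α → ℝ≥0∞} (h : Monotone φ) :
    (m.mean fun a => ⨆ n, φ n a) = ⨆ n, m.mean (φ n) :=
  lexp_iSup m fun _ _ hnk a _ => h hnk a

theorem mean_const_mul (m : RandComp α) (k : ℝ≥0∞) (φ : α → ℝ≥0∞) :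
    (m.mean fun a => k * φ a) = k * m.mean φ := lexp_const_mul ..

theorem mean_add (m : RandComp α) (φ ψ : α → ℝ≥0∞) :
    (m.mean fun a => φ a + ψ a) = m.mean φ + m.mean ψ := lexp_add ..

@[simp] theorem mean_zero (m : RandComp α) : (m.mean fun _ => 0) = 0 := lexp_zero m

/-- The loop is a fixed point of its unfolding, by monotone convergence in the fuel. The equation
alone does not determine the mean; a bound by `1` together with a contraction does. -/
theorem mean_loop (body : σ → RandComp (σ ⊕ α)) (s : σ) (φ : α → ℝ≥0∞) :
    (loop body s).mean φ = (body s).mean (Sum.elim (fun s' => (loop body s').mean φ) φ) := by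
  have hs : ∀ s, (loop body s).mean φ = ⨆ n, (loopFuel body n s).mean φ :=
    fun s => lexp_loop body s _
  have hmono : ∀ s, Monotone fun n => (loopFuel body n s).mean φ := fun s n k h =>
    lexp_mono_left (loopFuel_mono body s h) _
  have hstep : ∀ n, (loopFuel body (n + 1) s).mean φ =
      (body s).mean (Sum.elim (fun s' => (loopFuel body n s').mean φ) φ) :=
    fun n => lexp_loopFuel_succ ..
  -- Dropping the approximant with no fuel does not change the supremum of a monotone sequence.
  have h0 : (⨆ n, (loopFuel body n s).mean φ) = ⨆ n, (loopFuel body (n + 1) s).mean φ :=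
    ((hmono s).iSup_nat_add 1).symm
  rw [hs, h0]
  simp_rw [hstep, hs]
  rw [← mean_iSup]
  · congr 1
    funext x
    rcases x with s' | a
    · rfl
    · simp
  · intro n k h x
    rcases x with s' | a
    · exact hmono s' h
    · exact le_rfl

theorem pr_eq_mean (m : RandComp α) (E : α → Prop) [DecidablePred E] :
    m.pr E = m.mean fun a => if E a then 1 else 0 := by
  unfold pr mean lexp
  have := tsum_subtype {a | E a} fun a => ∑' c, m a c
  refine this.trans (tsum_congr fun a => ?_)
  by_cases h : E a <;> simp [Set.indicator, h]

/-- The probability of halting is at most one. -/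
def IsSub (m : RandComp α) : Prop := (m.mean fun _ => 1) ≤ 1

theorem IsSub.mean_le {m : RandComp α} (hm : m.IsSub) {φ : α → ℝ≥0∞} {k : ℝ≥0∞} (h : ∀ a, φ a ≤ k) :
    m.mean φ ≤ k :=
  calc m.mean φ ≤ m.mean fun _ => k * 1 := mean_mono m fun a => by simpa using h a
    _ = k * m.mean fun _ => 1 := mean_const_mul ..
    _ ≤ k := mul_le_of_le_one_right' hm

theorem sub_pay (c : Cost) (a : α) : (pay c a).IsSub := by simp [IsSub]

theorem sub_ret (a : α) : (ret a).IsSub := sub_pay ..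

theorem sub_charge (t : ℕ) (a : α) : (charge t a).IsSub := sub_pay ..

theorem sub_uniform (n : ℕ) : (uniform n).IsSub := by
  rw [IsSub, mean_uniform]
  simp [ENNReal.inv_mul_le_one]

theorem IsSub.bind {m : RandComp α} {f : α → RandComp β} (hm : m.IsSub) (hf : ∀ a, (f a).IsSub) :
    (m.bind f).IsSub := by
  rw [IsSub, mean_bind]
  exact hm.mean_le hf

theorem sub_loopFuel {body : σ → RandComp (σ ⊕ α)} (h : ∀ s, (body s).IsSub) (n : ℕ) (s : σ) :
    (loopFuel body n s).IsSub := by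
  induction n generalizing s with
  | zero => simp [IsSub, mean, lexp, loopFuel]
  | succ n ih =>
    refine (sub_charge 1 s).bind fun s => (h s).bind fun x => ?_
    rcases x with s' | a
    · exact ih s'
    · exact sub_ret a

theorem sub_loop {body : σ → RandComp (σ ⊕ α)} (h : ∀ s, (body s).IsSub) (s : σ) :
    (loop body s).IsSub := by
  rw [IsSub, mean, lexp_loop]
  exact iSup_le fun n => sub_loopFuel h n s

theorem sub_foldList {f : β → α → RandComp β} (h : ∀ b a, (f b a).IsSub) (l : List α) (b : β) :
    (foldList f b l).IsSub := by
  induction l generalizing b with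
  | nil => exact sub_charge ..
  | cons a l ih => exact (sub_charge ..).bind fun b => (h b a).bind fun b' => ih b'

/-! ## Possible results -/

/-- Every possible result satisfies `Q`. -/
def AllOut (m : RandComp α) (Q : α → Prop) : Prop := ∀ a c, m a c ≠ 0 → Q a

theorem AllOut.mono {m : RandComp α} {Q R : α → Prop} (hm : m.AllOut Q) (h : ∀ a, Q a → R a) :
    m.AllOut R := fun a c hc => h a (hm a c hc)

theorem allOut_pay {c : Cost} {a : α} {Q : α → Prop} (h : Q a) : (pay c a).AllOut Q := by
  intro x c' hx
  have : x = a ∧ c' = c := by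
    by_contra hn; exact hx (by simp [pay, hn])
  exact this.1 ▸ h

theorem allOut_ret {a : α} {Q : α → Prop} (h : Q a) : (ret a).AllOut Q := allOut_pay h

theorem allOut_charge {t : ℕ} {a : α} {Q : α → Prop} (h : Q a) : (charge t a).AllOut Q :=
  allOut_pay h

theorem allOut_uniform (n : ℕ) : (uniform n).AllOut fun x => x < n := by
  intro x c hx
  by_contra hn; exact hx (by simp [uniform, hn])

theorem AllOut.bind {m : RandComp α} {f : α → RandComp β} {Q : α → Prop} {R : β → Prop}
    (hm : m.AllOut Q) (hf : ∀ a, Q a → (f a).AllOut R) : (m.bind f).AllOut R := by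
  intro b c hb
  by_contra hR
  refine hb ?_
  unfold RandComp.bind
  simp only [ENNReal.tsum_eq_zero]
  intro a c₁ c₂
  split_ifs with hc
  · by_cases h0 : m a c₁ = 0
    · simp [h0]
    · have : f a b c₂ = 0 := by
        by_contra h1; exact hR (hf a (hm a c₁ h0) b c₂ h1)
      simp [this]
  · rfl

/-- Partial correctness by a loop invariant `I`. Halting plays no role, because only results of
positive weight are constrained. -/
theorem allOut_loop {body : σ → RandComp (σ ⊕ α)} (I : σ → Prop) {Q : α → Prop}
    (h : ∀ s, I s → (body s).AllOut (Sum.elim I Q)) {s : σ} (hs : I s) :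
    (loop body s).AllOut Q := by
  have key : ∀ n s, I s → (loopFuel body n s).AllOut Q := by
    intro n
    induction n with
    | zero => intro s _ a c hc; exact absurd rfl hc
    | succ n ih =>
      intro s hs
      refine (allOut_charge (Q := I) hs).bind fun s hs => (h s hs).bind fun x hx => ?_
      rcases x with s' | a
      · exact ih s' hx
      · exact allOut_ret hx
  intro a c hc
  have : ∃ n, loopFuel body n s a c ≠ 0 := by
    by_contra hn
    push Not at hn
    exact hc (by simp [loop, hn])
  obtain ⟨n, hn⟩ := this
  exact key n s hs a c hn

/-- The invariant sees the entries still to be processed, so it can express that the state does not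
yet meet them. -/
theorem allOut_foldList {f : β → α → RandComp β} (I : β → List α → Prop)
    (h : ∀ b a l, I b (a :: l) → (f b a).AllOut fun b' => I b' l) {l : List α} {b : β}
    (hb : I b l) : (foldList f b l).AllOut fun b' => I b' [] := by
  induction l generalizing b with
  | nil => exact allOut_charge hb
  | cons a l ih =>
    exact (allOut_charge (Q := fun b => I b (a :: l)) hb).bind fun b hb =>
      (h b a l hb).bind fun b' hb' => ih hb'

theorem AllOut.mean_congr {m : RandComp α} {Q : α → Prop} (hm : m.AllOut Q) {φ ψ : α → ℝ≥0∞}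
    (h : ∀ a, Q a → φ a = ψ a) : m.mean φ = m.mean ψ :=
  le_antisymm (lexp_mono_of m fun a c hc => (h a (hm a c hc)).le)
    (lexp_mono_of m fun a c hc => (h a (hm a c hc)).ge)

/-! ## Expected costs -/

/-- The expected value of the cost, measured by `g`, plus a function of the result. -/
noncomputable def ert (g : Cost →+ ℝ≥0∞) (m : RandComp α) (Φ : α → ℝ≥0∞) : ℝ≥0∞ :=
  lexp m fun a c => g c + Φ a

variable {g : Cost →+ ℝ≥0∞}

theorem ert_pay (c : Cost) (a : α) (Φ : α → ℝ≥0∞) : ert g (pay c a) Φ = g c + Φ a := lexp_pay ..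

theorem ert_mono {m : RandComp α} {Q : α → Prop} (hm : m.AllOut Q) {Φ Ψ : α → ℝ≥0∞}
    (h : ∀ a, Q a → Φ a ≤ Ψ a) : ert g m Φ ≤ ert g m Ψ :=
  lexp_mono_of m fun a c hc => by gcongr; exact h a (hm a c hc)

theorem ert_mono' (m : RandComp α) {Φ Ψ : α → ℝ≥0∞} (h : ∀ a, Φ a ≤ Ψ a) :
    ert g m Φ ≤ ert g m Ψ := lexp_mono m fun a _ => by gcongr; exact h a

/-- A constant is counted with the halting mass, which is at most `1`. This is why sequencing costs
is an inequality here and needs `IsSub`. -/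
theorem lexp_le_ert {m : RandComp α} (hm : m.IsSub) (k : ℝ≥0∞) (Φ : α → ℝ≥0∞) :
    lexp m (fun a c => (k + g c) + Φ a) ≤ k + ert g m Φ := by
  have : (fun (a : α) c => (k + g c) + Φ a) = fun a c => k * 1 + (g c + Φ a) := by
    funext a c; ring
  rw [this, lexp_add, lexp_const_mul]
  exact add_le_add_left (mul_le_of_le_one_right' hm) _

theorem ert_bind_le (m : RandComp α) {f : α → RandComp β} (hf : ∀ a, (f a).IsSub)
    (Φ : β → ℝ≥0∞) : ert g (m.bind f) Φ ≤ ert g m fun a => ert g (f a) Φ := by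
  rw [ert, lexp_bind]
  refine lexp_mono m fun a c => ?_
  simp only [map_add]
  exact lexp_le_ert (hf a) _ _

theorem ert_bind_pay (c : Cost) (a : α) {f : α → RandComp β} (hf : (f a).IsSub)
    (Φ : β → ℝ≥0∞) : ert g ((pay c a).bind f) Φ ≤ g c + ert g (f a) Φ := by
  rw [ert, lexp_bind, lexp_pay]
  simp only [map_add]
  exact lexp_le_ert hf _ _

/-- A potential argument: if `Φ` pays for one pass and for the expected potential afterwards, it
bounds the cost for every amount of fuel, hence for the loop. Termination need not be known. -/
theorem ert_loop_le {body : σ → RandComp (σ ⊕ α)} (hb : ∀ s, (body s).IsSub) {Φ : σ → ℝ≥0∞}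
    {Ψ : α → ℝ≥0∞} (I : σ → Prop) (hI : ∀ s, I s → (body s).AllOut (Sum.elim I fun _ => True))
    (h : ∀ s, I s → g ⟨0, 0, 1⟩ + ert g (body s) (Sum.elim Φ Ψ) ≤ Φ s) {s : σ} (hs : I s) :
    ert g (loop body s) Ψ ≤ Φ s := by
  rw [ert, lexp_loop]
  refine iSup_le fun n => ?_
  change ert g (loopFuel body n s) Ψ ≤ Φ s
  induction n generalizing s with
  | zero => simp [ert, lexp, loopFuel]
  | succ n ih =>
    refine le_trans ?_ (h s hs)
    rw [loopFuel]
    refine (ert_bind_pay _ _ ?_ _).trans ?_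
    · exact (hb s).bind fun x => by
        rcases x with s' | a
        · exact sub_loopFuel hb n s'
        · exact sub_ret a
    · gcongr
      refine (ert_bind_le _ ?_ _).trans ?_
      · intro x
        rcases x with s' | a
        · exact sub_loopFuel hb n s'
        · exact sub_ret a
      · refine ert_mono (hI s hs) fun x hx => ?_
        rcases x with s' | a
        · exact ih hx
        · simp [ret, ert_pay]

theorem expected_eq_ert (m : RandComp α) (h : Cost → ℕ) (hg : ∀ c, g c = h c) :
    m.expected h = ert g m fun _ => 0 := by
  simp [expected, ert, lexp, hg]

end RandComp

end FactoredIdeals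

namespace FactoredIdeals

universe u v w

/-! ### Deterministic computations with a cost bound -/

namespace RandComp

variable {α : Type u} {β : Type v}

theorem bind_eq_pay {m : RandComp α} {f : α → RandComp β} {c c' : Cost} {a : α} {b : β}
    (hm : m = pay c a) (hf : f a = pay c' b) : m.bind f = pay (c + c') b := by
  classical
  subst hm
  funext x k
  unfold bind
  rw [tsum_eq_single a, tsum_eq_single c, tsum_eq_single c']
  · simp only [hf, pay]
    by_cases hx : x = b <;> by_cases hk : k = c + c' <;> simp [hx, hk, eq_comm]
  · intro c₂ h
    simp [hf, pay, h]
  · intro c₁ h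
    simp [pay, h]
  · intro a' h
    simp [pay, h]

/-- The computation is deterministic, with result `a`, and takes time at most `t`. -/
def Takes (m : RandComp α) (a : α) (t : ℕ) : Prop := ∃ t' ≤ t, m = charge t' a

theorem takes_charge {t t' : ℕ} (h : t ≤ t') (a : α) : Takes (charge t a) a t' := ⟨t, h, rfl⟩

theorem takes_ret (a : α) : Takes (ret a) a 0 := ⟨0, le_rfl, rfl⟩

theorem Takes.mono {m : RandComp α} {a : α} {t t' : ℕ} (h : Takes m a t) (ht : t ≤ t') :
    Takes m a t' := by
  obtain ⟨k, hk, rfl⟩ := h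
  exact ⟨k, hk.trans ht, rfl⟩

theorem Takes.bind {m : RandComp α} {f : α → RandComp β} {a : α} {b : β} {t t' : ℕ}
    (hm : Takes m a t) (hf : Takes (f a) b t') : Takes (m.bind f) b (t + t') := by
  obtain ⟨k, hk, rfl⟩ := hm
  obtain ⟨k', hk', hf⟩ := hf
  exact ⟨k + k', add_le_add hk hk', bind_eq_pay rfl hf⟩

/-- The state after `i` entries is prescribed as `S i`, so that bounds on the intermediate numbers
can be read off a closed form. -/
theorem takes_foldList {f : β → α → RandComp β} {t : ℕ} (l : List α) (S : ℕ → β)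
    (h : ∀ (i : ℕ) (hi : i < l.length), Takes (f (S i) l[i]) (S (i + 1)) t) :
    Takes (foldList f (S 0) l) (S l.length) (l.length * (t + 1) + 1) := by
  induction l generalizing S with
  | nil => exact takes_charge (by simp) _
  | cons a l ih =>
    have h0 := h 0 (by simp)
    have h1 := ih (fun i => S (i + 1)) fun i hi => h (i + 1) (by simpa using hi)
    have h2 : Takes (foldList f (S 0) (a :: l)) (S (l.length + 1)) _ :=
      (takes_charge le_rfl (S 0) : Takes (charge 1 (S 0)) (S 0) 1).bind
        (Takes.bind h0 h1)
    refine h2.mono (le_of_eq ?_)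
    simp only [List.length_cons]
    ring

/-- The computation is deterministic, with result `a`, and costs at most `k`, measured by `g`. -/
def Runs (g : Cost →+ ℝ≥0∞) (m : RandComp α) (a : α) (k : ℝ≥0∞) : Prop :=
  ∃ c, m = pay c a ∧ g c ≤ k

variable {g : Cost →+ ℝ≥0∞}

theorem runs_pay (c : Cost) (a : α) : Runs g (pay c a) a (g c) := ⟨c, rfl, le_rfl⟩

theorem runs_ret (a : α) : Runs g (ret a) a 0 := ⟨0, rfl, by simp⟩

theorem Runs.mono {m : RandComp α} {a : α} {k k' : ℝ≥0∞} (h : Runs g m a k) (hk : k ≤ k') :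
    Runs g m a k' := by
  obtain ⟨c, h1, h2⟩ := h
  exact ⟨c, h1, h2.trans hk⟩

theorem Takes.runs {w : ℝ≥0∞} (hw : ∀ t, g ⟨0, 0, t⟩ ≤ w * t) {m : RandComp α} {a : α} {t : ℕ}
    (h : Takes m a t) : Runs g m a (w * t) := by
  obtain ⟨k, hk, rfl⟩ := h
  exact ⟨_, rfl, (hw k).trans (by gcongr)⟩

theorem Runs.bind {m : RandComp α} {f : α → RandComp β} {a : α} {b : β} {k k' : ℝ≥0∞}
    (hm : Runs g m a k) (hf : Runs g (f a) b k') : Runs g (m.bind f) b (k + k') := by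
  obtain ⟨c, h1, h2⟩ := hm
  obtain ⟨c', h1', h2'⟩ := hf
  exact ⟨c + c', bind_eq_pay h1 h1', by rw [map_add]; gcongr⟩

theorem runs_foldList {w : ℝ≥0∞} (hw : ∀ t, g ⟨0, 0, t⟩ ≤ w * t) {f : β → α → RandComp β}
    {k : ℝ≥0∞} (l : List α) (S : ℕ → β)
    (h : ∀ (i : ℕ) (hi : i < l.length), Runs g (f (S i) l[i]) (S (i + 1)) k) :
    Runs g (foldList f (S 0) l) (S l.length) (l.length * (w + k) + w) := by
  have h1 : ∀ b : β, Runs g (charge 1 b) b w := fun b =>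
    (Takes.runs hw (takes_charge le_rfl b)).mono (by simp)
  induction l generalizing S with
  | nil => exact (h1 _).mono (by simp)
  | cons a l ih =>
    have h0 := h 0 (by simp)
    have h2 := ih (fun i => S (i + 1)) fun i hi => h (i + 1) (by simpa using hi)
    have h3 : Runs g (foldList f (S 0) (a :: l)) (S (l.length + 1)) _ :=
      Runs.bind (h1 (S 0)) (Runs.bind h0 h2)
    refine h3.mono (le_of_eq ?_)
    simp only [List.length_cons]
    push_cast
    ring

theorem Runs.mean {m : RandComp α} {a : α} {k : ℝ≥0∞} (h : Runs g m a k) (φ : α → ℝ≥0∞) :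
    m.mean φ = φ a := by
  obtain ⟨c, rfl, -⟩ := h
  simp

theorem Runs.ert_le {m : RandComp α} {a : α} {k : ℝ≥0∞} (h : Runs g m a k) (Φ : α → ℝ≥0∞) :
    ert g m Φ ≤ k + Φ a := by
  obtain ⟨c, rfl, hc⟩ := h
  rw [ert_pay]
  gcongr

theorem Runs.ert_bind_le {m : RandComp α} {a : α} {k : ℝ≥0∞} (h : Runs g m a k)
    {f : α → RandComp β} (hf : (f a).IsSub) (Φ : β → ℝ≥0∞) :
    ert g (m.bind f) Φ ≤ k + ert g (f a) Φ := by
  obtain ⟨c, rfl, hc⟩ := h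
  exact (ert_bind_pay _ _ hf Φ).trans (by gcongr)

theorem takes_mul {a b s : ℕ} (ha : a < 2 ^ s) (hb : b < 2 ^ s) :
    Takes (mul a b) (a * b) ((s + 1) ^ 2) := by
  refine takes_charge ?_ _
  rw [sq]
  exact Nat.mul_le_mul (by have := Nat.size_le.2 ha; omega) (by have := Nat.size_le.2 hb; omega)

theorem takes_div {a b s : ℕ} (ha : a < 2 ^ s) (hb : b < 2 ^ s) :
    Takes (div a b) (a / b) ((s + 1) ^ 2) := takes_mul ha hb |>.elim fun _ h =>
  takes_charge (by
    rw [sq]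
    exact Nat.mul_le_mul (by have := Nat.size_le.2 ha; omega)
      (by have := Nat.size_le.2 hb; omega)) _

theorem takes_mod {a b s : ℕ} (ha : a < 2 ^ s) (hb : b < 2 ^ s) :
    Takes (mod a b) (a % b) ((s + 1) ^ 2) := by
  refine takes_charge ?_ _
  rw [sq]
  exact Nat.mul_le_mul (by have := Nat.size_le.2 ha; omega) (by have := Nat.size_le.2 hb; omega)

theorem size_add_size_le {a b s : ℕ} (ha : a < 2 ^ s) (hb : b < 2 ^ s) :
    a.size + b.size + 1 ≤ 2 * s + 1 := by
  have := Nat.size_le.2 ha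
  have := Nat.size_le.2 hb
  omega

theorem takes_add {a b s : ℕ} (ha : a < 2 ^ s) (hb : b < 2 ^ s) :
    Takes (add a b) (a + b) (2 * s + 1) := takes_charge (size_add_size_le ha hb) _

theorem takes_sub {a b s : ℕ} (ha : a < 2 ^ s) (hb : b < 2 ^ s) :
    Takes (sub a b) (a - b) (2 * s + 1) := takes_charge (size_add_size_le ha hb) _

theorem takes_le {a b s : ℕ} (ha : a < 2 ^ s) (hb : b < 2 ^ s) :
    Takes (le a b) (decide (a ≤ b)) (2 * s + 1) := takes_charge (size_add_size_le ha hb) _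

theorem takes_eq {a b s : ℕ} (ha : a < 2 ^ s) (hb : b < 2 ^ s) :
    Takes (eq a b) (decide (a = b)) (2 * s + 1) := takes_charge (size_add_size_le ha hb) _

theorem takes_read {i s : ℕ} (l : List ℕ) (hi : i < 2 ^ s) :
    Takes (read l i) (l.getD i 0) (s + 1) :=
  takes_charge (by have := Nat.size_le.2 hi; omega) _

theorem takes_pow {a e s : ℕ} (ha : 0 < a) (has : a < 2 ^ s) (h : a ^ e < 2 ^ s) :
    Takes (pow a e) (a ^ e) (e * ((s + 1) ^ 2 + 1) + 1) := by
  have := takes_foldList (f := fun x b => mul x b) (t := (s + 1) ^ 2) (List.replicate e a)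
    (fun i => a ^ i) fun i hi => by
      have hi' : i < e := by simpa using hi
      simp only [List.getElem_replicate, pow_succ]
      exact takes_mul ((Nat.pow_le_pow_right ha hi'.le).trans_lt h) has
  simpa [pow] using this

end RandComp

/-! ## Numbers of solutions -/

/-- The generating function of the multiples of `f`. -/
noncomputable def multiplesSeries (f : ℕ) : PowerSeries ℕ :=
  PowerSeries.mk fun n => if f ∣ n then 1 else 0

/-- The number of solutions of `∑ cᵢ fᵢ = e` in natural numbers, if all `fᵢ` are positive. -/
noncomputable def numSolutions (fs : List ℕ) (e : ℕ) : ℕ :=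
  PowerSeries.coeff e (fs.map multiplesSeries).prod

/-- This is `1 / (1 - X ^ f)` without subtraction, as the coefficients are natural numbers. It gives
the recursion of the dynamic program. -/
theorem multiplesSeries_eq {f : ℕ} (hf : 0 < f) :
    multiplesSeries f = 1 + PowerSeries.X ^ f * multiplesSeries f := by
  ext n
  simp only [multiplesSeries, map_add, PowerSeries.coeff_one, PowerSeries.coeff_X_pow_mul',
    PowerSeries.coeff_mk]
  by_cases h : f ≤ n
  · have hn : n ≠ 0 := by omega
    have : f ∣ n - f ↔ f ∣ n := by
      rw [← Nat.dvd_add_left (dvd_refl f), Nat.sub_add_cancel h]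
    simp [h, hn, this]
  · by_cases hn : n = 0
    · subst hn; simp [hf.ne']
    · have : ¬ f ∣ n := fun hd => h (Nat.le_of_dvd (by omega) hd)
      simp [h, hn, this]

theorem coeff_multiplesSeries_mul {f : ℕ} (hf : 0 < f) (p : PowerSeries ℕ) (e : ℕ) :
    PowerSeries.coeff e (multiplesSeries f * p) = PowerSeries.coeff e p +
      if f ≤ e then PowerSeries.coeff (e - f) (multiplesSeries f * p) else 0 := by
  conv_lhs => rw [multiplesSeries_eq hf]
  rw [add_mul, one_mul, map_add, mul_assoc, PowerSeries.coeff_X_pow_mul']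

theorem numSolutions_nil (e : ℕ) : numSolutions [] e = if e = 0 then 1 else 0 := by
  simp [numSolutions, PowerSeries.coeff_one]

theorem numSolutions_cons {f : ℕ} (hf : 0 < f) (fs : List ℕ) (e : ℕ) :
    numSolutions (f :: fs) e = numSolutions fs e +
      if f ≤ e then numSolutions (f :: fs) (e - f) else 0 := by
  simpa [numSolutions] using coeff_multiplesSeries_mul hf (fs.map multiplesSeries).prod e

/-- The dynamic program takes in the degrees from the left, so its rows belong to growing prefixes.
The product of series commutes, so a new last degree behaves like a new first one. -/
theorem numSolutions_append_singleton {f : ℕ} (hf : 0 < f) (fs : List ℕ) (e : ℕ) :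
    numSolutions (fs ++ [f]) e = numSolutions fs e +
      if f ≤ e then numSolutions (fs ++ [f]) (e - f) else 0 := by
  simpa [numSolutions, mul_comm] using
    coeff_multiplesSeries_mul hf (fs.map multiplesSeries).prod e

theorem numSolutions_cons_eq_sum {f : ℕ} (hf : 0 < f) (fs : List ℕ) (e : ℕ) :
    numSolutions (f :: fs) e = ∑ c ∈ Finset.range (e / f + 1), numSolutions fs (e - c * f) := by
  induction e using Nat.strong_induction_on with
  | _ e ih =>
    rw [numSolutions_cons hf]
    split_ifs with h
    · rw [ih (e - f) (by omega), Nat.div_eq_sub_div hf h, Finset.sum_range_succ' _ ((e - f) / f + 1),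
        add_comm]
      congr 1
      · refine Finset.sum_congr rfl fun c _ => ?_
        rw [Nat.sub_sub, Nat.succ_mul, add_comm f]
      · simp
    · simp [Nat.div_eq_of_lt (not_le.1 h)]

theorem multichoose_mono_left {n m : ℕ} (h : n ≤ m) (k : ℕ) :
    n.multichoose k ≤ m.multichoose k := by
  refine monotone_nat_of_le_succ (f := fun n => Nat.multichoose n k) (fun n => ?_) h
  cases k with
  | zero => simp
  | succ k => simp [Nat.multichoose_succ_succ]

theorem multichoose_mono_right {n : ℕ} (hn : 0 < n) {j k : ℕ} (h : j ≤ k) :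
    n.multichoose j ≤ n.multichoose k := by
  obtain ⟨n, rfl⟩ := Nat.exists_eq_succ_of_ne_zero hn.ne'
  refine monotone_nat_of_le_succ (f := fun k => Nat.multichoose (n + 1) k) (fun k => ?_) h
  simp [Nat.multichoose_succ_succ]

/-- Solutions with `c = 0` for the first degree and those with `c > 0` are compared with the two
summands of Pascal's rule for multiset coefficients. The extremal case is that of `∑ fᵢ` degrees
equal to `1`, the totally split prime. -/
theorem numSolutions_le_multichoose (fs : List ℕ) (hfs : ∀ f ∈ fs, 0 < f) (e : ℕ) :
    numSolutions fs e ≤ fs.sum.multichoose e := by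
  induction fs generalizing e with
  | nil => cases e <;> simp [numSolutions_nil]
  | cons f fs ih =>
    have hf : 0 < f := hfs f (by simp)
    induction e using Nat.strong_induction_on with
    | _ e ihe =>
      rw [numSolutions_cons hf]
      have h1 := ih (fun f hf => hfs f (by simp [hf])) e
      split_ifs with h
      · have h2 := ihe (e - f) (by omega)
        obtain ⟨e, rfl⟩ : ∃ e', e = e' + 1 := ⟨e - 1, by omega⟩
        obtain ⟨s, hs⟩ : ∃ s, (f :: fs).sum = s + 1 := ⟨(f :: fs).sum - 1, by simp; omega⟩
        rw [hs] at h2 ⊢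
        rw [Nat.multichoose_succ_succ]
        refine add_le_add (h1.trans (multichoose_mono_left ?_ _))
          (h2.trans (multichoose_mono_right (by omega) (by omega)))
        simp at hs
        omega
      · exact h1.trans (multichoose_mono_left (by simp) _)

theorem multichoose_le_two_pow (n k : ℕ) : n.multichoose k ≤ 2 ^ (n + k) := by
  rw [Nat.multichoose_eq]
  exact (Nat.choose_le_two_pow _ _).trans (Nat.pow_le_pow_right (by omega) (by omega))

/-- A multiset of size `k` is the image of a `k`-tuple. This is why one factor `d` per large prime
factor in the denominator makes the acceptance probability at most `1`. -/
theorem multichoose_le_pow (n k : ℕ) : n.multichoose k ≤ n ^ k := by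
  rcases Nat.eq_zero_or_pos n with rfl | hn
  · cases k <;> simp
  induction k with
  | zero => simp
  | succ k ih =>
    obtain ⟨n, rfl⟩ : ∃ m, n = m + 1 := ⟨n - 1, by omega⟩
    have h := Nat.add_one_mul_choose_eq (n + k) k
    rw [Nat.multichoose_eq] at ih ⊢
    have e1 : n + 1 + k - 1 = n + k := by omega
    have e2 : n + 1 + (k + 1) - 1 = (n + k).succ := by omega
    rw [e1] at ih
    rw [e2]
    refine Nat.le_of_mul_le_mul_right (c := k.succ) ?_ (Nat.succ_pos k)
    rw [← h, pow_succ]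
    calc (n + k).succ * (n + k).choose k ≤ ((n + 1) * k.succ) * (n + 1) ^ k :=
          Nat.mul_le_mul (by simp only [Nat.succ_eq_add_one]; nlinarith [Nat.zero_le (n * k)]) ih
      _ = _ := by ring

theorem numSolutions_lt_two_pow {fs : List ℕ} (hfs : ∀ f ∈ fs, 0 < f) {d e j : ℕ}
    (hd : fs.sum ≤ d) (hj : j ≤ e) : numSolutions fs j < 2 ^ (d + e + 1) :=
  calc numSolutions fs j ≤ 2 ^ (fs.sum + j) :=
        (numSolutions_le_multichoose fs hfs j).trans (multichoose_le_two_pow _ _)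
    _ < 2 ^ (d + e + 1) := Nat.pow_lt_pow_right (by omega) (by omega)

/-- The new row refers to itself at `j - f`, which has already been computed because `f > 0`.
Reading from the new row allows any multiplicity of the summand `f`. -/
theorem takes_solutionRow {e f s : ℕ} (a b : ℕ → ℕ)
    (hb : ∀ j, b j = a j + if f ≤ j then b (j - f) else 0) (hes : e < 2 ^ s)
    (hfs : f < 2 ^ s) (has : ∀ j ≤ e, a j < 2 ^ s) (hbs : ∀ j ≤ e, b j < 2 ^ s) (hf : 0 < f) :
    Takes (solutionRow e ((List.range (e + 1)).map a) f) ((List.range (e + 1)).map b)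
      ((e + 1) * (8 * s + 8) + 1) := by
  have key := takes_foldList (t := 8 * s + 7) (f := fun new j =>
      (read ((List.range (e + 1)).map a) j).bind fun x => (le f j).bind fun fits =>
    if fits then (sub j f).bind fun i => (read new i).bind fun y => (add x y).bind fun z =>
      charge 1 (new ++ [z])
    else charge 1 (new ++ [x])) (List.range (e + 1)) (fun k => (List.range k).map b) ?_
  · simpa [solutionRow] using key
  intro j hj
  have hj' : j < e + 1 := by simpa using hj
  have hjs : j < 2 ^ s := by omega
  have e0 : (List.range (j + 1)).map b = (List.range j).map b ++ [b j] := by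
    simp [List.range_succ]
  have e1 : ((List.range (e + 1)).map a).getD j 0 = a j := by
    simp [List.getD, hj']
  rw [e0]
  simp only [List.getElem_range]
  have h1 := takes_read ((List.range (e + 1)).map a) hjs
  rw [e1] at h1
  by_cases h : f ≤ j
  · have e2 : ((List.range j).map b).getD (j - f) 0 = b (j - f) := by
      have : j - f < j := by omega
      simp [List.getD, this]
    have h2 := takes_read ((List.range j).map b) (show j - f < 2 ^ s by omega)
    rw [e2] at h2
    refine (h1.bind ((takes_le hfs hjs).bind (t' := 5 * s + 4) ?_)).mono (by omega)
    simp only [h, decide_true, if_true]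
    refine ((takes_sub hjs hfs).bind (h2.bind ((takes_add (has j (by omega))
      (hbs (j - f) (by omega))).bind (t' := 1) ?_))).mono (by omega)
    rw [hb j, if_pos h]
    exact takes_charge le_rfl _
  · refine (h1.bind ((takes_le hfs hjs).bind (t' := 1) ?_)).mono (by omega)
    simp only [h, decide_false, Bool.false_eq_true, if_false]
    rw [hb j, if_neg h]
    exact takes_charge le_rfl _

theorem takes_countSolutions {fs : List ℕ} (hfs : ∀ f ∈ fs, 0 < f) {d : ℕ} (hd : fs.sum ≤ d)
    (e : ℕ) : Takes (countSolutions fs e) (numSolutions fs e)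
      ((fs.length + 1) * ((e + 1) * (8 * (d + e + 1) + 8) + 2) + (d + e + 2)) := by
  set s := d + e + 1 with hs
  have hpow : ∀ n, n < s → n < 2 ^ s := fun n hn =>
    Nat.lt_two_pow_self.trans (Nat.pow_lt_pow_right (by omega) hn)
  have e0 : (1 :: List.replicate e 0) = (List.range (e + 1)).map (numSolutions (fs.take 0)) := by
    refine List.ext_getElem (by simp) fun i h1 h2 => ?_
    cases i <;> simp [numSolutions_nil]
  have hsum : ∀ i, (fs.take i).sum ≤ d := fun i => by
    refine le_trans ?_ hd
    conv_rhs => rw [← List.take_append_drop i fs, List.sum_append]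
    omega
  have key := takes_foldList (f := solutionRow e) (t := (e + 1) * (8 * s + 8) + 1) fs
    (fun i => (List.range (e + 1)).map (numSolutions (fs.take i))) ?_
  · unfold countSolutions
    have h2 := takes_read ((List.range (e + 1)).map (numSolutions (fs.take fs.length)))
      (hpow e (by omega))
    rw [List.take_length] at h2
    have e1 : ((List.range (e + 1)).map (numSolutions fs)).getD e 0 = numSolutions fs e := by
      simp [List.getD]
    rw [e1] at h2
    simp only [List.take_length] at key
    rw [← e0] at key
    have h3 := key.bind (f := fun row => read row e) h2
    refine ((takes_charge (le_refl (e + 1)) (1 :: List.replicate e 0)).bind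
      (f := fun row => (foldList (solutionRow e) row fs).bind fun row => read row e)
      (t' := fs.length * ((e + 1) * (8 * s + 8) + 1 + 1) + 1 + (s + 1)) h3).mono ?_
    nlinarith [Nat.zero_le ((e + 1) * (8 * s + 8))]
  · intro i hi
    have hmem : fs[i] ∈ fs := List.getElem_mem hi
    have htake : fs.take (i + 1) = fs.take i ++ [fs[i]] := (List.take_append_getElem hi).symm
    have hle : fs[i] ≤ fs.sum := List.single_le_sum (by simp) _ hmem
    refine takes_solutionRow _ _ (fun j => ?_) (hpow e (by omega)) (hpow _ (by omega))
      (fun j hj => numSolutions_lt_two_pow (fun f hf => hfs f (List.mem_of_mem_take hf))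
        (hsum i) hj)
      (fun j hj => numSolutions_lt_two_pow (fun f hf => hfs f (List.mem_of_mem_take hf))
        (hsum (i + 1)) hj) (hfs _ hmem)
    rw [htake]
    exact numSolutions_append_singleton (hfs _ hmem) _ j

end FactoredIdeals

namespace FactoredIdeals

universe u v w

set_option linter.unusedSectionVars false

/-! ## The list of all solutions -/

/-- All solutions of `∑ cᵢ fᵢ = e` in natural numbers, as computed by `solutions`. -/
def solutionList : List ℕ → ℕ → List (List ℕ)
  | [], e => if e = 0 then [[]] else []
  | f :: fs, e => (List.range (e / f + 1)).foldl
      (fun acc c => (solutionList fs (e - c * f)).map (fun cs => c :: cs) ++ acc) []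

theorem foldl_append_eq_flatMap {α β : Type*} (h : α → List β) (l : List α) (acc : List β) :
    l.foldl (fun acc c => h c ++ acc) acc = l.reverse.flatMap h ++ acc := by
  induction l generalizing acc with
  | nil => simp
  | cons a l ih => simp [ih]

theorem solutionList_cons (f : ℕ) (fs : List ℕ) (e : ℕ) :
    solutionList (f :: fs) e = (List.range (e / f + 1)).reverse.flatMap
      fun c => (solutionList fs (e - c * f)).map fun cs => c :: cs := by
  rw [solutionList, foldl_append_eq_flatMap (fun c => (solutionList fs (e - c * f)).map
    fun cs => c :: cs), List.append_nil]

theorem mem_solutionList {fs : List ℕ} (hfs : ∀ f ∈ fs, 0 < f) {e : ℕ} {cs : List ℕ} :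
    cs ∈ solutionList fs e ↔ cs.length = fs.length ∧ (List.zipWith (· * ·) cs fs).sum = e := by
  induction fs generalizing e cs with
  | nil =>
    rcases cs with _ | ⟨c, cs⟩
    · by_cases h : e = 0 <;> simp [solutionList, h, eq_comm]
    · by_cases h : e = 0 <;> simp [solutionList, h]
  | cons f fs ih =>
    have hf : 0 < f := hfs f (by simp)
    have ih := fun e cs => @ih (fun f hf => hfs f (by simp [hf])) e cs
    rw [solutionList_cons]
    simp only [List.mem_flatMap, List.mem_reverse, List.mem_range, List.mem_map, ih]
    constructor
    · rintro ⟨c, hc, cs', ⟨h1, h2⟩, rfl⟩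
      have : c * f ≤ e := (Nat.le_div_iff_mul_le hf).1 (by omega)
      refine ⟨by simp [h1], ?_⟩
      simp only [List.zipWith_cons_cons, List.sum_cons, h2]
      omega
    · rintro ⟨h1, h2⟩
      rcases cs with _ | ⟨c, cs⟩
      · simp at h1
      · simp only [List.zipWith_cons_cons, List.sum_cons] at h2
        have : c ≤ e / f := (Nat.le_div_iff_mul_le hf).2 (by omega)
        exact ⟨c, by omega, cs, ⟨by simpa using h1, by omega⟩, rfl⟩

theorem nodup_solutionList (fs : List ℕ) (e : ℕ) : (solutionList fs e).Nodup := by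
  induction fs generalizing e with
  | nil => rw [solutionList]; split_ifs <;> simp
  | cons f fs ih =>
    rw [solutionList_cons, List.nodup_flatMap]
    refine ⟨fun c _ => (ih _).map fun a b h => by simpa using h, ?_⟩
    refine (List.nodup_reverse.2 List.nodup_range).imp fun {a b} hab => ?_
    intro x hx hx'
    simp only [List.mem_map] at hx hx'
    obtain ⟨y, -, rfl⟩ := hx
    obtain ⟨z, -, hz⟩ := hx'
    exact hab (by simp at hz; exact hz.1.symm)

/-- The count used for acceptance and the enumeration used for the choice of the ideal agree, so
that their contributions can cancel. -/
theorem length_solutionList {fs : List ℕ} (hfs : ∀ f ∈ fs, 0 < f) (e : ℕ) :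
    (solutionList fs e).length = numSolutions fs e := by
  induction fs generalizing e with
  | nil => rw [solutionList, numSolutions_nil]; split_ifs <;> simp
  | cons f fs ih =>
    rw [solutionList_cons, numSolutions_cons_eq_sum (hfs f (by simp))]
    simp only [List.length_flatMap, List.length_map, ih fun f hf => hfs f (by simp [hf]),
      List.map_reverse, List.sum_reverse]
    rw [Finset.sum_range, ← List.sum_ofFn, List.ofFn_eq_map]
    congr 1
    refine List.ext_getElem (by simp) fun i h1 h2 => ?_
    simp

/-- Each `cᵢ` is at most `e`. For fixed `d` this is polynomial in `e`, hence polylogarithmic in the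
norm, so all solutions can be listed. -/
theorem numSolutions_le_pow {fs : List ℕ} (hfs : ∀ f ∈ fs, 0 < f) (e : ℕ) :
    numSolutions fs e ≤ (e + 1) ^ fs.length := by
  induction fs generalizing e with
  | nil => rw [numSolutions_nil]; split_ifs <;> simp
  | cons f fs ih =>
    rw [numSolutions_cons_eq_sum (hfs f (by simp))]
    calc _ ≤ ∑ c ∈ Finset.range (e / f + 1), (e + 1) ^ fs.length :=
          Finset.sum_le_sum fun c _ => (ih (fun f hf => hfs f (by simp [hf])) _).trans
            (Nat.pow_le_pow_left (by omega) _)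
      _ ≤ (e + 1) ^ (f :: fs).length := by
          simp only [Finset.sum_const, Finset.card_range, smul_eq_mul, List.length_cons]
          rw [pow_succ, mul_comm]
          exact Nat.mul_le_mul_left _ (by have := Nat.div_le_self e f; omega)

/-! ## Prime ideals above a rational prime -/

section

variable (K : Type u) [Field K] [NumberField K]

/-- The prime ideals above `p`. -/
noncomputable def primesAbove (p : ℕ) : List (Ideal (𝓞 K)) :=
  (splittingData K p).map PrimeAbove.ideal

/-- The residue degrees of the prime ideals above `p`. -/
noncomputable def degreesAbove (p : ℕ) : List ℕ := (splittingData K p).map PrimeAbove.degree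

variable {K}

theorem degreesAbove_eq (p : ℕ) :
    degreesAbove K p = (primesAbove K p).map (Ideal.inertiaDeg' (Ideal.span {(p : ℤ)})) := by
  simp [degreesAbove, primesAbove, splittingData, Function.comp_def]

theorem primesAbove_eq (p : ℕ) : primesAbove K p = (UniqueFactorizationMonoid.primeFactors
    (Ideal.span {(p : 𝓞 K)})).toList := by
  simp [primesAbove, splittingData, Function.comp_def]

theorem nodup_primesAbove (p : ℕ) : (primesAbove K p).Nodup := by
  rw [primesAbove_eq]
  exact Finset.nodup_toList _

theorem span_natCast_ne_bot {p : ℕ} (hp : p ≠ 0) : Ideal.span {(p : 𝓞 K)} ≠ ⊥ := by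
  simpa using hp

theorem mem_primesAbove {p : ℕ} (hp : p ≠ 0) {𝔭 : Ideal (𝓞 K)} :
    𝔭 ∈ primesAbove K p ↔ Prime 𝔭 ∧ (p : 𝓞 K) ∈ 𝔭 := by
  have : 𝔭 ∈ primesAbove K p ↔ 𝔭 ∈ UniqueFactorizationMonoid.normalizedFactors
      (Ideal.span {(p : 𝓞 K)}) := by
    rw [primesAbove_eq, Finset.mem_toList, UniqueFactorizationMonoid.mem_primeFactors]
  rw [this, UniqueFactorizationMonoid.mem_normalizedFactors_iff' (by simpa using hp),
    Ideal.dvd_span_singleton]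
  simp [UniqueFactorizationMonoid.irreducible_iff_prime]

theorem liesOver_of_mem_primesAbove {p : ℕ} (hp : p.Prime) {𝔭 : Ideal (𝓞 K)}
    (h : 𝔭 ∈ primesAbove K p) : 𝔭.LiesOver (Ideal.span {(p : ℤ)}) := by
  obtain ⟨h1, h2⟩ := (mem_primesAbove hp.ne_zero).1 h
  have hP : 𝔭.IsPrime := Ideal.isPrime_of_prime h1
  have hmax : (Ideal.span {(p : ℤ)}).IsMaximal :=
    PrincipalIdealRing.isMaximal_of_irreducible (Nat.prime_iff_prime_int.1 hp).irreducible
  refine ⟨hmax.eq_of_le (Ideal.IsPrime.ne_top (hP.under ℤ)) ?_⟩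
  rw [Ideal.span_singleton_le_iff_mem, Ideal.mem_comap]
  simpa using h2

theorem absNorm_of_mem_primesAbove {p : ℕ} (hp : p.Prime) {𝔭 : Ideal (𝓞 K)}
    (h : 𝔭 ∈ primesAbove K p) :
    Ideal.absNorm 𝔭 = p ^ Ideal.inertiaDeg' (Ideal.span {(p : ℤ)}) 𝔭 := by
  have := liesOver_of_mem_primesAbove hp h
  exact Ideal.absNorm_eq_pow_inertiaDeg' 𝔭 hp

theorem degreesAbove_pos {p : ℕ} (hp : p.Prime) : ∀ f ∈ degreesAbove K p, 0 < f := by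
  intro f hf
  rw [degreesAbove_eq, List.mem_map] at hf
  obtain ⟨𝔭, h𝔭, rfl⟩ := hf
  have := liesOver_of_mem_primesAbove hp h𝔭
  have hmax : (Ideal.span {(p : ℤ)}).IsMaximal :=
    PrincipalIdealRing.isMaximal_of_irreducible (Nat.prime_iff_prime_int.1 hp).irreducible
  exact Ideal.inertiaDeg'_pos _ _

/-- The product of the distinct primes above `p` divides `p𝓞_K`, which has norm `p ^ d`; compare
norms. Ramification only makes the inequality strict. -/
theorem sum_degreesAbove_le {p : ℕ} (hp : p.Prime) :
    (degreesAbove K p).sum ≤ Module.finrank ℚ K := by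
  have h1 : (primesAbove K p).prod ∣ Ideal.span {(p : 𝓞 K)} := by
    rw [primesAbove_eq, Finset.prod_toList]
    conv_rhs => rw [← Ideal.prod_normalizedFactors_eq_self (span_natCast_ne_bot hp.ne_zero)]
    classical
    rw [← UniqueFactorizationMonoid.toFinset_normalizedFactors]
    exact Multiset.toFinset_prod_dvd_prod _
  have h2 : Ideal.absNorm (primesAbove K p).prod = p ^ (degreesAbove K p).sum := by
    rw [map_list_prod, degreesAbove_eq]
    have : ∀ l : List (Ideal (𝓞 K)), (∀ 𝔭 ∈ l, 𝔭 ∈ primesAbove K p) →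
        (l.map Ideal.absNorm).prod =
          p ^ (l.map (Ideal.inertiaDeg' (Ideal.span {(p : ℤ)}))).sum := by
      intro l
      induction l with
      | nil => simp
      | cons a l ih =>
        intro h
        simp only [List.map_cons, List.prod_cons, List.sum_cons, pow_add]
        rw [ih fun 𝔭 h' => h 𝔭 (by simp [h']), absNorm_of_mem_primesAbove hp (h a (by simp))]
    exact this _ fun _ h => h
  have h3 := map_dvd Ideal.absNorm h1
  rw [h2, Ideal.absNorm_span_natCast, NumberField.RingOfIntegers.rank] at h3
  exact (Nat.pow_dvd_pow_iff_le_right hp.one_lt).1 h3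

/-! ## Ideals of prime power norm -/

/-- The ideal with the given exponents. -/
noncomputable def idealOfExponents (Q : List (Ideal (𝓞 K))) (cs : List ℕ) : Ideal (𝓞 K) :=
  ((Q.zip cs).map fun y => y.1 ^ y.2).prod

theorem absNorm_idealOfExponents {p : ℕ} (hp : p.Prime) (Q : List (Ideal (𝓞 K)))
    (hQ : ∀ 𝔭 ∈ Q, 𝔭 ∈ primesAbove K p) (cs : List ℕ) :
    Ideal.absNorm (idealOfExponents Q cs) = p ^ (List.zipWith (· * ·) cs
      (Q.map (Ideal.inertiaDeg' (Ideal.span {(p : ℤ)})))).sum := by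
  induction Q generalizing cs with
  | nil => simp [idealOfExponents]
  | cons 𝔭 Q ih =>
    rcases cs with _ | ⟨c, cs⟩
    · simp [idealOfExponents]
    · have ih := ih (fun 𝔭 h => hQ 𝔭 (by simp [h])) cs
      simp only [idealOfExponents] at ih ⊢
      simp only [List.zip_cons_cons, List.map_cons, List.prod_cons, map_mul, map_pow, ih,
        List.zipWith_cons_cons, List.sum_cons, pow_add,
        absNorm_of_mem_primesAbove hp (hQ 𝔭 (by simp)), ← pow_mul, mul_comm]

open Classical in
/-- The exponents of the given prime ideals in the factorization of an ideal. -/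
noncomputable def exponentsIn (Q : List (Ideal (𝓞 K))) (J : Ideal (𝓞 K)) : List ℕ :=
  Q.map fun 𝔭 => (UniqueFactorizationMonoid.normalizedFactors J).count 𝔭

theorem idealOfExponents_ne_zero (Q : List (Ideal (𝓞 K))) (hQ : ∀ 𝔭 ∈ Q, Prime 𝔭)
    (cs : List ℕ) : idealOfExponents Q cs ≠ 0 := by
  refine List.prod_ne_zero fun h => ?_
  rw [List.mem_map] at h
  obtain ⟨y, hy, h0⟩ := h
  exact pow_ne_zero _ (hQ y.1 (List.of_mem_zip hy).1).ne_zero h0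

theorem idealOfExponents_cons (𝔭 : Ideal (𝓞 K)) (Q : List (Ideal (𝓞 K))) (c : ℕ)
    (cs : List ℕ) : idealOfExponents (𝔭 :: Q) (c :: cs) = 𝔭 ^ c * idealOfExponents Q cs := by
  simp [idealOfExponents]

open Classical in
theorem count_idealOfExponents_of_notMem (Q : List (Ideal (𝓞 K))) (hQ : ∀ 𝔭 ∈ Q, Prime 𝔭)
    (cs : List ℕ) {𝔮 : Ideal (𝓞 K)} (h𝔮 : 𝔮 ∉ Q) :
    (UniqueFactorizationMonoid.normalizedFactors (idealOfExponents Q cs)).count 𝔮 = 0 := by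
  induction Q generalizing cs with
  | nil => simp [idealOfExponents, -Ideal.one_eq_top]
  | cons 𝔭 Q ih =>
    rcases cs with _ | ⟨c, cs⟩
    · simp [idealOfExponents, -Ideal.one_eq_top]
    · have hQ' : ∀ 𝔭 ∈ Q, Prime 𝔭 := fun 𝔭 h => hQ 𝔭 (by simp [h])
      have hp := hQ 𝔭 (by simp)
      rw [idealOfExponents_cons, UniqueFactorizationMonoid.normalizedFactors_mul
        (pow_ne_zero _ hp.ne_zero) (idealOfExponents_ne_zero Q hQ' cs), Multiset.count_add,
        ih hQ' cs (by simp at h𝔮; exact h𝔮.2), UniqueFactorizationMonoid.normalizedFactors_pow,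
        UniqueFactorizationMonoid.normalizedFactors_irreducible hp.irreducible]
      simp only [List.mem_cons, not_or] at h𝔮
      simp [h𝔮.1]

/-- One half of unique factorization over a fixed list of distinct primes: the exponents can be read
back from the ideal. -/
theorem exponentsIn_idealOfExponents (Q : List (Ideal (𝓞 K))) (hQ : ∀ 𝔭 ∈ Q, Prime 𝔭)
    (hnd : Q.Nodup) (cs : List ℕ) (hcs : cs.length = Q.length) :
    exponentsIn Q (idealOfExponents Q cs) = cs := by
  classical
  induction Q generalizing cs with
  | nil => simp at hcs; simp [exponentsIn, hcs]
  | cons 𝔭 Q ih =>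
    rcases cs with _ | ⟨c, cs⟩
    · simp at hcs
    · have hQ' : ∀ 𝔭 ∈ Q, Prime 𝔭 := fun 𝔭 h => hQ 𝔭 (by simp [h])
      have hp := hQ 𝔭 (by simp)
      have hn := List.nodup_cons.1 hnd
      have ih := ih hQ' hn.2 cs (by simpa using hcs)
      have key : ∀ 𝔮, (UniqueFactorizationMonoid.normalizedFactors
          (idealOfExponents (𝔭 :: Q) (c :: cs))).count 𝔮 = (if 𝔮 = 𝔭 then c else 0) +
          (UniqueFactorizationMonoid.normalizedFactors (idealOfExponents Q cs)).count 𝔮 := by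
        intro 𝔮
        rw [idealOfExponents_cons, UniqueFactorizationMonoid.normalizedFactors_mul
          (pow_ne_zero _ hp.ne_zero) (idealOfExponents_ne_zero Q hQ' cs), Multiset.count_add,
          UniqueFactorizationMonoid.normalizedFactors_pow,
          UniqueFactorizationMonoid.normalizedFactors_irreducible hp.irreducible]
        simp [Multiset.count_nsmul, Multiset.count_singleton]
      simp only [exponentsIn] at ih ⊢
      rw [List.map_cons]
      simp only [key]
      rw [count_idealOfExponents_of_notMem Q hQ' cs hn.1]
      simp only [if_true, add_zero]
      congr 1
      conv_rhs => rw [← ih]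
      refine List.map_congr_left fun 𝔮 h𝔮 => ?_
      have : 𝔮 ≠ 𝔭 := fun h => hn.1 (h ▸ h𝔮)
      simp [this]

/-- The other half. An ideal contains its norm, so a prime factor of `J` contains `p ^ e`, hence
`p`, and appears among the primes above `p`. -/
theorem idealOfExponents_exponentsIn {p : ℕ} (hp : p.Prime) {e : ℕ} {J : Ideal (𝓞 K)}
    (hJ : Ideal.absNorm J = p ^ e) :
    idealOfExponents (primesAbove K p) (exponentsIn (primesAbove K p) J) = J := by
  classical
  have hJ0 : J ≠ ⊥ := fun h => by
    rw [h, Ideal.absNorm_bot] at hJ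
    exact pow_ne_zero e hp.ne_zero hJ.symm
  have h1 : idealOfExponents (primesAbove K p) (exponentsIn (primesAbove K p) J) =
      ∏ 𝔭 ∈ (primesAbove K p).toFinset,
        𝔭 ^ (UniqueFactorizationMonoid.normalizedFactors J).count 𝔭 := by
    rw [List.prod_toFinset _ (nodup_primesAbove p), idealOfExponents, exponentsIn,
      List.zip_map_right, List.map_map]
    congr 1
    have : ∀ (Q : List (Ideal (𝓞 K))) (h : Ideal (𝓞 K) → ℕ), (Q.zip Q).map
        ((fun y : Ideal (𝓞 K) × ℕ => y.1 ^ y.2) ∘ Prod.map id h) = Q.map fun a => a ^ h a := by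
      intro Q h
      induction Q with
      | nil => simp
      | cons a Q ih => simp [ih]
    exact this _ _
  rw [h1, ← Finset.prod_multiset_count_of_subset, Ideal.prod_normalizedFactors_eq_self hJ0]
  intro 𝔮 h𝔮
  rw [Multiset.mem_toFinset] at h𝔮
  rw [List.mem_toFinset, mem_primesAbove hp.ne_zero]
  have hprime := UniqueFactorizationMonoid.prime_of_normalized_factor 𝔮 h𝔮
  refine ⟨hprime, ?_⟩
  have hle : J ≤ 𝔮 := Ideal.le_of_dvd
    (UniqueFactorizationMonoid.dvd_of_mem_normalizedFactors h𝔮)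
  have hmem := hle (Ideal.absNorm_mem J)
  rw [hJ, Nat.cast_pow] at hmem
  exact (Ideal.isPrime_of_prime hprime).mem_of_pow_mem _ hmem

theorem length_primesAbove (p : ℕ) : (primesAbove K p).length = (degreesAbove K p).length := by
  simp [degreesAbove_eq]

theorem prime_of_mem_primesAbove {p : ℕ} (hp : p.Prime) :
    ∀ 𝔭 ∈ primesAbove K p, Prime 𝔭 := fun _ h => ((mem_primesAbove hp.ne_zero).1 h).1

theorem exponentsIn_mem_solutionList {p : ℕ} (hp : p.Prime) {e : ℕ} {J : Ideal (𝓞 K)}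
    (hJ : Ideal.absNorm J = p ^ e) :
    exponentsIn (primesAbove K p) J ∈ solutionList (degreesAbove K p) e := by
  rw [mem_solutionList (degreesAbove_pos hp)]
  refine ⟨by simp [exponentsIn, degreesAbove_eq], ?_⟩
  have h := absNorm_idealOfExponents hp (primesAbove K p) (fun _ h => h)
    (exponentsIn (primesAbove K p) J)
  rw [idealOfExponents_exponentsIn hp hJ, hJ, ← degreesAbove_eq] at h
  exact (Nat.pow_right_injective hp.two_le h).symm

theorem absNorm_of_mem_solutionList {p : ℕ} (hp : p.Prime) {e : ℕ} {cs : List ℕ}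
    (h : cs ∈ solutionList (degreesAbove K p) e) :
    Ideal.absNorm (idealOfExponents (primesAbove K p) cs) = p ^ e := by
  rw [mem_solutionList (degreesAbove_pos hp)] at h
  rw [absNorm_idealOfExponents hp _ (fun _ h => h), ← degreesAbove_eq, h.2]

theorem exponentsIn_of_mem_solutionList {p : ℕ} (hp : p.Prime) {e : ℕ} {cs : List ℕ}
    (h : cs ∈ solutionList (degreesAbove K p) e) :
    exponentsIn (primesAbove K p) (idealOfExponents (primesAbove K p) cs) = cs := by
  rw [mem_solutionList (degreesAbove_pos hp)] at h
  exact exponentsIn_idealOfExponents _ (prime_of_mem_primesAbove hp) (nodup_primesAbove p) cs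
    (by rw [h.1, length_primesAbove])

theorem idealCount_prime_pow {p : ℕ} (hp : p.Prime) (e : ℕ) :
    idealCount K (p ^ e) = numSolutions (degreesAbove K p) e := by
  rw [← length_solutionList (degreesAbove_pos hp),
    ← List.toFinset_card_of_nodup (nodup_solutionList _ _), idealCount, ← Nat.card_eq_finsetCard]
  refine Nat.card_congr ⟨fun J => ⟨exponentsIn (primesAbove K p) J.1, ?_⟩,
    fun cs => ⟨idealOfExponents (primesAbove K p) cs.1, ?_⟩, ?_, ?_⟩
  · simpa using exponentsIn_mem_solutionList hp J.2
  · exact absNorm_of_mem_solutionList hp (List.mem_toFinset.1 cs.2)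
  · exact fun J => Subtype.ext (idealOfExponents_exponentsIn hp J.2)
  · exact fun cs => Subtype.ext (exponentsIn_of_mem_solutionList hp (List.mem_toFinset.1 cs.2))

/-! ## Multiplicativity -/

theorem span_natCast_sup_span_natCast {m n : ℕ} (h : m.Coprime n) :
    Ideal.span {(m : 𝓞 K)} ⊔ Ideal.span {(n : 𝓞 K)} = ⊤ := by
  refine Ideal.isCoprime_iff_sup_eq.1 ((Ideal.isCoprime_span_singleton_iff _ _).2 ?_)
  simpa using (Nat.isCoprime_iff_coprime.2 h).map (Int.castRingHom (𝓞 K))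

/-- The ideal `J` is recovered from `J + (m)` and `J + (n)`: their product lies in `J` because `mn ∈
J`, and it contains `J (m) + J (n) = J`. This splits an ideal into parts of coprime norms without
using its factorization. -/
theorem sup_span_mul_sup_span {m n : ℕ} (h : m.Coprime n) {J : Ideal (𝓞 K)}
    (hJ : Ideal.absNorm J = m * n) :
    (J ⊔ Ideal.span {(m : 𝓞 K)}) * (J ⊔ Ideal.span {(n : 𝓞 K)}) = J := by
  have hmem : Ideal.span {(m : 𝓞 K)} * Ideal.span {(n : 𝓞 K)} ≤ J := by
    rw [Ideal.span_singleton_mul_span_singleton, Ideal.span_singleton_le_iff_mem]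
    have := Ideal.absNorm_mem J
    rw [hJ] at this
    simpa using this
  refine le_antisymm ?_ ?_
  · rw [Ideal.sup_mul, Ideal.mul_sup, Ideal.mul_sup]
    exact sup_le (sup_le Ideal.mul_le_right Ideal.mul_le_left) (sup_le Ideal.mul_le_right hmem)
  · calc J = J * (Ideal.span {(m : 𝓞 K)} ⊔ Ideal.span {(n : 𝓞 K)}) := by
          rw [span_natCast_sup_span_natCast h, Ideal.mul_top]
      _ ≤ _ := by
          rw [Ideal.mul_sup]
          refine sup_le ?_ (Ideal.mul_mono le_sup_left le_sup_right)
          rw [mul_comm]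
          exact Ideal.mul_mono le_sup_right le_sup_left

theorem mul_sup_span_eq {m n : ℕ} (h : m.Coprime n) {I₁ I₂ : Ideal (𝓞 K)}
    (h₁ : Ideal.absNorm I₁ = m) (h₂ : Ideal.absNorm I₂ = n) :
    I₁ * I₂ ⊔ Ideal.span {(m : 𝓞 K)} = I₁ := by
  have hm : Ideal.span {(m : 𝓞 K)} ≤ I₁ := h₁ ▸ Ideal.span_singleton_absNorm_le I₁
  have hn : Ideal.span {(n : 𝓞 K)} ≤ I₂ := h₂ ▸ Ideal.span_singleton_absNorm_le I₂
  refine le_antisymm (sup_le Ideal.mul_le_left hm) ?_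
  calc I₁ = I₁ * (Ideal.span {(n : 𝓞 K)} ⊔ Ideal.span {(m : 𝓞 K)}) := by
        rw [sup_comm, span_natCast_sup_span_natCast h, Ideal.mul_top]
    _ ≤ _ := by
        rw [Ideal.mul_sup]
        exact sup_le_sup (Ideal.mul_mono le_rfl hn) Ideal.mul_le_right

/-- The norms of `J + (m)` and `J + (n)` divide powers of `m` and of `n` and multiply to `mn`.
Coprimality then determines both. -/
theorem absNorm_sup_span {m n : ℕ} (h : m.Coprime n) {J : Ideal (𝓞 K)}
    (hJ : Ideal.absNorm J = m * n) :
    Ideal.absNorm (J ⊔ Ideal.span {(m : 𝓞 K)}) = m := by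
  have key : ∀ k : ℕ, Ideal.absNorm (J ⊔ Ideal.span {(k : 𝓞 K)}) ∣
      k ^ Module.finrank ℤ (𝓞 K) := fun k => by
    rw [← Ideal.absNorm_span_natCast]
    exact Ideal.absNorm_dvd_absNorm_of_le le_sup_right
  have hmul := congrArg Ideal.absNorm (sup_span_mul_sup_span h hJ)
  rw [map_mul, hJ] at hmul
  have hd1 : Ideal.absNorm (J ⊔ Ideal.span {(m : 𝓞 K)}) ∣ m :=
    (Nat.Coprime.dvd_of_dvd_mul_right ((h.pow_left _).coprime_dvd_left (key m))
      (Dvd.intro _ hmul))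
  have hd2 : m ∣ Ideal.absNorm (J ⊔ Ideal.span {(m : 𝓞 K)}) :=
    Nat.Coprime.dvd_of_dvd_mul_right
      (Nat.Coprime.coprime_dvd_right (key n) (h.pow_right _)) (Dvd.intro _ hmul.symm)
  exact Nat.dvd_antisymm hd1 hd2

theorem idealCount_mul {m n : ℕ} (h : m.Coprime n) :
    idealCount K (m * n) = idealCount K m * idealCount K n := by
  unfold idealCount
  rw [← Nat.card_prod]
  refine Nat.card_congr ⟨fun J => (⟨J.1 ⊔ Ideal.span {(m : 𝓞 K)}, absNorm_sup_span h J.2⟩,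
    ⟨J.1 ⊔ Ideal.span {(n : 𝓞 K)}, absNorm_sup_span h.symm (J.2.trans (mul_comm ..))⟩),
    fun I => ⟨I.1.1 * I.2.1, by rw [map_mul, I.1.2, I.2.2]⟩, ?_, ?_⟩
  · exact fun J => Subtype.ext (sup_span_mul_sup_span h J.2)
  · rintro ⟨⟨I₁, h₁⟩, ⟨I₂, h₂⟩⟩
    refine Prod.ext (Subtype.ext (mul_sup_span_eq h h₁ h₂)) (Subtype.ext ?_)
    change I₁ * I₂ ⊔ _ = I₂
    rw [mul_comm]
    exact mul_sup_span_eq h.symm h₂ h₁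

theorem idealCount_one : idealCount K 1 = 1 := by
  unfold idealCount
  simp [Ideal.absNorm_eq_one_iff]

theorem idealCount_eq_prod {r : ℕ} (hr : r ≠ 0) :
    idealCount K r = r.factorization.prod fun p e => numSolutions (degreesAbove K p) e := by
  rw [Nat.multiplicative_factorization (idealCount K) (fun _ _ h => idealCount_mul h)
    idealCount_one hr]
  refine Finsupp.prod_congr fun p hp => ?_
  exact idealCount_prime_pow (Nat.prime_of_mem_primeFactors hp) _

end

end FactoredIdeals

namespace FactoredIdeals

universe u v w

/-! ## Deterministic parts of the algorithm -/

theorem lt_two_pow_of_le {n s : ℕ} (h : n ≤ s) : n < 2 ^ s :=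
  Nat.lt_two_pow_self.trans_le (Nat.pow_le_pow_right (by omega) h)

theorem takes_solutions {fs : List ℕ} {d : ℕ} (hfs : ∀ f ∈ fs, 0 < f ∧ f ≤ d) {e X : ℕ}
    (hX : e + d + 2 ≤ X) :
    Takes (solutions fs e) (solutionList fs e) ((8 * fs.length + 1) * X ^ (fs.length + 2)) := by
  induction fs generalizing e with
  | nil =>
    refine takes_charge ?_ _
    exact Nat.mul_pos (by omega) (Nat.pow_pos (by omega))
  | cons f fs ih =>
    have hfs' : ∀ f ∈ fs, 0 < f ∧ f ≤ d := fun f hf => hfs f (by simp [hf])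
    have hf := hfs f (by simp)
    obtain ⟨s, rfl⟩ : ∃ s, X = s + 1 := ⟨X - 1, by omega⟩
    set k := fs.length with hk
    set T := (8 * k + 1) * (s + 1) ^ (k + 2) with hT
    have hq : e / f ≤ e := Nat.div_le_self e f
    have key := takes_foldList (f := fun acc c => (mul c f).bind fun cf => (sub e cf).bind
      fun e' => (solutions fs e').bind fun l =>
        charge (l.length + 1) (l.map (fun cs => c :: cs) ++ acc)) (t := (s + 1) ^ 2 + (2 * s + 1) + T
          + ((s + 1) ^ k + 1)) (List.range (e / f + 1))
      (fun i => (List.range i).foldl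
        (fun acc c => (solutionList fs (e - c * f)).map (fun cs => c :: cs) ++ acc) []) ?_
    · have h1 := (takes_div (s := s) (lt_two_pow_of_le (show e ≤ s by omega))
        (lt_two_pow_of_le (show f ≤ s by omega))).bind (f := fun q =>
        foldList (fun acc c => (mul c f).bind fun cf => (sub e cf).bind fun e' =>
        (solutions fs e').bind fun l =>
          charge (l.length + 1) (l.map (fun cs => c :: cs) ++ acc)) [] (List.range (q + 1)))
        (by simpa only [List.length_range, List.range_zero, List.foldl_nil] using key)
      rw [solutions, solutionList]
      refine h1.mono ?_
      simp only [List.length_cons]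
      have e1 : (s + 1) ^ (k + 1 + 2) = (s + 1) ^ (k + 2) * (s + 1) := pow_succ ..
      have e2 : (s + 1) ^ (k + 2) = (s + 1) ^ k * (s + 1) ^ 2 := pow_add ..
      have e3 : 1 ≤ (s + 1) ^ k := Nat.one_le_pow _ _ (by omega)
      have e4 : (e / f + 1) ≤ s + 1 := by omega
      have hb : (s + 1) ^ 2 + (2 * s + 1) + T + ((s + 1) ^ k + 1) + 1 ≤
          (8 * k + 7) * (s + 1) ^ (k + 2) := by
        rw [hT, e2]
        have : (s + 1) ^ 2 ≤ (s + 1) ^ k * (s + 1) ^ 2 := Nat.le_mul_of_pos_left _ (by omega)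
        have : (s + 1) ^ k ≤ (s + 1) ^ k * (s + 1) ^ 2 :=
          Nat.le_mul_of_pos_right _ (by positivity)
        nlinarith
      have hc : (s + 1) ^ 2 ≤ (s + 1) ^ (k + 2) * (s + 1) :=
        (Nat.pow_le_pow_right (by omega) (by omega : 2 ≤ k + 2 + 1)).trans_eq (pow_succ ..)
      have hd : 1 ≤ (s + 1) ^ (k + 2) * (s + 1) := Nat.mul_pos (by positivity) (by omega)
      calc _ ≤ (s + 1) ^ 2 + ((s + 1) * ((8 * k + 7) * (s + 1) ^ (k + 2)) + 1) := by gcongr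
        _ ≤ _ := by rw [e1]; nlinarith
    · intro i hi
      have hi' : i ≤ e / f := by simpa using Nat.lt_succ_iff.1 (by simpa using hi)
      have hmul : i * f ≤ e := (Nat.le_div_iff_mul_le hf.1).1 hi'
      rw [List.getElem_range, List.range_succ (n := i), List.foldl_append, List.foldl_cons,
        List.foldl_nil]
      refine ((takes_mul (s := s) (lt_two_pow_of_le (by omega))
        (lt_two_pow_of_le (by omega))).bind (t' := (2 * s + 1) + (T + ((s + 1) ^ k + 1))) ?_).mono
          (by omega)
      refine (takes_sub (s := s) (lt_two_pow_of_le (by omega))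
        (lt_two_pow_of_le (by omega))).bind ?_
      refine (ih hfs' (e := e - i * f) (by omega)).bind ?_
      refine takes_charge ?_ _
      rw [length_solutionList fun f hf => (hfs' f hf).1]
      have := (numSolutions_le_pow (fun f hf => (hfs' f hf).1) (e - i * f)).trans
        (Nat.pow_le_pow_left (show e - i * f + 1 ≤ s + 1 by omega) fs.length)
      rw [← hk] at this
      omega

/-- The inverse of `α`. -/
def alphaInvValue (d N : ℕ) : ℕ := (d + Nat.log 2 N - 1).choose (Nat.log 2 N)

/-- The algorithm computes the binomial coefficient as a rising factorial over `(d - 1)!`, so the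
number of multiplications depends on `d` alone. -/
theorem alphaInvValue_eq {d : ℕ} (hd : 0 < d) (N : ℕ) :
    alphaInvValue d N = (Nat.log 2 N + 1).ascFactorial (d - 1) / (d - 1).factorial := by
  rw [Nat.ascFactorial_eq_factorial_mul_choose, Nat.mul_div_cancel_left _ (Nat.factorial_pos _),
    alphaInvValue, ← Nat.choose_symm_of_eq_add
      (show d + Nat.log 2 N - 1 = (d - 1) + Nat.log 2 N by omega)]
  congr 1
  omega

theorem alphaInvValue_pos {d : ℕ} (hd : 0 < d) (N : ℕ) : 0 < alphaInvValue d N :=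
  Nat.choose_pos (by omega)

theorem alphaInvValue_eq_multichoose (d N : ℕ) :
    alphaInvValue d N = d.multichoose (Nat.log 2 N) := by
  rw [Nat.multichoose_eq, alphaInvValue]

theorem takes_alphaInv {d : ℕ} (hd : 0 < d) (N : ℕ) {s : ℕ}
    (hs : d * (Nat.log 2 N + d + 1) ≤ s) :
    Takes (alphaInv d N) (alphaInvValue d N) (8 * (s + 1) ^ 3) := by
  set L := Nat.log 2 N with hL
  have hLs : L + d + 1 ≤ s := le_trans (Nat.le_mul_of_pos_left _ hd) hs
  -- One common bound for all partial rising factorials and factorials.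
  have hpow : (L + d) ^ d < 2 ^ s :=
    calc (L + d) ^ d ≤ (2 ^ (L + d)) ^ d := Nat.pow_le_pow_left Nat.lt_two_pow_self.le d
      _ = 2 ^ ((L + d) * d) := (pow_mul ..).symm
      _ < 2 ^ s := Nat.pow_lt_pow_right (by omega) (by nlinarith)
  have hasc : ∀ i ≤ d - 1, (L + 1).ascFactorial i < 2 ^ s := fun i hi => by
    refine lt_of_le_of_lt ?_ hpow
    refine (Nat.ascFactorial_le_pow_add L i).trans ?_
    exact (Nat.pow_le_pow_left (by omega) i).trans (Nat.pow_le_pow_right (by omega) (by omega))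
  have hfac : ∀ i ≤ d - 1, i.factorial < 2 ^ s := fun i hi => by
    refine lt_of_le_of_lt ?_ hpow
    refine (Nat.factorial_le_pow i).trans ?_
    exact (Nat.pow_le_pow_left (by omega) i).trans (Nat.pow_le_pow_right (by omega) (by omega))
  have h1 := takes_foldList (f := fun x i => (add L i).bind fun y => mul x y)
    (t := 2 * s + 1 + (s + 1) ^ 2) (List.range' 1 (d - 1)) (fun i => (L + 1).ascFactorial i) ?_
  · have h2 := takes_foldList (f := fun y i => mul y i)
      (t := (s + 1) ^ 2) (List.range' 1 (d - 1)) (fun i => i.factorial) ?_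
    · have h3 := takes_div (hasc (d - 1) le_rfl) (hfac (d - 1) le_rfl)
      rw [← alphaInvValue_eq hd] at h3
      simp only [List.length_range', Nat.ascFactorial_zero, Nat.factorial_zero] at h1 h2
      have h4 : Takes (log2 N) L (s + 2) := takes_charge (by
        have : N.size ≤ L + 1 := Nat.size_le.2 (Nat.lt_pow_succ_log_self (by omega) N)
        omega) _
      have h5 := h2.bind (f := fun y => div ((L + 1).ascFactorial (d - 1)) y) h3
      have h6 := h1.bind (f := fun x =>
        (foldList (fun y i => mul y i) 1 (List.range' 1 (d - 1))).bind fun y => div x y) h5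
      have h7 := h4.bind (f := fun L =>
        (foldList (fun x i => (add L i).bind fun y => mul x y) 1 (List.range' 1 (d - 1))).bind
          fun x => (foldList (fun y i => mul y i) 1 (List.range' 1 (d - 1))).bind
            fun y => div x y) h6
      refine Takes.mono h7 ?_
      have hds : d - 1 ≤ s := by omega
      have := Nat.mul_le_mul_right (2 * s + 1 + (s + 1) ^ 2 + 1) hds
      have := Nat.mul_le_mul_right ((s + 1) ^ 2 + 1) hds
      nlinarith [Nat.zero_le (s ^ 3)]
    · intro i hi
      have hi' : i < d - 1 := by simpa using hi
      rw [List.getElem_range', Nat.factorial_succ, one_mul, mul_comm, add_comm]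
      exact takes_mul (hfac i (by omega)) (lt_two_pow_of_le (by omega))
  · intro i hi
    have hi' : i < d - 1 := by simpa using hi
    rw [List.getElem_range', Nat.ascFactorial_succ, one_mul]
    have e1 : L + 1 + i = L + (1 + i) := by omega
    rw [e1, mul_comm]
    exact (takes_add (lt_two_pow_of_le (by omega)) (lt_two_pow_of_le (by omega))).bind
      (f := fun y => mul _ y) (takes_mul (hasc i (by omega)) (lt_two_pow_of_le (by omega)))

/-- Bounds on the cost, measured by `g`, of a unit of time, of a primality test, and of a
factorization of `p𝓞_K`, for numbers up to `M`. -/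
structure CostBound (P : Prices) (g : Cost →+ ℝ≥0∞) (M : ℕ) (w τ σ : ℝ≥0∞) : Prop where
  time : ∀ t : ℕ, g ⟨0, 0, t⟩ ≤ w * t
  test : ∀ m ≤ M, g ⟨1, 0, P.test m⟩ ≤ τ
  split : ∀ p ≤ M, g ⟨0, 1, P.split p⟩ ≤ σ

/-- With the zero measure the cost lemmas become pure statements about results, so correctness and
cost share one proof. -/
theorem costBound_zero (P : Prices) (M : ℕ) : CostBound P 0 M 0 0 0 :=
  ⟨by simp, by simp, by simp⟩

section

variable {P : Prices} {g : Cost →+ ℝ≥0∞} {M : ℕ} {w τ σ : ℝ≥0∞}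

theorem CostBound.runs_primalityTest (h : CostBound P g M w τ σ) {m : ℕ} (hm : m ≤ M) :
    Runs g (primalityTest P m) (decide m.Prime) τ := (runs_pay _ _).mono (h.test m hm)

theorem CostBound.runs_factorPrime (K : Type u) [Field K] [NumberField K]
    (h : CostBound P g M w τ σ) {p : ℕ} (hp : p ≤ M) :
    Runs g (factorPrime K P p) (splittingData K p) σ := (runs_pay _ _).mono (h.split p hp)

theorem card_primesIoc_zero_le (d : ℕ) : (primesIoc 0 d).card ≤ d - 1 := by
  have : primesIoc 0 d ⊆ Finset.Icc 2 d := fun p hp => by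
    simp only [primesIoc, Finset.mem_filter, Finset.mem_Ioc] at hp
    exact Finset.mem_Icc.2 ⟨hp.2.two_le, hp.1.2⟩
  simpa using Finset.card_le_card this

/-- `N` times one factor `α⁻¹` for every prime `p ≤ d`. -/
def baseValue (d N : ℕ) : ℕ := N * alphaInvValue d N ^ (primesIoc 0 d).card

theorem runs_baseDenominator (h : CostBound P g M w τ σ) {d : ℕ} (hd : 0 < d) (hdM : d ≤ M)
    {N s : ℕ} (hs : d * (Nat.log 2 N + d + 1) ≤ s) (hs' : N * alphaInvValue d N ^ d < 2 ^ s)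
    (ha : alphaInvValue d N < 2 ^ s) :
    Runs g (baseDenominator P d N) (baseValue d N) (w * (10 * (s + 1) ^ 3 : ℕ) + d * τ) := by
  -- The list of candidates starts at `2`, so after `i` entries exactly the primes up to `i + 1`
  -- have been treated.
  have h1 := runs_foldList h.time (k := τ + w * ((s + 1) ^ 2 : ℕ))
    (f := fun x p => (primalityTest P p).bind fun isPrime =>
      if isPrime then mul x (alphaInvValue d N) else ret x) (List.range' 2 (d - 1))
    (fun i => N * alphaInvValue d N ^ (primesIoc 0 (i + 1)).card) ?_
  · have h2 := ((takes_alphaInv hd N hs).runs h.time).bind (f := fun a =>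
      foldList (fun x p => (primalityTest P p).bind fun isPrime =>
      if isPrime then mul x a else ret x) N (List.range' 2 (d - 1))) (by
        have e0 : (primesIoc 0 (0 + 1)).card = 0 := by decide
        rwa [e0, pow_zero, mul_one] at h1)
    have e1 : d - 1 + 1 = d := by omega
    simp only [List.length_range', e1] at h2
    refine Runs.mono h2 ?_
    have hds : d ≤ s := by nlinarith [Nat.zero_le (Nat.log 2 N)]
    calc w * (8 * (s + 1) ^ 3 : ℕ) + (((d - 1 : ℕ) : ℝ≥0∞) * (w + (τ + w * ((s + 1) ^ 2 : ℕ))) + w)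
        = w * ((8 * (s + 1) ^ 3 + (d - 1) * (1 + (s + 1) ^ 2) + 1 : ℕ) : ℝ≥0∞)
          + ((d - 1 : ℕ) : ℝ≥0∞) * τ := by push_cast; ring
      _ ≤ _ := by
        gcongr
        · have := Nat.mul_le_mul_right (1 + (s + 1) ^ 2) (show d - 1 ≤ s by omega)
          nlinarith [Nat.zero_le (s ^ 3)]
        · omega
  · intro i hi
    have hi' : i < d - 1 := by simpa using hi
    rw [List.getElem_range', one_mul]
    refine (h.runs_primalityTest (m := 2 + i) (by omega)).bind ?_
    have e0 : Finset.Ioc 0 (i + 1 + 1) = insert (2 + i) (Finset.Ioc 0 (i + 1)) := by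
      ext x; simp only [Finset.mem_Ioc, Finset.mem_insert]; omega
    by_cases hp : (2 + i).Prime
    · have e1 : (primesIoc 0 (i + 1 + 1)).card = (primesIoc 0 (i + 1)).card + 1 := by
        rw [primesIoc, e0, Finset.filter_insert, if_pos hp, Finset.card_insert_of_notMem, primesIoc]
        simp only [Finset.mem_filter, Finset.mem_Ioc]
        omega
      simp only [hp, decide_true, if_true]
      rw [e1, pow_succ, ← mul_assoc]
      refine (takes_mul ?_ ha).runs h.time
      refine lt_of_le_of_lt ?_ hs'
      have := card_primesIoc_zero_le (i + 1)
      exact Nat.mul_le_mul_left _ (Nat.pow_le_pow_right (alphaInvValue_pos hd N) (by omega))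
    · have e1 : (primesIoc 0 (i + 1 + 1)).card = (primesIoc 0 (i + 1)).card := by
        rw [primesIoc, e0, Finset.filter_insert, if_neg hp, primesIoc]
      simp only [hp, decide_false, Bool.false_eq_true, if_false]
      rw [e1]
      exact (runs_ret _).mono zero_le

end

end FactoredIdeals

namespace FactoredIdeals

universe u v w

/-! ## The acceptance ratio -/

theorem prod_map_le_prod_map {α : Type*} (l : List α) {f h : α → ℕ} (H : ∀ x ∈ l, f x ≤ h x) :
    (l.map f).prod ≤ (l.map h).prod := by
  induction l with
  | nil => simp
  | cons a l ih =>
    simp only [List.map_cons, List.prod_cons]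
    exact Nat.mul_le_mul (H a (by simp)) (ih fun x hx => H x (by simp [hx]))

theorem prod_map_pow_eq {α : Type*} (l : List α) (f : α → ℕ) (k : ℕ) :
    (l.map fun x => f x ^ k).prod = (l.map f).prod ^ k := by
  induction l with
  | nil => simp
  | cons a l ih => simp [ih, mul_pow]

theorem prod_map_take_dvd {α : Type*} (l : List α) (h : α → ℕ) (i : ℕ) :
    ((l.take i).map h).prod ∣ (l.map h).prod := by
  conv_rhs => rw [← List.take_append_drop i l, List.map_append, List.prod_append]
  exact Dvd.intro _ rfl

/-- The base `p` or `p - p̄ + 1` of the numerator of the acceptance probability. -/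
def keepBase (d p : ℕ) : ℕ := if p ≤ d then p else p - residue d p + 1

/-- The base `p - 1` or `d` of the denominator of the acceptance probability. -/
def dropBase (d p : ℕ) : ℕ := if p ≤ d then p - 1 else d

theorem residue_pos (d p : ℕ) : 0 < residue d p := Nat.succ_pos _

theorem residue_le {d : ℕ} (hd : 0 < d) (p : ℕ) : residue d p ≤ d := Nat.mod_lt _ hd

theorem keepBase_pos {d p : ℕ} (hp : p.Prime) : 0 < keepBase d p := by
  unfold keepBase
  split_ifs
  · exact hp.pos
  · omega

theorem keepBase_le {d p : ℕ} (hp : p.Prime) : keepBase d p ≤ p := by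
  unfold keepBase
  have := residue_pos d p
  have := hp.pos
  split_ifs <;> omega

theorem dropBase_pos {d p : ℕ} (hd : 0 < d) (hp : p.Prime) : 0 < dropBase d p := by
  unfold dropBase
  have := hp.two_le
  split_ifs <;> omega

theorem dropBase_le {d p : ℕ} : dropBase d p ≤ p := by
  unfold dropBase
  split_ifs <;> omega

section

variable (K : Type u) [Field K] [NumberField K]

/-- The contribution of `p ^ e` to the numerator of the acceptance probability. -/
noncomputable def numeratorFactor (q : ℕ × ℕ) : ℕ :=
  numSolutions (degreesAbove K q.1) q.2 * keepBase (Module.finrank ℚ K) q.1 ^ q.2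

/-- The contribution of `p ^ e` to the denominator of the acceptance probability. -/
noncomputable def denominatorFactor (q : ℕ × ℕ) : ℕ := dropBase (Module.finrank ℚ K) q.1 ^ q.2

/-- A prime power with the splitting data of the prime. -/
noncomputable def toPrimePower (q : ℕ × ℕ) : PrimePower K := ⟨q.1, q.2, splittingData K q.1⟩

theorem finrank_pos' : 0 < Module.finrank ℚ K := Module.finrank_pos

variable {K}

theorem IsFactorizationOf.prime {l : List (ℕ × ℕ)} {r : ℕ} (h : IsFactorizationOf l r)
    {q : ℕ × ℕ} (hq : q ∈ l) : q.1.Prime := (h.2.1 q hq).1.nat_prime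

theorem IsFactorizationOf.ne_zero {l : List (ℕ × ℕ)} {r : ℕ} (h : IsFactorizationOf l r) :
    r ≠ 0 := by
  rw [← h.2.2]
  refine List.prod_ne_zero fun h0 => ?_
  obtain ⟨q, hq, h1⟩ := List.mem_map.1 h0
  exact pow_ne_zero _ (h.prime hq).ne_zero h1

theorem IsFactorizationOf.pow_dvd {l : List (ℕ × ℕ)} {r : ℕ} (h : IsFactorizationOf l r)
    {q : ℕ × ℕ} (hq : q ∈ l) : q.1 ^ q.2 ∣ r := by
  rw [← h.2.2]
  exact List.dvd_prod (List.mem_map_of_mem hq)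

theorem numSolutions_degreesAbove_le {p : ℕ} (hp : p.Prime) (e : ℕ) :
    numSolutions (degreesAbove K p) e ≤ (Module.finrank ℚ K).multichoose e :=
  (numSolutions_le_multichoose _ (degreesAbove_pos hp) e).trans
    (multichoose_mono_left (sum_degreesAbove_le hp) e)

theorem numSolutions_degreesAbove_le_pow {p : ℕ} (hp : p.Prime) {e : ℕ} (he : 0 < e) :
    numSolutions (degreesAbove K p) e ≤ (p ^ e) ^ (Module.finrank ℚ K + 1) := by
  refine ((numSolutions_degreesAbove_le hp e).trans (multichoose_le_two_pow _ _)).trans ?_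
  rw [← pow_mul]
  refine (Nat.pow_le_pow_left hp.two_le _).trans (Nat.pow_le_pow_right hp.pos ?_)
  nlinarith [Nat.zero_le (Module.finrank ℚ K)]

theorem numeratorFactor_le {p e : ℕ} (hp : p.Prime) (he : 0 < e) :
    numeratorFactor K (p, e) ≤ (p ^ e) ^ (Module.finrank ℚ K + 2) := by
  rw [numeratorFactor, pow_succ _ (Module.finrank ℚ K + 1)]
  exact Nat.mul_le_mul (numSolutions_degreesAbove_le_pow hp he)
    (Nat.pow_le_pow_left (keepBase_le hp) e)

variable {P : Prices} {g : Cost →+ ℝ≥0∞} {M : ℕ} {w τ σ : ℝ≥0∞}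

set_option maxHeartbeats 800000 in
-- Partial numerators stay below `r ^ (d + 2)` and partial denominators below `base * r`, so every
-- number fits into `s` bits. A multiplication then costs at most `(s + 1) ^ 2`, and a power or a
-- count of solutions `O((s + 1) ^ 3)`.
theorem runs_acceptanceRatio (h : CostBound P g M w τ σ) {l : List (ℕ × ℕ)} {r N base s : ℕ}
    (hl : IsFactorizationOf l r) (hrN : r ≤ N) (hNM : N ≤ M) (hbase : 0 < base)
    (hs : base * N ^ (Module.finrank ℚ K + 2) < 2 ^ s) :
    Runs g (acceptanceRatio K P (Module.finrank ℚ K) base l)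
      ((l.map (numeratorFactor K)).prod, base * (l.map (denominatorFactor K)).prod,
        (l.map (toPrimePower K)).reverse)
      (l.length * (w + (σ + w * (30 * (s + 1) ^ 3 : ℕ))) + w) := by
  set d := Module.finrank ℚ K with hd
  have hd0 : 0 < d := finrank_pos' K
  have hr0 : 0 < r := Nat.pos_of_ne_zero hl.ne_zero
  have hN1 : 1 ≤ N := by omega
  have hNs : ∀ x ≤ N ^ (d + 2), x < 2 ^ s := fun x hx =>
    lt_of_le_of_lt (hx.trans (Nat.le_mul_of_pos_left _ hbase)) hs
  have hNs' : ∀ x ≤ base * N, x < 2 ^ s := fun x hx =>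
    lt_of_le_of_lt (hx.trans (Nat.mul_le_mul_left _ (Nat.le_self_pow (by omega) N))) hs
  have hnum : ∀ i, ((l.take i).map (numeratorFactor K)).prod < 2 ^ s := fun i => by
    refine hNs _ ?_
    calc ((l.take i).map (numeratorFactor K)).prod
        ≤ ((l.take i).map fun q => (q.1 ^ q.2) ^ (d + 2)).prod :=
          prod_map_le_prod_map _ fun q hq =>
            have hq := List.mem_of_mem_take hq
            numeratorFactor_le (hl.prime hq) (hl.2.1 q hq).2
      _ ≤ (l.map fun q => (q.1 ^ q.2) ^ (d + 2)).prod := by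
          refine Nat.le_of_dvd ?_ (prod_map_take_dvd _ _ _)
          rw [prod_map_pow_eq l fun q => q.1 ^ q.2, hl.2.2]
          positivity
      _ ≤ N ^ (d + 2) := by
          rw [prod_map_pow_eq l fun q => q.1 ^ q.2, hl.2.2]
          exact Nat.pow_le_pow_left hrN _
  have hden : ∀ i, base * ((l.take i).map (denominatorFactor K)).prod < 2 ^ s := fun i => by
    refine hNs' _ (Nat.mul_le_mul_left _ ?_)
    calc ((l.take i).map (denominatorFactor K)).prod
        ≤ ((l.take i).map fun q => q.1 ^ q.2).prod :=
          prod_map_le_prod_map _ fun q hq => Nat.pow_le_pow_left dropBase_le _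
      _ ≤ (l.map fun q => q.1 ^ q.2).prod := by
          refine Nat.le_of_dvd ?_ (prod_map_take_dvd _ _ _)
          rw [hl.2.2]
          exact hr0
      _ ≤ N := by rw [hl.2.2]; exact hrN
  have key := runs_foldList h.time (k := σ + w * (30 * (s + 1) ^ 3 : ℕ))
    (f := fun (x : ℕ × ℕ × List (PrimePower K)) (q : ℕ × ℕ) =>
      (factorPrime K P q.1).bind fun S =>
      (charge S.length (S.map PrimeAbove.degree)).bind fun fs =>
      (countSolutions fs q.2).bind fun D =>
      (le q.1 d).bind fun small =>
      (if small then
        (sub q.1 1).bind fun b => ret (q.1, b)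
      else
        (sub q.1 1).bind fun y => (mod y d).bind fun z => (add z 1).bind fun t =>
        (sub q.1 t).bind fun a => (add a 1).bind fun a => ret (a, d)).bind fun ab =>
      (pow ab.1 q.2).bind fun a => (pow ab.2 q.2).bind fun b =>
      (mul x.1 D).bind fun num => (mul num a).bind fun num =>
      (mul x.2.1 b).bind fun den =>
      charge 1 (num, den, ⟨q.1, q.2, S⟩ :: x.2.2)) l
    (fun i => (((l.take i).map (numeratorFactor K)).prod,
      base * ((l.take i).map (denominatorFactor K)).prod,
        ((l.take i).map (toPrimePower K)).reverse)) ?_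
  · simpa [acceptanceRatio] using key
  intro i hi
  obtain ⟨p, e, hq⟩ : ∃ p e, l[i] = (p, e) := ⟨_, _, rfl⟩
  have hmem : (p, e) ∈ l := hq ▸ List.getElem_mem hi
  have hp : p.Prime := hl.prime hmem
  have he : 0 < e := (hl.2.1 _ hmem).2
  have hpe : p ^ e ≤ N := (Nat.le_of_dvd hr0 (hl.pow_dvd hmem)).trans hrN
  have hpN : p ≤ N := (Nat.le_self_pow (by omega) p).trans hpe
  have htake : l.take (i + 1) = l.take i ++ [(p, e)] := by
    rw [← hq]; exact (List.take_append_getElem hi).symm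
  have e1 : ((l.take (i + 1)).map (numeratorFactor K)).prod =
      ((l.take i).map (numeratorFactor K)).prod * numSolutions (degreesAbove K p) e *
        keepBase d p ^ e := by
    rw [htake]; simp [numeratorFactor, mul_assoc, hd]
  have e2 : base * ((l.take (i + 1)).map (denominatorFactor K)).prod =
      base * ((l.take i).map (denominatorFactor K)).prod * dropBase d p ^ e := by
    rw [htake]; simp [denominatorFactor, mul_assoc, hd]
  have e3 : ((l.take (i + 1)).map (toPrimePower K)).reverse =
      ⟨p, e, splittingData K p⟩ :: ((l.take i).map (toPrimePower K)).reverse := by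
    rw [htake]; simp [toPrimePower]
  -- From `2 ^ e ≤ p ^ e ≤ N` and `N ^ (d + 2) < 2 ^ s`. It makes the row length `e + 1` of the
  -- dynamic program and the number of degrees at most `s`.
  have hes : e * (d + 2) < s := by
    refine (Nat.pow_lt_pow_iff_right (a := 2) (by omega)).1 (hNs _ ?_)
    rw [pow_mul]
    exact Nat.pow_le_pow_left ((Nat.pow_le_pow_left hp.two_le e).trans hpe) _
  have hdes : d + e + 2 ≤ s := by nlinarith
  have hps : p < 2 ^ s := hNs' p (hpN.trans (Nat.le_mul_of_pos_left _ hbase))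
  have hlt : ∀ x ≤ s, x < 2 ^ s := fun x hx => lt_two_pow_of_le hx
  have hK1 := keepBase_pos (d := d) hp
  have hK2 := keepBase_le (d := d) hp
  have hD1 := dropBase_pos hd0 hp
  have hD2 := dropBase_le (d := d) (p := p)
  have hKe : keepBase d p ^ e < 2 ^ s := hNs' _ (((Nat.pow_le_pow_left hK2 e).trans hpe).trans
    (Nat.le_mul_of_pos_left _ hbase))
  have hDe : dropBase d p ^ e < 2 ^ s := hNs' _ (((Nat.pow_le_pow_left hD2 e).trans hpe).trans
    (Nat.le_mul_of_pos_left _ hbase))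
  have hDs : numSolutions (degreesAbove K p) e < 2 ^ s := by
    refine hNs _ ((numSolutions_degreesAbove_le_pow hp he).trans ?_)
    exact (Nat.pow_le_pow_left hpe _).trans (Nat.pow_le_pow_right hN1 (by omega))
  have hlen : (splittingData K p).length ≤ d := by
    have h1 : (splittingData K p).length = (degreesAbove K p).length := by simp [degreesAbove]
    rw [h1]
    refine le_trans ?_ (sum_degreesAbove_le (K := K) hp)
    exact List.length_le_sum_of_one_le _ fun f hf => degreesAbove_pos hp f hf
  have hcount := takes_countSolutions (degreesAbove_pos (K := K) hp) (sum_degreesAbove_le hp) e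
  have hcount' : Takes (countSolutions (degreesAbove K p) e) (numSolutions (degreesAbove K p) e)
      (8 * (s + 1) ^ 3) := by
    refine hcount.mono ?_
    have h1 : (degreesAbove K p).length + 1 ≤ s := by
      have : (degreesAbove K p).length = (splittingData K p).length := by simp [degreesAbove]
      omega
    calc _ ≤ s * (s * (8 * s) + 2) + s := by gcongr <;> omega
      _ ≤ _ := by nlinarith [Nat.zero_le (s ^ 2)]
  have hbases : Takes (if decide (p ≤ d) = true then
        (sub p 1).bind fun b => ret (p, b)
      else
        (sub p 1).bind fun y => (mod y d).bind fun z => (add z 1).bind fun t =>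
        (sub p t).bind fun a => (add a 1).bind fun a => ret (a, d))
      (keepBase d p, dropBase d p) (4 * (2 * s + 1) + (s + 1) ^ 2) := by
    by_cases hpd : p ≤ d
    · simp only [hpd, decide_true, if_true, keepBase, dropBase]
      exact ((takes_sub hps (hlt 1 (by omega))).bind (f := fun b => ret (p, b))
        (takes_ret _)).mono (by nlinarith)
    · have hm : (p - 1) % d < d := Nat.mod_lt _ hd0
      simp only [hpd, decide_false, Bool.false_eq_true, if_false, keepBase, dropBase]
      have hp1 : p - 1 < 2 ^ s := by omega
      have hsm : (p - 1) % d + 1 ≤ s := by omega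
      have h4 := (takes_add (a := p - residue d p) (b := 1) (s := s) (by omega)
        (hlt _ (by omega))).bind (f := fun a => ret (a, d)) (takes_ret _)
      have h3 := (takes_sub hps (hlt _ hsm)).bind (f := fun a => (add a 1).bind
        fun a => ret (a, d)) h4
      have h2 := (takes_add (hlt _ ((Nat.le_succ _).trans hsm)) (hlt 1 (by omega))).bind
        (f := fun t => (sub p t).bind fun a => (add a 1).bind fun a => ret (a, d)) h3
      have h1 := (takes_mod hp1 (hlt d (by omega))).bind (f := fun z => (add z 1).bind fun t =>
        (sub p t).bind fun a => (add a 1).bind fun a => ret (a, d)) h2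
      have h0 := (takes_sub hps (hlt 1 (by omega))).bind (f := fun y => (mod y d).bind fun z =>
        (add z 1).bind fun t =>
        (sub p t).bind fun a => (add a 1).bind fun a => ret (a, d)) h1
      exact h0.mono (by omega)
  have hpow1 : Takes (pow (keepBase d p) e) (keepBase d p ^ e) ((s + 1) ^ 3) := by
    refine (takes_pow hK1 (lt_of_le_of_lt hK2 hps) hKe).mono ?_
    have := Nat.mul_le_mul_right ((s + 1) ^ 2 + 1) (show e ≤ s by omega)
    nlinarith
  have hpow2 : Takes (pow (dropBase d p) e) (dropBase d p ^ e) ((s + 1) ^ 3) := by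
    refine (takes_pow hD1 (lt_of_le_of_lt hD2 hps) hDe).mono ?_
    have := Nat.mul_le_mul_right ((s + 1) ^ 2 + 1) (show e ≤ s by omega)
    nlinarith
  simp only [hq]
  rw [e1, e2, e3]
  refine (h.runs_factorPrime K (hpN.trans hNM)).bind (Takes.runs h.time ?_)
  have hmid : ((l.take i).map (numeratorFactor K)).prod * numSolutions (degreesAbove K p) e <
      2 ^ s := lt_of_le_of_lt (Nat.le_mul_of_pos_right _ (Nat.pow_pos hK1))
        (e1 ▸ hnum (i + 1))
  refine ((takes_charge hlen _).bind (t' := 8 * (s + 1) ^ 3 + ((2 * s + 1) +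
    ((4 * (2 * s + 1) + (s + 1) ^ 2) + ((s + 1) ^ 3 + ((s + 1) ^ 3 + ((s + 1) ^ 2 +
      ((s + 1) ^ 2 + ((s + 1) ^ 2 + 1)))))))) ?_).mono ?_
  · refine hcount'.bind ?_
    refine (takes_le hps (hlt d (by omega))).bind ?_
    refine hbases.bind ?_
    refine hpow1.bind ?_
    refine hpow2.bind ?_
    refine (takes_mul (hnum i) hDs).bind ?_
    refine (takes_mul hmid hKe).bind ?_
    refine (takes_mul (hden i) hDe).bind ?_
    exact takes_charge le_rfl _
  · have h2 : (s + 1) ^ 2 ≤ (s + 1) ^ 3 := Nat.pow_le_pow_right (by omega) (by omega)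
    have h1 : s + 1 ≤ (s + 1) ^ 3 := Nat.le_self_pow (by omega) _
    have hds : d ≤ s := by omega
    clear * - h1 h2 hds
    generalize (s + 1) ^ 3 = X at *
    generalize (s + 1) ^ 2 = Y at *
    omega

end

end FactoredIdeals

namespace FactoredIdeals

universe u v w

/-! ## Products over factorization lists -/

theorem IsFactorizationOf.tail {p e r : ℕ} {l : List (ℕ × ℕ)}
    (h : IsFactorizationOf ((p, e) :: l) r) :
    ∃ r', IsFactorizationOf l r' ∧ r = p ^ e * r' ∧ ¬ p ∣ r' := by
  obtain ⟨h1, h2, h3⟩ := h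
  simp only [List.map_cons, List.nodup_cons] at h1
  refine ⟨_, ⟨h1.2, fun q hq => h2 q (by simp [hq]), rfl⟩, by simpa using h3.symm, ?_⟩
  have hp := (h2 (p, e) (by simp)).1
  intro hd
  obtain ⟨x, hx, hpx⟩ := (Prime.dvd_prod_iff hp).1 hd
  obtain ⟨q, hq, rfl⟩ := List.mem_map.1 hx
  have hq' := (h2 q (by simp [hq])).1
  have := (Nat.prime_dvd_prime_iff_eq hp.nat_prime hq'.nat_prime).1 (hp.dvd_of_dvd_pow hpx)
  exact h1.1 (List.mem_map.2 ⟨q, hq, this.symm⟩)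

theorem IsFactorizationOf.prod_map {M : Type*} [CommMonoid M] {l : List (ℕ × ℕ)} {r : ℕ}
    (h : IsFactorizationOf l r) (f : ℕ → ℕ → M) :
    (l.map fun q => f q.1 q.2).prod = r.factorization.prod f := by
  induction l generalizing r with
  | nil =>
    have : r = 1 := by simpa using h.2.2.symm
    simp [this]
  | cons q l ih =>
    obtain ⟨p, e⟩ := q
    have hp : p.Prime := h.prime (q := (p, e)) (by simp)
    have he : 0 < e := (h.2.1 (p, e) (by simp)).2
    obtain ⟨r', h', rfl, hd⟩ := h.tail
    have hco : (p ^ e).Coprime r' := Nat.Coprime.pow_left _ (hp.coprime_iff_not_dvd.2 hd)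
    rw [List.map_cons, List.prod_cons, ih h', Nat.factorization_mul_of_coprime hco,
      Finsupp.prod_add_index_of_disjoint hco.disjoint_primeFactors, hp.factorization_pow]
    congr 1
    have hs : (Finsupp.single p e).support = {p} := by simp [Finsupp.support_single, he.ne']
    rw [Finsupp.prod, hs]
    simp

theorem IsFactorizationOf.reverse {M : Type*} [CommMonoidWithZero M] {l : List (M × ℕ)} {x : M}
    (h : IsFactorizationOf l x) : IsFactorizationOf l.reverse x := by
  refine ⟨?_, fun q hq => h.2.1 q (by simpa using hq), ?_⟩
  · rw [List.map_reverse, List.nodup_reverse]; exact h.1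
  · rw [List.map_reverse, List.prod_reverse]; exact h.2.2

theorem mem_primesIoc {a b p : ℕ} : p ∈ primesIoc a b ↔ (a < p ∧ p ≤ b) ∧ p.Prime := by
  simp [primesIoc]

section

variable {K : Type u} [Field K] [NumberField K]

theorem prod_dropBase (d : ℕ) {r : ℕ} :
    (r.factorization.prod fun p e => ((dropBase d p : ℕ) : ℝ) ^ e) =
      (∏ p ∈ primesIoc 0 d, ((p : ℝ) - 1) ^ r.factorization p) *
        (d : ℝ) ^ bigOmegaAbove d r := by
  rw [Finsupp.prod, Nat.support_factorization,
    ← Finset.prod_filter_mul_prod_filter_not r.primeFactors (fun p => p ≤ d)]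
  congr 1
  · have h1 : r.primeFactors.filter (fun p => p ≤ d) ⊆ primesIoc 0 d := fun p hp => by
      rw [Finset.mem_filter] at hp
      have hpp := Nat.prime_of_mem_primeFactors hp.1
      exact mem_primesIoc.2 ⟨⟨hpp.pos, hp.2⟩, hpp⟩
    rw [← Finset.prod_subset h1]
    · refine Finset.prod_congr rfl fun p hp => ?_
      rw [Finset.mem_filter] at hp
      have hpp := (Nat.prime_of_mem_primeFactors hp.1).one_le
      rw [dropBase, if_pos hp.2, Nat.cast_sub hpp, Nat.cast_one]
    · intro p hp hn
      have hp' := mem_primesIoc.1 hp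
      have : p ∉ r.primeFactors := fun h => hn (Finset.mem_filter.2 ⟨h, hp'.1.2⟩)
      rw [← Nat.support_factorization, Finsupp.notMem_support_iff] at this
      simp [this]
  · rw [bigOmegaAbove, ← Finset.prod_pow_eq_pow_sum]
    have : (fun p => ¬ p ≤ d) = fun p => d < p := by funext p; simp
    simp only [not_le]
    refine Finset.prod_congr rfl fun p hp => ?_
    rw [dropBase, if_neg (by simpa using (Finset.mem_filter.1 hp).2)]

/-- The real number in the analysis is the quotient of the two integers that the algorithm computes,
so the acceptance test is exact. -/
theorem acceptProb_eq {N r : ℕ} {l : List (ℕ × ℕ)} (hl : IsFactorizationOf l r) :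
    acceptProb K N r = ((l.map (numeratorFactor K)).prod : ℕ) /
      ((baseValue (Module.finrank ℚ K) N * (l.map (denominatorFactor K)).prod : ℕ) : ℝ) := by
  have h1 : (l.map (numeratorFactor K)).prod =
      psi (Module.finrank ℚ K) r * idealCount K r := by
    rw [idealCount_eq_prod hl.ne_zero, psi, ← Finsupp.prod_mul, ← hl.prod_map]
    congr 1
    refine List.map_congr_left fun q _ => ?_
    rw [numeratorFactor, mul_comm, keepBase]
  have h2 : (((l.map (denominatorFactor K)).prod : ℕ) : ℝ) =
      r.factorization.prod fun p e => ((dropBase (Module.finrank ℚ K) p : ℕ) : ℝ) ^ e := by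
    rw [← hl.prod_map, Nat.cast_list_prod, List.map_map]
    congr 1
    refine List.map_congr_left fun q _ => ?_
    simp [denominatorFactor]
  rw [Nat.cast_mul, h1, h2, prod_dropBase, acceptProb, smallPrimeFactor, baseValue]
  simp only [Finset.prod_mul_distrib, Finset.prod_const, alpha, one_div, inv_pow,
    Finset.prod_inv_distrib, alphaInvValue]
  push_cast
  simp only [div_eq_mul_inv, mul_inv]
  ring

/-- There are two regimes. For `p > d` the denominator supplies `d ^ e ≥ D(p ^ e)`. For `p ≤ d` the
base is only `p - 1`, possibly `1`, and the factor `α⁻¹` takes over; it suffices because `2 ^ e ≤ N`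
gives `e ≤ log₂ N`. -/
theorem numeratorFactor_le' {N p e : ℕ} (hp : p.Prime) (hpe : p ^ e ≤ N) :
    numeratorFactor K (p, e) ≤ p ^ e * denominatorFactor K (p, e) *
      (if p ≤ Module.finrank ℚ K then alphaInvValue (Module.finrank ℚ K) N else 1) := by
  set d := Module.finrank ℚ K with hd
  have hd0 : 0 < d := finrank_pos' K
  simp only [numeratorFactor, denominatorFactor, keepBase, dropBase, ← hd]
  split_ifs with h
  · have h1 : numSolutions (degreesAbove K p) e ≤ alphaInvValue d N := by
      rw [alphaInvValue_eq_multichoose]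
      refine (numSolutions_degreesAbove_le hp e).trans (multichoose_mono_right hd0 ?_)
      exact Nat.le_log_of_pow_le (by omega) ((Nat.pow_le_pow_left hp.two_le e).trans hpe)
    have h2 : 1 ≤ (p - 1) ^ e := Nat.one_le_pow _ _ (by have := hp.two_le; omega)
    calc _ ≤ alphaInvValue d N * p ^ e * 1 := by rw [mul_one]; gcongr
      _ ≤ alphaInvValue d N * p ^ e * (p - 1) ^ e := by gcongr
      _ = _ := by ring
  · have h1 : numSolutions (degreesAbove K p) e ≤ d ^ e :=
      (numSolutions_degreesAbove_le hp e).trans (multichoose_le_pow _ _)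
    have h2 : p - residue d p + 1 ≤ p := by
      have := residue_pos d p
      have := hp.pos
      omega
    rw [mul_one, mul_comm (p ^ e)]
    gcongr

/-- Multiply the local bounds: the prime powers give `r ≤ N`, and at most one `α⁻¹` is spent per
prime `p ≤ d`. These are the two factors of `baseValue`. -/
theorem prod_numeratorFactor_le {N r : ℕ} {l : List (ℕ × ℕ)} (hl : IsFactorizationOf l r)
    (hrN : r ≤ N) : (l.map (numeratorFactor K)).prod ≤
      baseValue (Module.finrank ℚ K) N * (l.map (denominatorFactor K)).prod := by
  set d := Module.finrank ℚ K with hd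
  have hd0 : 0 < d := finrank_pos' K
  have h1 : (l.map (numeratorFactor K)).prod ≤ (l.map fun q => q.1 ^ q.2 *
      denominatorFactor K q * (if q.1 ≤ d then alphaInvValue d N else 1)).prod :=
    prod_map_le_prod_map _ fun q hq => numeratorFactor_le' (hl.prime hq)
      ((Nat.le_of_dvd (Nat.pos_of_ne_zero hl.ne_zero) (hl.pow_dvd hq)).trans hrN)
  have h2 : (l.map fun q : ℕ × ℕ => if q.1 ≤ d then alphaInvValue d N else 1).prod ≤
      alphaInvValue d N ^ (primesIoc 0 d).card := by
    rw [hl.prod_map fun p _ => if p ≤ d then alphaInvValue d N else 1, Finsupp.prod,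
      ← Finset.prod_filter, Finset.prod_const]
    refine Nat.pow_le_pow_right (alphaInvValue_pos hd0 N) (Finset.card_le_card fun p hp => ?_)
    rw [Finset.mem_filter, Nat.support_factorization] at hp
    have hpp := Nat.prime_of_mem_primeFactors hp.1
    exact mem_primesIoc.2 ⟨⟨hpp.pos, hp.2⟩, hpp⟩
  refine h1.trans ?_
  rw [List.prod_map_mul, List.prod_map_mul, hl.2.2, baseValue]
  calc r * (l.map (denominatorFactor K)).prod *
        (l.map fun q : ℕ × ℕ => if q.1 ≤ d then alphaInvValue d N else 1).prod
      ≤ N * (l.map (denominatorFactor K)).prod * alphaInvValue d N ^ (primesIoc 0 d).card := by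
        gcongr
    _ = _ := by ring

theorem baseValue_pos {N : ℕ} (hN : 0 < N) : 0 < baseValue (Module.finrank ℚ K) N :=
  Nat.mul_pos hN (Nat.pow_pos (alphaInvValue_pos (finrank_pos' K) N))

theorem prod_denominatorFactor_pos {r : ℕ} {l : List (ℕ × ℕ)} (hl : IsFactorizationOf l r) :
    0 < (l.map (denominatorFactor K)).prod := by
  refine Nat.pos_of_ne_zero (List.prod_ne_zero fun h0 => ?_)
  obtain ⟨q, hq, h1⟩ := List.mem_map.1 h0
  exact (Nat.pow_pos (dropBase_pos (finrank_pos' K) (hl.prime hq))).ne' h1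

theorem exists_isFactorizationOf {r : ℕ} (hr : r ≠ 0) : ∃ l, IsFactorizationOf l r := by
  refine ⟨r.primeFactors.toList.map fun p => (p, r.factorization p), ?_, ?_, ?_⟩
  · simpa [Function.comp_def] using Finset.nodup_toList _
  · intro q hq
    simp only [List.mem_map, Finset.mem_toList] at hq
    obtain ⟨p, hp, rfl⟩ := hq
    have hpp := Nat.prime_of_mem_primeFactors hp
    exact ⟨hpp.prime, hpp.factorization_pos_of_dvd hr (Nat.dvd_of_mem_primeFactors hp)⟩
  · rw [List.map_map]
    conv_rhs => rw [← Nat.prod_factorization_pow_eq_self hr, Finsupp.prod,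
      Nat.support_factorization]
    exact Finset.prod_map_toList ..

theorem acceptProb_mem {N r : ℕ} (hr : 1 ≤ r) (hrN : r ≤ N) :
    0 ≤ acceptProb K N r ∧ acceptProb K N r ≤ 1 := by
  obtain ⟨l, hl⟩ := exists_isFactorizationOf (show r ≠ 0 by omega)
  rw [acceptProb_eq hl]
  refine ⟨by positivity, div_le_one_of_le₀ ?_ (by positivity)⟩
  exact_mod_cast prod_numeratorFactor_le hl hrN

/-! ## The acceptance step -/

/-- All four bounds reduce to `N ^ (d + 3) * α ^ (-d)`, with `α⁻¹ ≤ 2 ^ (d + log₂ N)`. So the bit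
length needed for computing the ratio is a constant times that of `N`. -/
theorem bit_bounds {d N : ℕ} (hd : 0 < d) (hN : 1 ≤ N) :
    d * (Nat.log 2 N + d + 1) ≤ (d + 2) ^ 2 * N.size ∧
    N * alphaInvValue d N ^ d < 2 ^ ((d + 2) ^ 2 * N.size) ∧
    alphaInvValue d N < 2 ^ ((d + 2) ^ 2 * N.size) ∧
    baseValue d N * N ^ (d + 2) < 2 ^ ((d + 2) ^ 2 * N.size) := by
  set L := Nat.log 2 N with hL
  have hsize : N.size = L + 1 := by
    refine le_antisymm (Nat.size_le.2 (Nat.lt_pow_succ_log_self (by omega) N)) ?_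
    exact Nat.succ_le_of_lt (Nat.lt_size.2 (Nat.pow_log_le_self 2 (by omega)))
  have hN2 : N < 2 ^ (L + 1) := Nat.lt_pow_succ_log_self (by omega) N
  have ha : alphaInvValue d N ≤ 2 ^ (d + L) := by
    rw [alphaInvValue_eq_multichoose]
    exact multichoose_le_two_pow _ _
  have ha0 := alphaInvValue_pos hd N
  have key : N ^ (d + 3) * alphaInvValue d N ^ d < 2 ^ ((d + 2) ^ 2 * (L + 1)) := by
    calc N ^ (d + 3) * alphaInvValue d N ^ d
        ≤ N ^ (d + 3) * (2 ^ (d + L)) ^ d := by gcongr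
      _ < (2 ^ (L + 1)) ^ (d + 3) * (2 ^ (d + L)) ^ d := by
          gcongr
      _ = 2 ^ ((L + 1) * (d + 3) + (d + L) * d) := by rw [← pow_mul, ← pow_mul, ← pow_add]
      _ ≤ _ := Nat.pow_le_pow_right (by omega) (by nlinarith [Nat.zero_le (L * d * d)])
  rw [hsize]
  refine ⟨by nlinarith [Nat.zero_le (L * d * d)], lt_of_le_of_lt ?_ key,
    lt_of_le_of_lt ?_ key, lt_of_le_of_lt ?_ key⟩
  · gcongr
    exact Nat.le_self_pow (by omega) N
  · calc alphaInvValue d N ≤ alphaInvValue d N ^ d := Nat.le_self_pow (by omega) _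
      _ ≤ _ := Nat.le_mul_of_pos_left _ (by positivity)
  · rw [baseValue, pow_succ N (d + 2)]
    have : (primesIoc 0 d).card ≤ d := (card_primesIoc_zero_le d).trans (by omega)
    calc N * alphaInvValue d N ^ (primesIoc 0 d).card * N ^ (d + 2)
        ≤ N * alphaInvValue d N ^ d * N ^ (d + 2) := by gcongr
      _ = _ := by ring

/-- The result of an accepted integer with the given factorization. -/
noncomputable def acceptedValue (K : Type u) [Field K] [NumberField K] (x : ℕ × List (ℕ × ℕ)) :
    FactoredNorm K := ⟨x.1, (x.2.map (toPrimePower K)).reverse⟩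

theorem isFactoredNorm_acceptedValue {r : ℕ} {l : List (ℕ × ℕ)} (hl : IsFactorizationOf l r) :
    IsFactoredNorm r (acceptedValue K (r, l)) := by
  refine ⟨rfl, ?_⟩
  have : (acceptedValue K (r, l)).factors.map (fun q => (q.prime, q.exponent)) = l.reverse := by
    simp [acceptedValue, toPrimePower, Function.comp_def]
  rw [this]
  exact hl.reverse

/-- Exactly `m` of the `n` values lie below `m`, so a uniform integer realizes the rational
probability `m / n` without rounding. -/
theorem mean_uniform_threshold {n m : ℕ} (hn : 0 < n) (hm : m ≤ n) (A B : ℝ≥0∞) :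
    (uniform n).mean (fun t => if m ≤ t then A else B) =
      ENNReal.ofReal (m / n : ℝ) * B + ENNReal.ofReal (1 - m / n : ℝ) * A := by
  have hn0 : (n : ℝ) ≠ 0 := by positivity
  have h1 : ∑ t ∈ Finset.range n, (if m ≤ t then A else B) = m * B + ((n - m : ℕ) : ℝ≥0∞) * A := by
    rw [Finset.range_eq_Ico, ← Finset.sum_Ico_consecutive _ (Nat.zero_le m) hm]
    congr 1
    · rw [Finset.sum_congr rfl fun t ht => if_neg (by have := (Finset.mem_Ico.1 ht).2; omega)]
      simp
    · rw [Finset.sum_congr rfl fun t ht => if_pos (Finset.mem_Ico.1 ht).1]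
      simp
  have h2 : ∀ k : ℕ, ENNReal.ofReal (k / n : ℝ) = (n : ℝ≥0∞)⁻¹ * k := fun k => by
    rw [ENNReal.ofReal_div_of_pos (by positivity), ENNReal.ofReal_natCast, ENNReal.ofReal_natCast,
      ENNReal.div_eq_inv_mul]
  have h3 : (1 - m / n : ℝ) = ((n - m : ℕ) : ℝ) / n := by
    rw [Nat.cast_sub hm]; field_simp
  rw [mean_uniform, h1, h3, h2, h2]
  ring

variable {P : Prices}

theorem mean_acceptStep {N r : ℕ} {l : List (ℕ × ℕ)} (hl : IsFactorizationOf l r) (hrN : r ≤ N)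
    (φ : Option (FactoredNorm K) → ℝ≥0∞) :
    (acceptStep K P (Module.finrank ℚ K) N (r, l)).mean φ =
      ENNReal.ofReal (acceptProb K N r) * φ (some (acceptedValue K (r, l))) +
        ENNReal.ofReal (1 - acceptProb K N r) * φ none := by
  have hd0 := finrank_pos' K
  have hN : 1 ≤ N := (Nat.one_le_iff_ne_zero.2 hl.ne_zero).trans hrN
  obtain ⟨hs1, hs2, hs3, hs4⟩ := bit_bounds hd0 hN
  have hcb := costBound_zero P (N + Module.finrank ℚ K)
  have h1 := runs_baseDenominator hcb hd0 (by omega) hs1 hs2 hs3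
  have h2 := runs_acceptanceRatio (K := K) hcb hl hrN (by omega) (baseValue_pos (by omega)) hs4
  have hle : decide (r ≤ N) = true := by simpa using hrN
  rw [acceptStep, mean_bind, le, mean_charge]
  simp only [hle, if_true, mean_bind]
  rw [h1.mean, h2.mean, acceptProb_eq hl, ← mean_uniform_threshold
    (Nat.mul_pos (baseValue_pos (by omega)) (prod_denominatorFactor_pos hl))
    (prod_numeratorFactor_le hl hrN)]
  congr 1
  funext t
  simp only [le, mean_charge, mean_ret]
  by_cases ht : (l.map (numeratorFactor K)).prod ≤ t <;> simp [ht, acceptedValue]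

theorem mean_acceptStep_of_lt {N : ℕ} {x : ℕ × List (ℕ × ℕ)} (h : N < x.1)
    (φ : Option (FactoredNorm K) → ℝ≥0∞) :
    (acceptStep K P (Module.finrank ℚ K) N x).mean φ = φ none := by
  have hle : decide (x.1 ≤ N) = false := by simpa using h
  rw [acceptStep, mean_bind, le, mean_charge]
  simp [hle]

theorem pr_acceptStep {N r : ℕ} {l : List (ℕ × ℕ)} (hl : IsFactorizationOf l r) (hrN : r ≤ N) :
    (acceptStep K P (Module.finrank ℚ K) N (r, l)).pr
      (fun x => ∃ y, x = some y ∧ IsFactoredNorm r y) = ENNReal.ofReal (acceptProb K N r) := by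
  classical
  rw [pr_eq_mean, mean_acceptStep hl hrN]
  simp [isFactoredNorm_acceptedValue hl]

end

end FactoredIdeals

namespace FactoredIdeals

universe u v w

/-! ## The law of the random integer -/

/-- The probability with which the random integer is multiplied by `p` once more. -/
noncomputable def stepProb (d p : ℕ) : ℝ :=
  if p ≤ d then ((p : ℝ) - 1) / p else d / ((p : ℝ) - residue d p + 1)

theorem residue_add_div_mul (d p : ℕ) (hp : 0 < p) : (p - 1) / d * d + residue d p = p := by
  have := Nat.div_add_mod' (p - 1) d
  unfold residue
  omega

/-- Writing `p = j d + p̄` with `j = ⌊(p - 1) / d⌋` turns `p - p̄ + 1` into `j d + 1`, the number of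
equally likely outcomes in `nextIndex d j`. -/
theorem stepProb_of_lt {d p : ℕ} (hp : d < p) :
    stepProb d p = d / (((p - 1) / d * d + 1 : ℕ) : ℝ) := by
  rw [stepProb, if_neg (by omega)]
  have h := residue_add_div_mul d p (by omega)
  have h' : (p : ℝ) = ((p - 1) / d * d : ℕ) + residue d p := by exact_mod_cast h.symm
  congr 1
  rw [h']
  push_cast
  ring

theorem stepProb_mem {d p : ℕ} (hp : 0 < p) (hd : 0 < d) :
    0 ≤ stepProb d p ∧ stepProb d p < 1 := by
  by_cases h : p ≤ d
  · have hp' : (1 : ℝ) ≤ p := by exact_mod_cast hp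
    rw [stepProb, if_pos h]
    refine ⟨div_nonneg (by linarith) (by linarith), ?_⟩
    rw [div_lt_one (by linarith)]
    linarith
  · rw [stepProb_of_lt (by omega)]
    refine ⟨by positivity, ?_⟩
    rw [div_lt_one (by positivity)]
    have : 1 ≤ (p - 1) / d := (Nat.one_le_div_iff hd).2 (by omega)
    have : d < (p - 1) / d * d + 1 := by nlinarith
    exact_mod_cast this

/-- The probability that the product of independent geometric powers of the primes in `S` is
`n`. -/
noncomputable def geometricWeight (d : ℕ) (S : Finset ℕ) (n : ℕ) : ℝ :=
  if n.primeFactors ⊆ S then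
    ∏ p ∈ S, (1 - stepProb d p) * stepProb d p ^ n.factorization p else 0

/-- The probability of reaching `r` from `x` by multiplying with independent geometric powers of
the primes in `S`. -/
noncomputable def reachProb (d r : ℕ) (S : Finset ℕ) (x : ℕ) : ℝ≥0∞ :=
  if x ∣ r then ENNReal.ofReal (geometricWeight d S (r / x)) else 0

theorem geometricWeight_mem {d : ℕ} (hd : 0 < d) {S : Finset ℕ} (hS : ∀ p ∈ S, p.Prime) (n : ℕ) :
    0 ≤ geometricWeight d S n ∧ geometricWeight d S n ≤ 1 := by
  unfold geometricWeight
  split_ifs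
  · have h := fun p hp => stepProb_mem (d := d) (hS p hp).pos hd
    have h0 : ∀ p ∈ S, 0 ≤ (1 - stepProb d p) * stepProb d p ^ n.factorization p := fun p hp =>
      mul_nonneg (by linarith [(h p hp).2]) (pow_nonneg (h p hp).1 _)
    exact ⟨Finset.prod_nonneg h0, Finset.prod_le_one h0 fun p hp =>
      mul_le_one₀ (by linarith [(h p hp).1]) (pow_nonneg (h p hp).1 _)
        (pow_le_one₀ (h p hp).1 (h p hp).2.le)⟩
  · simp

theorem reachProb_le_one {d : ℕ} (hd : 0 < d) {S : Finset ℕ} (hS : ∀ p ∈ S, p.Prime) (r x : ℕ) :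
    reachProb d r S x ≤ 1 := by
  unfold reachProb
  split_ifs
  · exact ENNReal.ofReal_le_one.2 (geometricWeight_mem hd hS _).2
  · exact zero_le

/-- Condition on the first trial for `p`. A failure leaves `n` to the primes in `S`, which is
impossible if `p ∣ n`; a success divides `n` by `p` and starts the trials for `p` again. -/
theorem geometricWeight_insert {d p : ℕ} (hp : p.Prime) {S : Finset ℕ}
    (hpS : p ∉ S) {n : ℕ} (hn : n ≠ 0) :
    geometricWeight d (insert p S) n = (1 - stepProb d p) * geometricWeight d S n +
      stepProb d p * if p ∣ n then geometricWeight d (insert p S) (n / p) else 0 := by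
  unfold geometricWeight
  by_cases hd : p ∣ n
  · obtain ⟨m, rfl⟩ := hd
    have hm : m ≠ 0 := by rintro rfl; simp at hn
    have h1 : ¬ (p * m).primeFactors ⊆ S := fun h => hpS (h (by simp [hp, hm, hp.ne_zero]))
    have h2 : (p * m).primeFactors ⊆ insert p S ↔ m.primeFactors ⊆ insert p S := by
      rw [Nat.primeFactors_mul hp.ne_zero hm, hp.primeFactors, Finset.union_subset_iff]
      simp
    rw [if_neg h1, if_pos (dvd_mul_right p m), Nat.mul_div_cancel_left _ hp.pos]
    simp only [h2]
    split_ifs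
    · have e1 : ∀ q ∈ S, (p * m).factorization q = m.factorization q := fun q hq => by
        have : q ≠ p := fun h => hpS (h ▸ hq)
        rw [Nat.factorization_mul hp.ne_zero hm, hp.factorization]
        simp [this.symm]
      have e2 : (p * m).factorization p = m.factorization p + 1 := by
        rw [Nat.factorization_mul hp.ne_zero hm, hp.factorization]
        simp [add_comm]
      rw [Finset.prod_insert hpS, Finset.prod_insert hpS, e2,
        Finset.prod_congr rfl fun q hq => by rw [e1 q hq]]
      ring
    · ring
  · have h2 : n.primeFactors ⊆ insert p S ↔ n.primeFactors ⊆ S := by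
      rw [Finset.subset_insert_iff_of_notMem]
      simp [hd]
    simp only [h2, hd, if_false, mul_zero, add_zero]
    split_ifs
    · rw [Finset.prod_insert hpS, Nat.factorization_eq_zero_of_not_dvd hd]
      ring
    · ring

/-- The same recursion in terms of the current product `x`. Both the list loop at a prime value and
the loop of step 3 satisfy it. -/
theorem reachProb_insert {d p r : ℕ} (hd : 0 < d) (hp : p.Prime) {S : Finset ℕ}
    (hS : ∀ q ∈ S, q.Prime) (hpS : p ∉ S) (hr : r ≠ 0) (x : ℕ) :
    reachProb d r (insert p S) x = ENNReal.ofReal (1 - stepProb d p) * reachProb d r S x +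
      ENNReal.ofReal (stepProb d p) * reachProb d r (insert p S) (x * p) := by
  unfold reachProb
  by_cases hx : x ∣ r
  · obtain ⟨n, rfl⟩ := hx
    have hx0 : 0 < x := Nat.pos_of_ne_zero (by rintro rfl; simp at hr)
    have hn : n ≠ 0 := by rintro rfl; simp at hr
    have hq := stepProb_mem (d := d) hp.pos hd
    have hins : ∀ q ∈ insert p S, q.Prime := by
      intro q hq
      rcases Finset.mem_insert.1 hq with rfl | h
      · exact hp
      · exact hS q h
    have hdvd : x * p ∣ x * n ↔ p ∣ n := Nat.mul_dvd_mul_iff_left hx0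
    rw [if_pos (dvd_mul_right x n), if_pos (dvd_mul_right x n), Nat.mul_div_cancel_left _ hx0,
      Nat.mul_div_mul_left _ _ hx0, geometricWeight_insert hp hpS hn]
    simp only [hdvd]
    rw [ENNReal.ofReal_add, ENNReal.ofReal_mul (by linarith), ENNReal.ofReal_mul hq.1]
    · split_ifs <;> simp
    · exact mul_nonneg (by linarith) (geometricWeight_mem hd hS n).1
    · refine mul_nonneg hq.1 ?_
      split_ifs
      · exact (geometricWeight_mem hd hins _).1
      · exact le_rfl
  · have : ¬ x * p ∣ r := fun h => hx (dvd_of_mul_right_dvd h)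
    simp [hx, this]

/-- A bounded solution of a contracting recursion is unique. -/
theorem eq_of_contracting {σ : Type*} {ρ : ℝ≥0∞} (hρ : ρ < 1) {t V a : σ → ℝ≥0∞} {next : σ → σ}
    (ht : ∀ s, t s = a s + ρ * t (next s)) (hV : ∀ s, V s = a s + ρ * V (next s))
    (ht1 : ∀ s, t s ≤ 1) (hV1 : ∀ s, V s ≤ 1) (s : σ) : t s = V s := by
  have key : ∀ {f h : σ → ℝ≥0∞}, (∀ s, f s = a s + ρ * f (next s)) →
      (∀ s, h s = a s + ρ * h (next s)) → (∀ s, f s ≤ 1) → ∀ s, f s ≤ h s := by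
    intro f h hf hh hf1 s
    -- After `n` unfoldings the two solutions differ by at most `ρ ^ n`, starting from `f ≤ 1`.
    have hn : ∀ n s, f s ≤ h s + ρ ^ n := by
      intro n
      induction n with
      | zero => intro s; exact (hf1 s).trans (by simp)
      | succ n ih =>
        intro s
        calc f s = a s + ρ * f (next s) := hf s
          _ ≤ a s + ρ * (h (next s) + ρ ^ n) := by gcongr; exact ih _
          _ = h s + ρ ^ (n + 1) := by rw [hh s]; ring
    have hlim : Tendsto (fun n => h s + ρ ^ n) atTop (nhds (h s + 0)) :=
      (ENNReal.tendsto_pow_atTop_nhds_zero_of_lt_one hρ).const_add _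
    rw [add_zero] at hlim
    exact ge_of_tendsto' hlim fun n => hn n s
  exact le_antisymm (key ht hV ht1 s) (key hV ht hV1 s)

/-! ## Multiplication by a prime -/

/-- The result of `multiplyBy`. -/
def multiplyByValue (x : ℕ × List (ℕ × ℕ)) (p : ℕ) : ℕ × List (ℕ × ℕ) :=
  (x.1 * p, match x.2 with
    | [] => [(p, 1)]
    | (q, e) :: l => if q = p then (q, e + 1) :: l else (p, 1) :: (q, e) :: l)

/-- A bound for the bit lengths of the numbers that `multiplyBy` works with. -/
def bitLength (x : ℕ × List (ℕ × ℕ)) : ℕ :=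
  x.1.size + match x.2 with
    | [] => 0
    | (q, e) :: _ => q.size + e.size

theorem takes_multiplyBy (x : ℕ × List (ℕ × ℕ)) (p : ℕ) :
    Takes (multiplyBy x p) (multiplyByValue x p) ((bitLength x + 4) * (p.size + 2)) := by
  obtain ⟨r, l⟩ := x
  rcases l with _ | ⟨⟨q, e⟩, l⟩
  · refine Takes.mono ((takes_charge le_rfl _).bind (t' := 1) (takes_charge le_rfl _)) ?_
    simp only [bitLength]
    nlinarith [Nat.zero_le (r.size * p.size)]
  · have h1 : (1 : ℕ).size = 1 := Nat.size_one
    have key : Takes (if decide (q = p) = true then (add e 1).bind fun e' =>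
        charge 1 (r * p, (q, e') :: l) else charge 1 (r * p, (p, 1) :: (q, e) :: l))
        (multiplyByValue (r, (q, e) :: l) p) (e.size + 1 + 1 + 1) := by
      by_cases h : q = p
      · simp only [h, decide_true, if_true, multiplyByValue]
        exact (takes_charge (by rw [h1]) _).bind (t' := 1) (takes_charge le_rfl _)
      · simp only [h, decide_false, Bool.false_eq_true, if_false, multiplyByValue]
        exact takes_charge (by omega) _
    refine Takes.mono ((takes_charge le_rfl _).bind ((takes_charge le_rfl _).bind key)) ?_
    simp only [bitLength]
    nlinarith [Nat.zero_le (r.size * p.size), Nat.zero_le (q.size * p.size),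
      Nat.zero_le (e.size * p.size)]

theorem size_mul_le (a b : ℕ) : (a * b).size ≤ a.size + b.size := by
  rw [Nat.size_le, pow_add]
  exact Nat.mul_lt_mul'' (Nat.lt_size_self a) (Nat.lt_size_self b)

theorem size_succ_le (a : ℕ) : (a + 1).size ≤ a.size + 1 := by
  rw [Nat.size_le, pow_succ]
  have := Nat.lt_size_self a
  omega

theorem bitLength_multiplyByValue_le (x : ℕ × List (ℕ × ℕ)) (p : ℕ) :
    bitLength (multiplyByValue x p) ≤ bitLength x + (2 * p.size + 1) := by
  obtain ⟨r, l⟩ := x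
  have h := size_mul_le r p
  rcases l with _ | ⟨⟨q, e⟩, l⟩
  · change (r * p).size + (p.size + Nat.size 1) ≤ r.size + 0 + (2 * p.size + 1)
    rw [Nat.size_one]
    omega
  · simp only [bitLength, multiplyByValue]
    by_cases hq : q = p
    · have := size_succ_le e
      simp only [hq, if_true]
      change (r * p).size + (p.size + (e + 1).size) ≤ r.size + (p.size + e.size) + (2 * p.size + 1)
      omega
    · simp only [hq, if_false]
      change (r * p).size + (p.size + Nat.size 1) ≤ r.size + (q.size + e.size) + (2 * p.size + 1)
      rw [Nat.size_one]
      omega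

theorem mean_multiplyBy (x : ℕ × List (ℕ × ℕ)) (p : ℕ) (φ : ℕ × List (ℕ × ℕ) → ℝ≥0∞) :
    (multiplyBy x p).mean φ = φ (multiplyByValue x p) :=
  ((takes_multiplyBy x p).runs (g := 0) (w := 0) (by simp)).mean φ

theorem sub_multiplyBy (x : ℕ × List (ℕ × ℕ)) (p : ℕ) : (multiplyBy x p).IsSub := by
  rw [IsSub, mean_multiplyBy]

theorem sub_primalityTest (P : Prices) (m : ℕ) : (primalityTest P m).IsSub := sub_pay ..

theorem sub_ite {α : Type*} {c : Prop} [Decidable c] {m m' : RandComp α} (h : m.IsSub)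
    (h' : m'.IsSub) : (if c then m else m').IsSub := by
  split_ifs
  · exact h
  · exact h'

theorem sub_multiplyByPrimes (P : Prices) (x : ℕ × List (ℕ × ℕ)) (l : List ℕ) :
    (multiplyByPrimes P x l).IsSub :=
  sub_foldList (fun x s => (sub_primalityTest P s).bind fun _ =>
    sub_ite (sub_multiplyBy x s) (sub_ret x)) l x

theorem sub_multiplySmall (p : ℕ) (x : ℕ × List (ℕ × ℕ)) : (multiplySmall p x).IsSub :=
  sub_loop (fun x => (sub_uniform p).bind fun _ => (sub_charge _ _).bind fun _ =>
    sub_ite (sub_ret _) ((sub_multiplyBy x p).bind fun _ => sub_ret _)) x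

theorem mean_multiplyByPrimes (P : Prices) (x : ℕ × List (ℕ × ℕ)) (l : List ℕ)
    (φ : ℕ → ℝ≥0∞) : (multiplyByPrimes P x l).mean (fun y => φ y.1) =
      φ (x.1 * (l.filter Nat.Prime).prod) := by
  induction l generalizing x with
  | nil => simp [multiplyByPrimes, foldList]
  | cons s l ih =>
    have : (multiplyByPrimes P x (s :: l)).mean (fun y => φ y.1) =
        (if s.Prime then multiplyBy x s else ret x).mean fun x' =>
          (multiplyByPrimes P x' l).mean fun y => φ y.1 := by
      simp [multiplyByPrimes, foldList, primalityTest]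
    rw [this]
    by_cases hs : s.Prime
    · rw [if_pos hs, mean_multiplyBy, ih]
      simp [hs, multiplyByValue, mul_assoc]
    · rw [if_neg hs, mean_ret, ih]
      simp [hs]

/-- The expectation over `multiplySmall`, from its recursion. -/
theorem mean_multiplySmall {d p : ℕ} (hp : p.Prime) (hpd : p ≤ d) {V φ : ℕ × List (ℕ × ℕ) → ℝ≥0∞}
    (hV : ∀ x, V x = ENNReal.ofReal (1 - stepProb d p) * φ x +
      ENNReal.ofReal (stepProb d p) * V (multiplyByValue x p))
    (hV1 : ∀ x, V x ≤ 1) (hφ : ∀ x, φ x ≤ 1) (x : ℕ × List (ℕ × ℕ)) :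
    (multiplySmall p x).mean φ = V x := by
  have hq := stepProb_mem (d := d) hp.pos (hp.pos.trans_le hpd)
  have hp0 : (0 : ℝ) < p := by exact_mod_cast hp.pos
  -- A uniform element of `{0, …, p - 1}` vanishes with probability `1 / p = 1 - stepProb d p`, so
  -- the loop contracts with the factor `(p - 1) / p`.
  refine eq_of_contracting (ρ := ENNReal.ofReal (stepProb d p))
    (a := fun x => ENNReal.ofReal (1 - stepProb d p) * φ x) (t := fun x => (multiplySmall p x).mean φ)
    (next := fun x => multiplyByValue x p)
    (ENNReal.ofReal_lt_one.2 hq.2) (fun x => ?_) hV (fun x => (sub_multiplySmall p x).mean_le hφ)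
    hV1 x
  have h1 : ENNReal.ofReal (1 - stepProb d p) = (p : ℝ≥0∞)⁻¹ := by
    rw [stepProb, if_pos hpd, ← ENNReal.ofReal_natCast, ← ENNReal.ofReal_inv_of_pos hp0]
    congr 1
    field_simp
    ring
  have h2 : ENNReal.ofReal (stepProb d p) = (p : ℝ≥0∞)⁻¹ * ((p - 1 : ℕ) : ℝ≥0∞) := by
    rw [stepProb, if_pos hpd, ← ENNReal.ofReal_natCast, ← ENNReal.ofReal_inv_of_pos hp0,
      ← ENNReal.ofReal_natCast, ← ENNReal.ofReal_mul (by positivity), Nat.cast_sub hp.one_le]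
    congr 1
    field_simp
    simp
  rw [h1, h2]
  change (multiplySmall p x).mean φ = _
  rw [multiplySmall, mean_loop]
  simp only [mean_bind, mean_uniform, RandComp.eq, mean_charge]
  obtain ⟨n, rfl⟩ : ∃ n, p = n + 1 := ⟨p - 1, by have := hp.pos; omega⟩
  rw [Finset.sum_range_succ']
  simp only [Nat.add_eq_zero_iff, one_ne_zero, and_false, decide_false, Bool.false_eq_true,
    if_false, mean_bind, mean_multiplyBy, mean_ret, Sum.elim_inl, decide_true, if_true,
    Sum.elim_inr, Finset.sum_const, Finset.card_range, nsmul_eq_mul, Nat.add_sub_cancel]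
  rw [mul_add, ← mul_assoc, add_comm]
  rfl

/-! ## The decreasing lists -/

/-- The index is `⌈x / d⌉` for a uniform `x` in `{0, …, j d}`: it is `0` for `x = 0` only, and each
of `1, …, j` arises from `d` values of `x`. -/
theorem mean_nextIndex {d : ℕ} (hd : 0 < d) (j : ℕ) (φ : ℕ → ℝ≥0∞) :
    (nextIndex d j).mean φ = ((j * d + 1 : ℕ) : ℝ≥0∞)⁻¹ *
      (φ 0 + d * ∑ i ∈ Finset.range j, φ (i + 1)) := by
  simp only [nextIndex, mean_bind, mul, add, div, mean_charge, mean_uniform]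
  congr 1
  induction j with
  | zero =>
    have : (d - 1) / d = 0 := Nat.div_eq_of_lt (by omega)
    simp [this]
  | succ j ih =>
    have h1 : (j + 1) * d + 1 = (j * d + 1) + d := by ring
    rw [h1, Finset.sum_range_add, ih, Finset.sum_range_succ (fun i => φ (i + 1)), mul_add,
      ← add_assoc]
    congr 1
    rw [Finset.sum_congr rfl (g := fun _ => φ (j + 1))]
    · simp
    · intro i hi
      have hi := Finset.mem_range.1 hi
      congr 1
      have h2 : (j + 1) * d = j * d + d := by ring
      have h3 : (j + 1 + 1) * d = j * d + d + d := by ring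
      exact Nat.div_eq_of_lt_le (by omega) (by omega)

theorem sub_nextIndex (d j : ℕ) : (nextIndex d j).IsSub :=
  (sub_charge _ _).bind fun _ => (sub_charge _ _).bind fun _ => (sub_uniform _).bind fun _ =>
    (sub_charge _ _).bind fun _ => sub_charge _ _

/-- One pass of the loop that generates a list. -/
noncomputable def listBody (d b : ℕ) (st : ℕ × List ℕ) : RandComp (ℕ × List ℕ ⊕ List ℕ) :=
  (nextIndex d st.1).bind fun j =>
    if j = 0 then charge 1 (Sum.inr (1 :: st.2))
    else (mul j d).bind fun jd => (add jd b).bind fun s => charge 1 (Sum.inl (j, s :: st.2))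

theorem sub_listBody (d b : ℕ) (st : ℕ × List ℕ) : (listBody d b st).IsSub :=
  (sub_nextIndex _ _).bind fun _ => sub_ite (sub_charge _ _)
    ((sub_charge _ _).bind fun _ => (sub_charge _ _).bind fun _ => sub_charge _ _)

theorem mean_listLoop {d : ℕ} (hd : 0 < d) (b J : ℕ) (acc : List ℕ) (Φ : List ℕ → ℝ≥0∞) :
    (loop (listBody d b) (J, acc)).mean Φ = ((J * d + 1 : ℕ) : ℝ≥0∞)⁻¹ *
      (Φ (1 :: acc) + d * ∑ i ∈ Finset.range J,
        (loop (listBody d b) (i + 1, ((i + 1) * d + b) :: acc)).mean Φ) := by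
  rw [mean_loop]
  conv_lhs => rw [listBody]
  rw [mean_bind, mean_nextIndex hd]
  simp [mul, add]

/-- The memoryless property behind the algorithm. Since `1 - d / ((J + 1) d + 1) = (J d + 1) / ((J +
1) d + 1)`, a draw that misses the top index continues as a draw from the smaller range. So the top
value is repeated geometrically often, independently of the rest. -/
theorem mean_listLoop_succ {d : ℕ} (hd : 0 < d) (b J : ℕ) (acc : List ℕ) (Φ : List ℕ → ℝ≥0∞) :
    (loop (listBody d b) (J + 1, acc)).mean Φ =
      ENNReal.ofReal (1 - d / (((J + 1) * d + 1 : ℕ) : ℝ)) *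
        (loop (listBody d b) (J, acc)).mean Φ +
      ENNReal.ofReal (d / (((J + 1) * d + 1 : ℕ) : ℝ)) *
        (loop (listBody d b) (J + 1, ((J + 1) * d + b) :: acc)).mean Φ := by
  have hpos : (0 : ℝ) < (((J + 1) * d + 1 : ℕ) : ℝ) := by positivity
  have h1 : ENNReal.ofReal (1 - d / (((J + 1) * d + 1 : ℕ) : ℝ)) =
      (((J + 1) * d + 1 : ℕ) : ℝ≥0∞)⁻¹ * ((J * d + 1 : ℕ) : ℝ≥0∞) := by
    rw [← ENNReal.ofReal_natCast, ← ENNReal.ofReal_inv_of_pos hpos, ← ENNReal.ofReal_natCast,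
      ← ENNReal.ofReal_mul (by positivity)]
    congr 1
    field_simp
    push_cast
    ring
  have h2 : ENNReal.ofReal (d / (((J + 1) * d + 1 : ℕ) : ℝ)) =
      (((J + 1) * d + 1 : ℕ) : ℝ≥0∞)⁻¹ * d := by
    rw [ENNReal.ofReal_div_of_pos hpos, ENNReal.ofReal_natCast, ENNReal.ofReal_natCast,
      ENNReal.div_eq_inv_mul]
  have h3 := mean_listLoop hd b J acc Φ
  have h4 : ((J * d + 1 : ℕ) : ℝ≥0∞) * (loop (listBody d b) (J, acc)).mean Φ =
      Φ (1 :: acc) + d * ∑ i ∈ Finset.range J,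
        (loop (listBody d b) (i + 1, ((i + 1) * d + b) :: acc)).mean Φ := by
    rw [h3, ← mul_assoc, ENNReal.mul_inv_cancel (by simp) (ENNReal.natCast_ne_top _), one_mul]
  rw [mean_listLoop hd, Finset.sum_range_succ, h1, h2, mul_assoc, h4]
  ring

/-- The expectation over the loop that generates a list, from its recursion. -/
theorem mean_listLoop_eq {d : ℕ} (hd : 0 < d) (b : ℕ) {Φ : List ℕ → ℝ≥0∞}
    {V : ℕ → List ℕ → ℝ≥0∞} {J : ℕ} (h0 : ∀ acc, V 0 acc = Φ (1 :: acc))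
    (hV : ∀ j < J, ∀ acc, V (j + 1) acc =
      ENNReal.ofReal (1 - d / (((j + 1) * d + 1 : ℕ) : ℝ)) * V j acc +
      ENNReal.ofReal (d / (((j + 1) * d + 1 : ℕ) : ℝ)) * V (j + 1) (((j + 1) * d + b) :: acc))
    (hΦ : ∀ l, Φ l ≤ 1) (hV1 : ∀ j acc, V j acc ≤ 1) (acc : List ℕ) :
    (loop (listBody d b) (J, acc)).mean Φ = V J acc := by
  induction J generalizing acc with
  | zero => rw [mean_listLoop hd, h0]; simp
  | succ J ih =>
    have ih := ih fun j hj => hV j (by omega)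
    refine eq_of_contracting (ρ := ENNReal.ofReal (d / (((J + 1) * d + 1 : ℕ) : ℝ)))
      (t := fun acc => (loop (listBody d b) (J + 1, acc)).mean Φ)
      (a := fun acc => ENNReal.ofReal (1 - d / (((J + 1) * d + 1 : ℕ) : ℝ)) * V J acc)
      (next := fun acc => ((J + 1) * d + b) :: acc) ?_ (fun acc => ?_) (hV J (by omega))
      (fun acc => (sub_loop (sub_listBody d b) _).mean_le hΦ) (hV1 _) acc
    · rw [ENNReal.ofReal_lt_one, div_lt_one (by positivity)]
      have : d < (J + 1) * d + 1 := by nlinarith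
      exact_mod_cast this
    · rw [← ih]
      exact mean_listLoop_succ hd b J acc Φ

theorem mean_generateList (d N b : ℕ) (Φ : List ℕ → ℝ≥0∞) :
    (generateList d N b).mean Φ =
      (loop (listBody d b) ((roundUp d N - b) / d, [])).mean Φ := by
  simp only [generateList, mean_bind, div, mul, add, RandComp.sub, mean_charge]
  rfl

theorem sub_generateList (d N b : ℕ) : (generateList d N b).IsSub := by
  rw [IsSub, mean_generateList]
  exact sub_loop (sub_listBody d b) _

/-- The constant `1` solves the recursion of the loop, so by uniqueness the list is finite with
probability one. -/
theorem mean_generateList_one {d : ℕ} (hd : 0 < d) (N b : ℕ) :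
    (generateList d N b).mean (fun _ => 1) = 1 := by
  rw [mean_generateList, mean_listLoop_eq hd b (V := fun _ _ => 1)] <;> try simp
  intro J _
  rw [← ENNReal.ofReal_add]
  · simp
  · rw [sub_nonneg, div_le_one (by positivity)]
    have : (0 : ℝ) ≤ J * d := by positivity
    nlinarith
  · positivity

end FactoredIdeals

/-! ### The residue classes and the law of the product -/

namespace FactoredIdeals

universe u v w

/-- The primes `j d + b` with `1 ≤ j ≤ J`. -/
def classPrimes (d b J : ℕ) : Finset ℕ :=
  ((Finset.Icc 1 J).image fun j => j * d + b).filter Nat.Prime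

theorem mem_classPrimes {d b J p : ℕ} :
    p ∈ classPrimes d b J ↔ (∃ j, (1 ≤ j ∧ j ≤ J) ∧ j * d + b = p) ∧ p.Prime := by
  simp [classPrimes]

theorem residue_mul_add {d b : ℕ} (j : ℕ) (hb : 0 < b) (hbd : b ≤ d) :
    residue d (j * d + b) = b := by
  have h : j * d + b - 1 = (b - 1) + j * d := by omega
  rw [residue, h, Nat.add_mul_mod_self_right, Nat.mod_eq_of_lt (by omega)]
  omega

theorem classPrimes_zero (d b : ℕ) : classPrimes d b 0 = ∅ := by simp [classPrimes]

theorem classPrimes_succ_of_prime {d b J : ℕ} (h : ((J + 1) * d + b).Prime) :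
    classPrimes d b (J + 1) = insert ((J + 1) * d + b) (classPrimes d b J) := by
  ext p
  simp only [mem_classPrimes, Finset.mem_insert]
  constructor
  · rintro ⟨⟨j, ⟨h1, h2⟩, rfl⟩, hp⟩
    rcases Nat.lt_or_ge j (J + 1) with hj | hj
    · exact Or.inr ⟨⟨j, ⟨h1, by omega⟩, rfl⟩, hp⟩
    · exact Or.inl (by rw [show j = J + 1 by omega])
  · rintro (rfl | ⟨⟨j, ⟨h1, h2⟩, rfl⟩, hp⟩)
    · exact ⟨⟨J + 1, ⟨by omega, le_rfl⟩, rfl⟩, h⟩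
    · exact ⟨⟨j, ⟨h1, by omega⟩, rfl⟩, hp⟩

theorem classPrimes_succ_of_not_prime {d b J : ℕ} (h : ¬ ((J + 1) * d + b).Prime) :
    classPrimes d b (J + 1) = classPrimes d b J := by
  ext p
  simp only [mem_classPrimes]
  constructor
  · rintro ⟨⟨j, ⟨h1, h2⟩, rfl⟩, hp⟩
    rcases Nat.lt_or_ge j (J + 1) with hj | hj
    · exact ⟨⟨j, ⟨h1, by omega⟩, rfl⟩, hp⟩
    · rw [show j = J + 1 by omega] at hp
      exact absurd hp h
  · rintro ⟨⟨j, ⟨h1, h2⟩, rfl⟩, hp⟩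
    exact ⟨⟨j, ⟨h1, by omega⟩, rfl⟩, hp⟩

/-- One list multiplies by independent geometric powers of the primes in its class. The set `S`
stands for the primes treated later; `V` tracks the primes of the class that can still appear,
together with the product of the entries already drawn. -/
theorem mean_listStep (P : Prices) {d b N r : ℕ} (hd : 0 < d) (hb : 0 < b) (hbd : b ≤ d)
    (hr : r ≠ 0) {S : Finset ℕ} (hS : ∀ p ∈ S, p.Prime)
    (hdis : Disjoint S (classPrimes d b ((roundUp d N - b) / d))) (x : ℕ × List (ℕ × ℕ)) :
    ((generateList d N b).bind fun l => multiplyByPrimes P x l).mean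
      (fun y => reachProb d r S y.1) =
      reachProb d r (S ∪ classPrimes d b ((roundUp d N - b) / d)) x.1 := by
  have hprime : ∀ J, ∀ p ∈ S ∪ classPrimes d b J, p.Prime := fun J p hp =>
    (Finset.mem_union.1 hp).elim (hS p) fun h => (mem_classPrimes.1 h).2
  rw [mean_bind]
  simp only [mean_multiplyByPrimes P _ _ fun y => reachProb d r S y]
  rw [mean_generateList]
  set J₀ := (roundUp d N - b) / d with hJ₀
  have hnot : ∀ J < J₀, (((J + 1) * d + b).Prime) → (J + 1) * d + b ∉ S ∪ classPrimes d b J := by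
    intro J hJ hp h
    rcases Finset.mem_union.1 h with h | h
    · exact Finset.disjoint_left.1 hdis h
        (mem_classPrimes.2 ⟨⟨J + 1, ⟨by omega, by omega⟩, rfl⟩, hp⟩)
    · obtain ⟨⟨j, ⟨h1, h2⟩, h3⟩, -⟩ := mem_classPrimes.1 h
      have : j * d = (J + 1) * d := by omega
      have := Nat.eq_of_mul_eq_mul_right hd this
      omega
  rw [mean_listLoop_eq hd b (V := fun J acc => reachProb d r (S ∪ classPrimes d b J)
      (x.1 * (acc.filter Nat.Prime).prod)) ?_ ?_ (fun _ => reachProb_le_one hd hS _ _)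
    (fun _ _ => reachProb_le_one hd (hprime _) _ _)]
  · simp
  · intro acc
    simp [classPrimes_zero, Nat.not_prime_one]
  · intro J hJ acc
    by_cases hp : ((J + 1) * d + b).Prime
    · have hq : stepProb d ((J + 1) * d + b) = d / (((J + 1) * d + 1 : ℕ) : ℝ) := by
        rw [stepProb_of_lt (by nlinarith)]
        have h := residue_add_div_mul d ((J + 1) * d + b) (by omega)
        rw [residue_mul_add _ hb hbd] at h
        rw [Nat.add_right_cancel h]
      rw [classPrimes_succ_of_prime hp, Finset.union_insert, ← hq,
        reachProb_insert hd hp (hprime J) (hnot J hJ hp) hr]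
      simp only [hp, decide_true, List.filter_cons_of_pos, List.prod_cons]
      rw [mul_assoc, mul_comm _ ((J + 1) * d + b)]
    · rw [classPrimes_succ_of_not_prime hp]
      simp only [hp, decide_false, Bool.false_eq_true, not_false_eq_true, List.filter_cons_of_neg]
      rw [← add_mul, ← ENNReal.ofReal_add]
      · simp
      · rw [sub_nonneg, div_le_one (by positivity)]
        have : d ≤ (J + 1) * d + 1 := by nlinarith
        exact_mod_cast this
      · positivity

theorem mem_foldr_union {α : Type*} {T : α → Finset ℕ} {l : List α} {S : Finset ℕ} {p : ℕ} :
    p ∈ l.foldr (fun a U => U ∪ T a) S ↔ p ∈ S ∨ ∃ a ∈ l, p ∈ T a := by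
  induction l with
  | nil => simp
  | cons a l ih =>
    simp only [List.foldr_cons, Finset.mem_union, ih, List.exists_mem_cons_iff, or_assoc]
    rw [or_comm (a := p ∈ T a)]

/-- The fold is evaluated backwards, from the target `r` to the start: each step adds its own primes
`T a` to the set of primes still to come. Disjointness of these sets is the independence of the
steps. -/
theorem mean_foldList_reachProb {α : Type*} {β : Type*} {f : β × List α → ℕ → RandComp (β × List α)}
    {d r : ℕ} (T : ℕ → Finset ℕ) (val : β × List α → ℕ) (l : List ℕ) {S : Finset ℕ}
    (hT : ∀ a ∈ l, ∀ p ∈ T a, p.Prime)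
    (hf : ∀ a ∈ l, ∀ U : Finset ℕ, (∀ p ∈ U, p.Prime) → Disjoint U (T a) → ∀ x,
      (f x a).mean (fun y => reachProb d r U (val y)) = reachProb d r (U ∪ T a) (val x))
    (hS : ∀ p ∈ S, p.Prime) (hST : ∀ a ∈ l, Disjoint S (T a))
    (hdis : l.Pairwise fun a a' => Disjoint (T a) (T a')) (x : β × List α) :
    (foldList f x l).mean (fun y => reachProb d r S (val y)) =
      reachProb d r (l.foldr (fun a U => U ∪ T a) S) (val x) := by
  induction l generalizing x with
  | nil => simp [foldList]
  | cons a l ih =>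
    rw [List.pairwise_cons] at hdis
    have ih := ih (fun a h => hT a (by simp [h])) (fun a h => hf a (by simp [h]))
      (fun a h => hST a (by simp [h])) hdis.2
    simp only [foldList, mean_bind, mean_charge, ih]
    rw [hf a (by simp), List.foldr_cons]
    · intro p hp
      rcases mem_foldr_union.1 hp with h | ⟨a', ha', h⟩
      · exact hS p h
      · exact hT a' (by simp [ha']) p h
    · rw [Finset.disjoint_left]
      intro p hp hpa
      rcases mem_foldr_union.1 hp with h | ⟨a', ha', h⟩
      · exact Finset.disjoint_left.1 (hST a (by simp)) h hpa
      · exact Finset.disjoint_left.1 (hdis.1 a' ha') hpa h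

theorem mem_residues {d b : ℕ} :
    b ∈ residues d ↔ (1 ≤ b ∧ b < 1 + max 1 (d - 1)) ∧ (Even d → Odd b) := by
  rw [residues, List.mem_filter, List.mem_range'_1, decide_eq_true_iff]

theorem pos_of_mem_residues {d b : ℕ} (h : b ∈ residues d) : 0 < b := (mem_residues.1 h).1.1

theorem le_of_mem_residues {d b : ℕ} (hd : 0 < d) (h : b ∈ residues d) : b ≤ d := by
  have := (mem_residues.1 h).1.2
  omega

theorem nodup_residues (d : ℕ) : (residues d).Nodup := (List.nodup_range' (s := 1)).filter _

theorem residue_of_mem_classPrimes {d b J p : ℕ} (hd : 0 < d) (hb : b ∈ residues d)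
    (h : p ∈ classPrimes d b J) : d < p ∧ residue d p = b := by
  obtain ⟨⟨j, ⟨h1, h2⟩, rfl⟩, hp⟩ := mem_classPrimes.1 h
  have hb0 := pos_of_mem_residues hb
  exact ⟨by nlinarith, residue_mul_add j hb0 (le_of_mem_residues hd hb)⟩

/-- No large prime is missed. The representative `d` would force `d ∣ p`, which is impossible for `1
< d < p`; for even `d` the prime is odd, hence so is its representative. -/
theorem residue_mem_residues {d p : ℕ} (hd : 0 < d) (hp : p.Prime) (hdp : d < p) :
    residue d p ∈ residues d := by
  rw [mem_residues]
  have h1 := residue_add_div_mul d p hp.pos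
  have h2 := residue_le hd p
  refine ⟨⟨residue_pos d p, ?_⟩, fun hev => ?_⟩
  · rcases Nat.lt_or_ge 1 d with hd1 | hd1
    · have : residue d p ≠ d := fun h => by
        have hdvd : d ∣ p := by
          rw [h] at h1
          exact ⟨(p - 1) / d + 1, by rw [mul_add, mul_one, mul_comm]; exact h1.symm⟩
        rcases (Nat.dvd_prime hp).1 hdvd with h' | h' <;> omega
      omega
    · omega
  · have hd2 : 2 ≤ d := by
      rcases hev with ⟨k, hk⟩; omega
    have hodd : Odd p := hp.odd_of_ne_two (by omega)
    rw [← h1, Nat.odd_add] at hodd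
    exact Nat.not_even_iff_odd.1 fun h => (Nat.not_even_iff_odd.2 (hodd.2 h)) (hev.mul_left _)

theorem le_roundUp {d N : ℕ} (hd : 0 < d) : N ≤ roundUp d N := by
  have := Nat.div_add_mod' N d
  have := Nat.mod_lt N hd
  unfold roundUp
  omega

theorem roundUp_le (d N : ℕ) : roundUp d N ≤ N + d := by
  have := Nat.div_mul_le_self N d
  unfold roundUp
  omega

/-- Since `N' ≥ d - 1`, and `N' = N ≥ 1` for `d = 1`, the truncated subtraction in `(roundUp d N -
b) / d` is a true one. -/
theorem le_roundUp_of_mem_residues {d N b : ℕ} (hd : 0 < d) (hN : 1 ≤ N) (h : b ∈ residues d) :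
    b ≤ roundUp d N := by
  have h1 := (mem_residues.1 h).1.2
  have h2 := le_roundUp (N := N) hd
  unfold roundUp at *
  omega

theorem mem_classPrimes_iff {d N b p : ℕ} (hd : 0 < d) (hN : 1 ≤ N) (hb : b ∈ residues d) :
    p ∈ classPrimes d b ((roundUp d N - b) / d) ↔
      (d < p ∧ p ≤ roundUp d N) ∧ p.Prime ∧ residue d p = b := by
  have hbN := le_roundUp_of_mem_residues hd hN hb
  constructor
  · intro h
    have h1 := residue_of_mem_classPrimes hd hb h
    obtain ⟨⟨j, ⟨h3, h4⟩, rfl⟩, hp⟩ := mem_classPrimes.1 h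
    have := (Nat.le_div_iff_mul_le hd).1 h4
    exact ⟨⟨h1.1, by omega⟩, hp, h1.2⟩
  · rintro ⟨⟨h1, h2⟩, hp, h3⟩
    have h4 := residue_add_div_mul d p hp.pos
    rw [h3] at h4
    refine mem_classPrimes.2 ⟨⟨(p - 1) / d, ⟨(Nat.one_le_div_iff hd).2 (by omega), ?_⟩, h4⟩, hp⟩
    exact (Nat.le_div_iff_mul_le hd).2 (by omega)

theorem sub_listStep (P : Prices) (d N b : ℕ) (x : ℕ × List (ℕ × ℕ)) :
    ((generateList d N b).bind fun l => multiplyByPrimes P x l).IsSub :=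
  (sub_generateList d N b).bind fun l => sub_multiplyByPrimes P x l

theorem sub_smallStep (P : Prices) (p : ℕ) (x : ℕ × List (ℕ × ℕ)) :
    ((primalityTest P p).bind fun isPrime => if isPrime then multiplySmall p x else ret x).IsSub :=
  (sub_primalityTest P p).bind fun _ => sub_ite (sub_multiplySmall p x) (sub_ret x)

theorem mean_smallStep (P : Prices) {d r p : ℕ} (hd : 0 < d) (hpd : p ≤ d) (hr : r ≠ 0)
    {S : Finset ℕ} (hS : ∀ p ∈ S, p.Prime) (hdis : Disjoint S (if p.Prime then {p} else ∅))
    (x : ℕ × List (ℕ × ℕ)) :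
    ((primalityTest P p).bind fun isPrime => if isPrime then multiplySmall p x else ret x).mean
      (fun y => reachProb d r S y.1) = reachProb d r (S ∪ if p.Prime then {p} else ∅) x.1 := by
  rw [mean_bind, primalityTest, mean_pay]
  by_cases hp : p.Prime
  · simp only [hp, if_true, decide_true, Finset.disjoint_singleton_right] at hdis ⊢
    rw [Finset.union_comm, ← Finset.insert_eq]
    refine mean_multiplySmall (V := fun x => reachProb d r (insert p S) x.1) hp hpd
      (fun x => reachProb_insert hd hp hS hdis hr x.1) (fun x => reachProb_le_one hd ?_ _ _)
      (fun x => reachProb_le_one hd hS _ _) x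
    intro q hq
    rcases Finset.mem_insert.1 hq with rfl | h
    · exact hp
    · exact hS q h
  · simp [hp]

theorem reachProb_empty {d r x : ℕ} (hr : r ≠ 0) :
    reachProb d r ∅ x = if x = r then 1 else 0 := by
  unfold reachProb geometricWeight
  by_cases h : x = r
  · subst h
    simp [Nat.div_self (Nat.pos_of_ne_zero hr)]
  · rw [if_neg h]
    split_ifs with h1 h2
    · exfalso
      obtain ⟨n, rfl⟩ := h1
      have hx : 0 < x := Nat.pos_of_ne_zero (by rintro rfl; simp at hr)
      rw [Nat.mul_div_cancel_left _ hx, Finset.subset_empty, Nat.primeFactors_eq_empty] at h2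
      rcases h2 with rfl | rfl <;> simp at h hr
    · simp
    · rfl

/-- The probability of the integer `r`. -/
theorem mean_generate (P : Prices) {d N r : ℕ} (hd : 0 < d) (hN : 1 ≤ N) (hr : r ≠ 0) :
    (generate P d N).mean (fun y => if y.1 = r then 1 else 0) =
      reachProb d r (primesIoc 0 d ∪ primesIoc d (roundUp d N)) 1 := by
  -- The indicator of the target is the reaching probability when no primes are left, the starting
  -- point of the backward evaluation.
  simp only [← reachProb_empty (d := d) hr]
  rw [generate, mean_bind]
  have h1 : ∀ x : ℕ × List (ℕ × ℕ), (foldList (fun x p => (primalityTest P p).bind fun isPrime =>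
      if isPrime then multiplySmall p x else ret x) x (List.range' 2 (d - 1))).mean
        (fun y => reachProb d r ∅ y.1) = reachProb d r (primesIoc 0 d) x.1 := by
    intro x
    rw [mean_foldList_reachProb (fun p => if p.Prime then {p} else ∅) Prod.fst]
    · congr 1
      ext p
      rw [mem_foldr_union, mem_primesIoc]
      simp only [Finset.notMem_empty, false_or, List.mem_range'_1]
      constructor
      · rintro ⟨a, ha, hp⟩
        by_cases h : a.Prime
        · simp only [h, if_true, Finset.mem_singleton] at hp
          subst hp
          exact ⟨⟨h.pos, by omega⟩, h⟩
        · simp [h] at hp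
      · rintro ⟨h, hp⟩
        have := hp.two_le
        exact ⟨p, by omega, by simp [hp]⟩
    · intro a _ p hp
      by_cases h : a.Prime
      · simp only [h, if_true, Finset.mem_singleton] at hp
        exact hp ▸ h
      · simp [h] at hp
    · intro a ha U hU hdis x
      have := List.mem_range'_1.1 ha
      exact mean_smallStep P hd (by omega) hr hU hdis x
    · simp
    · simp
    · refine (List.nodup_range' (s := 2) (n := d - 1)).imp fun {a b} hab => ?_
      rw [Finset.disjoint_left]
      intro p h1 h2
      split_ifs at h1 h2 <;> simp at h1 h2
      exact hab (h1.symm.trans h2)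
  simp only [h1]
  rw [mean_foldList_reachProb (fun b => classPrimes d b ((roundUp d N - b) / d)) Prod.fst]
  · congr 1
    ext p
    rw [mem_foldr_union, Finset.mem_union]
    refine or_congr Iff.rfl ?_
    constructor
    · rintro ⟨b, hb, hp⟩
      have := (mem_classPrimes_iff hd hN hb).1 hp
      exact mem_primesIoc.2 ⟨this.1, this.2.1⟩
    · intro hp
      have h := mem_primesIoc.1 hp
      have hres := residue_mem_residues hd h.2 h.1.1
      exact ⟨_, hres, (mem_classPrimes_iff hd hN hres).2 ⟨h.1, h.2, rfl⟩⟩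
  · exact fun a _ p hp => (mem_classPrimes.1 hp).2
  · exact fun b hb U hU hdis x => mean_listStep P hd (pos_of_mem_residues hb)
      (le_of_mem_residues hd hb) hr hU hdis x
  · exact fun p hp => (mem_primesIoc.1 hp).2
  · intro b hb
    rw [Finset.disjoint_left]
    intro p h1 h2
    have := (residue_of_mem_classPrimes hd hb h2).1
    have := (mem_primesIoc.1 h1).1.2
    omega
  · refine (nodup_residues d).imp_of_mem fun {a b} ha hb hab => ?_
    rw [Finset.disjoint_left]
    intro p h1 h2
    exact hab ((residue_of_mem_classPrimes hd ha h1).2.symm.trans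
      (residue_of_mem_classPrimes hd hb h2).2)

/-- Termination of steps 1 to 3 is proved separately, by running the constant `1` through the same
recursions; this avoids summing the law over all integers. -/
theorem mean_generate_one (P : Prices) {d : ℕ} (hd : 0 < d) (N : ℕ) :
    (generate P d N).mean (fun _ => 1) = 1 := by
  have hfold : ∀ {α β : Type} {f : β → α → RandComp β} (l : List α),
      (∀ a ∈ l, ∀ x, (f x a).mean (fun _ => 1) = 1) → ∀ x, (foldList f x l).mean (fun _ => 1) = 1 := by
    intro α β f l
    induction l with
    | nil => intro _ x; simp [foldList]
    | cons a l ih =>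
      intro h x
      simp [foldList, ih fun a ha => h a (by simp [ha]), h a (by simp)]
  rw [generate, mean_bind]
  rw [show (fun x : ℕ × List (ℕ × ℕ) => (foldList (fun x p => (primalityTest P p).bind fun isPrime =>
      if isPrime then multiplySmall p x else ret x) x (List.range' 2 (d - 1))).mean
        (fun _ => 1)) = fun _ => 1 from ?_]
  · refine hfold _ (fun b _ x => ?_) _
    rw [mean_bind]
    have : ∀ l, (multiplyByPrimes P x l).mean (fun _ => 1) = 1 := fun l =>
      mean_multiplyByPrimes P x l fun _ => 1
    simp only [this]
    exact mean_generateList_one hd N b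
  · funext x
    refine hfold _ (fun p hp x => ?_) _
    have := List.mem_range'_1.1 hp
    rw [mean_bind, primalityTest, mean_pay]
    by_cases hpp : p.Prime
    · simp only [hpp, decide_true, if_true]
      refine mean_multiplySmall (d := d) (V := fun _ => 1) hpp (by omega) (fun x => ?_)
        (fun _ => le_rfl) (fun _ => le_rfl) x
      have hq := stepProb_mem (d := d) hpp.pos hd
      rw [mul_one, mul_one, ← ENNReal.ofReal_add (by linarith) hq.1]
      simp
    · simp [hpp]

end FactoredIdeals

namespace FactoredIdeals

universe u v w

/-! ## The possible results of steps 1 to 3 -/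

/-- The list is the prime factorization of the integer. -/
def IsValid (x : ℕ × List (ℕ × ℕ)) : Prop := IsFactorizationOf x.2 x.1

/-- The primes of a factorization list. -/
def keys (x : ℕ × List (ℕ × ℕ)) : List ℕ := x.2.map Prod.fst

/-- Only the head of the factorization list is inspected, so a prime that is already present must be
at the head; otherwise it would be listed twice. -/
theorem IsValid.multiplyByValue {x : ℕ × List (ℕ × ℕ)} (hx : IsValid x) {p : ℕ} (hp : p.Prime)
    (hhead : p ∈ keys x → (keys x).head? = some p) :
    IsValid (multiplyByValue x p) ∧ (keys (multiplyByValue x p)).head? = some p ∧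
      ∀ q ∈ keys (multiplyByValue x p), q = p ∨ q ∈ keys x := by
  obtain ⟨r, l⟩ := x
  obtain ⟨h1, h2, h3⟩ := hx
  change (l.map fun q => q.1 ^ q.2).prod = r at h3
  rcases l with _ | ⟨⟨q, e⟩, l⟩
  · have hr : r = 1 := by simpa using h3.symm
    subst hr
    refine ⟨⟨by simp [FactoredIdeals.multiplyByValue], ?_, ?_⟩, by
      simp [FactoredIdeals.multiplyByValue, keys], ?_⟩
    · intro y hy
      simp only [FactoredIdeals.multiplyByValue, List.mem_singleton] at hy
      subst hy
      exact ⟨hp.prime, one_pos⟩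
    · simp [FactoredIdeals.multiplyByValue]
    · simp [FactoredIdeals.multiplyByValue, keys]
  · by_cases hq : q = p
    · subst hq
      simp only [FactoredIdeals.multiplyByValue, if_true, keys, List.map_cons, List.head?_cons,
        true_and]
      refine ⟨⟨by simpa using h1, ?_, ?_⟩, fun y hy => Or.inr hy⟩
      · intro y hy
        rcases List.mem_cons.1 hy with rfl | hy
        · exact ⟨hp.prime, Nat.succ_pos e⟩
        · exact h2 y (by simp [hy])
      · rw [← h3]
        simp only [List.map_cons, List.prod_cons, pow_succ]
        ring
    · have hnot : p ∉ keys (r, (q, e) :: l) := fun h => by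
        have := hhead h
        simp only [keys, List.map_cons, List.head?_cons, Option.some.injEq] at this
        exact hq this
      simp only [FactoredIdeals.multiplyByValue, if_neg hq, keys, List.map_cons, List.head?_cons,
        true_and]
      refine ⟨⟨?_, ?_, ?_⟩, fun y hy => List.mem_cons.1 hy⟩
      · rw [List.map_cons, List.nodup_cons]
        exact ⟨hnot, h1⟩
      · intro y hy
        rcases List.mem_cons.1 hy with rfl | hy
        · exact ⟨hp.prime, one_pos⟩
        · exact h2 y hy
      · rw [← h3]
        simp only [List.map_cons, List.prod_cons, pow_one]
        ring

theorem allOut_multiplyBy {x : ℕ × List (ℕ × ℕ)} {p : ℕ} {Q : ℕ × List (ℕ × ℕ) → Prop}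
    (h : Q (multiplyByValue x p)) : (multiplyBy x p).AllOut Q := by
  obtain ⟨t, -, ht⟩ := takes_multiplyBy x p
  rw [ht]
  exact allOut_charge h

/-- In a sorted list equal entries are adjacent, so a repeated prime is always the one added last.
The set `C` keeps the primes of this list apart from the earlier ones. -/
theorem allOut_multiplyByPrimes (P : Prices) (C : Set ℕ) {l : List ℕ}
    (hl : l.Pairwise (· ≤ ·)) (hlC : ∀ s ∈ l, s.Prime → s ∈ C) {x : ℕ × List (ℕ × ℕ)}
    (hx : IsValid x) (hxC : ∀ p ∈ keys x, p ∉ C) :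
    (multiplyByPrimes P x l).AllOut fun y => IsValid y ∧ ∀ p ∈ keys y, p ∈ keys x ∨ p ∈ C := by
  -- The last clause is the point: a prime of `C` already recorded is at most every remaining entry,
  -- and if it occurs again it is at the head.
  refine (allOut_foldList (fun y l => IsValid y ∧ l.Pairwise (· ≤ ·) ∧
    (∀ s ∈ l, s.Prime → s ∈ C) ∧ (∀ p ∈ keys y, p ∈ keys x ∨ p ∈ C) ∧
    ∀ p ∈ keys y, p ∈ C → (∀ s ∈ l, p ≤ s) ∧ (p ∈ l → (keys y).head? = some p)) ?_
    ⟨hx, hl, hlC, fun p hp => Or.inl hp, fun p hp h => absurd h (hxC p hp)⟩).mono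
    fun y hy => ⟨hy.1, hy.2.2.2.1⟩
  rintro y s l ⟨h1, h2, h3, h4, h5⟩
  rw [List.pairwise_cons] at h2
  refine (allOut_pay (Q := fun b => b = decide s.Prime) rfl).bind ?_
  rintro _ rfl
  by_cases hs : s.Prime
  · simp only [hs, decide_true, if_true]
    have hsC := h3 s (by simp) hs
    obtain ⟨g1, g2, g3⟩ := h1.multiplyByValue hs fun h => (h5 s h hsC).2 (by simp)
    refine allOut_multiplyBy ⟨g1, h2.2, fun s hs => h3 s (by simp [hs]), ?_, ?_⟩
    · intro p hp
      rcases g3 p hp with rfl | h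
      · exact Or.inr hsC
      · exact h4 p h
    · intro p hp hpC
      rcases g3 p hp with rfl | h
      · exact ⟨h2.1, fun _ => g2⟩
      · obtain ⟨k1, k2⟩ := h5 p h hpC
        refine ⟨fun s hs => k1 s (by simp [hs]), fun hpl => ?_⟩
        have : p = s := le_antisymm (k1 s (by simp)) (h2.1 p hpl)
        rw [this]; exact g2
  · simp only [hs, decide_false, Bool.false_eq_true, if_false]
    exact allOut_ret ⟨h1, h2.2, fun s hs => h3 s (by simp [hs]), h4, fun p hp hpC =>
      ⟨fun s hs => (h5 p hp hpC).1 s (by simp [hs]), fun hpl => (h5 p hp hpC).2 (by simp [hpl])⟩⟩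

theorem allOut_multiplySmall {p : ℕ} (hp : p.Prime) {x : ℕ × List (ℕ × ℕ)}
    (hx : IsValid x) (hxp : p ∉ keys x) :
    (multiplySmall p x).AllOut fun y => IsValid y ∧ ∀ q ∈ keys y, q ∈ keys x ∨ q = p := by
  refine (allOut_loop (fun y => IsValid y ∧ (∀ q ∈ keys y, q ∈ keys x ∨ q = p) ∧
    (p ∈ keys y → (keys y).head? = some p)) (Q := fun y => IsValid y ∧
      ∀ q ∈ keys y, q ∈ keys x ∨ q = p) ?_
    ⟨hx, fun q hq => Or.inl hq, fun h => absurd h hxp⟩)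
  rintro y ⟨h1, h2, h3⟩
  refine (allOut_uniform p).bind fun t _ => ?_
  refine (allOut_charge (Q := fun _ => True) trivial).bind fun b _ => ?_
  rcases b with _ | _
  · simp only [Bool.false_eq_true, if_false]
    obtain ⟨g1, g2, g3⟩ := h1.multiplyByValue hp h3
    refine (allOut_multiplyBy (Q := fun z => z = multiplyByValue y p) rfl).bind ?_
    rintro _ rfl
    refine allOut_ret ⟨g1, fun q hq => ?_, fun _ => g2⟩
    rcases g3 q hq with rfl | h
    · exact Or.inr rfl
    · exact h2 q h
  · simp only [if_true]
    exact allOut_ret ⟨h1, h2⟩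

theorem allOut_nextIndex {d : ℕ} (hd : 0 < d) (j : ℕ) : (nextIndex d j).AllOut fun i => i ≤ j := by
  refine (allOut_charge (Q := fun a => a = j * d) rfl).bind ?_
  rintro _ rfl
  refine (allOut_charge (Q := fun a => a = j * d + 1) rfl).bind ?_
  rintro _ rfl
  refine (allOut_uniform _).bind fun x hx => ?_
  refine (allOut_charge (Q := fun a => a = x + (d - 1)) rfl).bind ?_
  rintro _ rfl
  refine allOut_charge ?_
  have h : (j + 1) * d = j * d + d := by ring
  have h' : (x + (d - 1)) / d < j + 1 := (Nat.div_lt_iff_lt_mul hd).2 (by rw [h]; omega)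
  omega

/-- The entries of a list, in increasing order. -/
def IsEntryList (d b J : ℕ) (l : List ℕ) : Prop :=
  l.Pairwise (· ≤ ·) ∧ ∀ s ∈ l, s = 1 ∨ ∃ i, 1 ≤ i ∧ i ≤ J ∧ s = i * d + b

/-- The next index never exceeds the current one, and entries are prepended, so the accumulated list
increases. -/
theorem allOut_listBody {d b J : ℕ} (hd : 0 < d) (hb : 0 < b) {st : ℕ × List ℕ}
    (hst : st.1 ≤ J ∧ st.2.Pairwise (· ≤ ·) ∧
      ∀ s ∈ st.2, ∃ i, st.1 ≤ i ∧ 1 ≤ i ∧ i ≤ J ∧ s = i * d + b) :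
    (listBody d b st).AllOut (Sum.elim (fun st : ℕ × List ℕ => st.1 ≤ J ∧ st.2.Pairwise (· ≤ ·) ∧
      ∀ s ∈ st.2, ∃ i, st.1 ≤ i ∧ 1 ≤ i ∧ i ≤ J ∧ s = i * d + b) (IsEntryList d b J)) := by
  obtain ⟨h1, h2, h3⟩ := hst
  refine (allOut_nextIndex hd st.1).bind fun j hj => ?_
  by_cases h0 : j = 0
  · rw [if_pos h0]
    refine allOut_charge ⟨List.pairwise_cons.2 ⟨fun s hs => ?_, h2⟩, fun s hs => ?_⟩
    · obtain ⟨i, -, -, -, rfl⟩ := h3 s hs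
      omega
    · rcases List.mem_cons.1 hs with h | hs
      · exact Or.inl h
      · obtain ⟨i, -, h5, h6, h7⟩ := h3 s hs
        exact Or.inr ⟨i, h5, h6, h7⟩
  · rw [if_neg h0]
    refine (allOut_charge (Q := fun a => a = j * d) rfl).bind ?_
    rintro _ rfl
    refine (allOut_charge (Q := fun a => a = j * d + b) rfl).bind ?_
    rintro _ rfl
    refine allOut_charge ⟨hj.trans h1, List.pairwise_cons.2 ⟨fun s hs => ?_, h2⟩, fun s hs => ?_⟩
    · obtain ⟨i, h4, -, -, rfl⟩ := h3 s hs
      have := Nat.mul_le_mul_right d (hj.trans h4)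
      omega
    · rcases List.mem_cons.1 hs with h | hs
      · exact ⟨j, le_rfl, by omega, hj.trans h1, h⟩
      · obtain ⟨i, h4, h5⟩ := h3 s hs
        exact ⟨i, hj.trans h4, h5⟩

theorem allOut_generateList {d : ℕ} (hd : 0 < d) (N : ℕ) {b : ℕ} (hb : 0 < b) :
    (generateList d N b).AllOut (IsEntryList d b ((roundUp d N - b) / d)) := by
  refine (allOut_charge (Q := fun a => a = N / d) rfl).bind ?_
  rintro _ rfl
  refine (allOut_charge (Q := fun a => a = N / d * d) rfl).bind ?_
  rintro _ rfl
  refine (allOut_charge (Q := fun a => a = roundUp d N) rfl).bind ?_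
  rintro _ rfl
  refine (allOut_charge (Q := fun a => a = roundUp d N - b) rfl).bind ?_
  rintro _ rfl
  refine (allOut_charge (Q := fun a => a = (roundUp d N - b) / d) rfl).bind ?_
  rintro _ rfl
  exact allOut_loop _ (fun st hst => allOut_listBody hd hb hst) ⟨le_rfl, by simp, by simp⟩

theorem IsEntryList.le {d b N : ℕ} {l : List ℕ} (hd : 0 < d) (hN : 1 ≤ N) (hb : b ∈ residues d)
    (h : IsEntryList d b ((roundUp d N - b) / d) l) : ∀ s ∈ l, s ≤ roundUp d N := by
  intro s hs
  rcases h.2 s hs with rfl | ⟨i, -, h2, rfl⟩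
  · exact hN.trans (le_roundUp hd)
  · have := (Nat.le_div_iff_mul_le hd).1 h2
    have := le_roundUp_of_mem_residues hd hN hb
    omega

theorem allOut_listStep (P : Prices) {d : ℕ} (hd : 0 < d) (N : ℕ) {b : ℕ} (hb : b ∈ residues d)
    {x : ℕ × List (ℕ × ℕ)} (hx : IsValid x) (hxb : ∀ p ∈ keys x, residue d p ≠ b) :
    ((generateList d N b).bind fun l => multiplyByPrimes P x l).AllOut fun y =>
      IsValid y ∧ ∀ p ∈ keys y, p ∈ keys x ∨ (d < p ∧ residue d p = b) := by
  refine (allOut_generateList hd N (pos_of_mem_residues hb)).bind fun l hl => ?_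
  refine allOut_multiplyByPrimes P {p | d < p ∧ residue d p = b} hl.1 (fun s hs hsp => ?_) hx
    fun p hp h => hxb p hp h.2
  rcases hl.2 s hs with rfl | ⟨i, h1, h2, rfl⟩
  · exact absurd hsp Nat.not_prime_one
  · exact residue_of_mem_classPrimes hd hb (mem_classPrimes.2 ⟨⟨i, ⟨h1, h2⟩, rfl⟩, hsp⟩)

/-- Different lists yield primes in different residue classes, all larger than `d`, and step 3
treats each prime `p ≤ d` once. Hence no prime comes back after another one has been started. -/
theorem allOut_generate (P : Prices) {d : ℕ} (hd : 0 < d) (N : ℕ) :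
    (generate P d N).AllOut IsValid := by
  have h0 : IsValid (1, []) := ⟨by simp, by simp, by simp⟩
  refine AllOut.bind (Q := fun x => IsValid x ∧ ∀ p ∈ keys x, d < p) ?_ ?_
  · refine (allOut_foldList (fun x l => (IsValid x ∧ ∀ p ∈ keys x, d < p) ∧ l.Nodup ∧
      (∀ b ∈ l, b ∈ residues d) ∧ ∀ p ∈ keys x, residue d p ∉ l) ?_
      ⟨⟨h0, by simp [keys]⟩, nodup_residues d, fun b hb => hb, by simp [keys]⟩).mono
      fun x hx => hx.1
    rintro x b l ⟨⟨h1, h2⟩, h3, h4, h5⟩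
    rw [List.nodup_cons] at h3
    refine (allOut_listStep P hd N (h4 b (by simp)) h1 fun p hp h =>
      h5 p hp (by simp [h])).mono fun y hy => ?_
    refine ⟨⟨hy.1, fun p hp => ?_⟩, h3.2, fun b hb => h4 b (by simp [hb]), fun p hp hpl => ?_⟩
    · rcases hy.2 p hp with h | h
      · exact h2 p h
      · exact h.1
    · rcases hy.2 p hp with h | h
      · exact h5 p h (by simp [hpl])
      · exact h3.1 (h.2 ▸ hpl)
  · intro x hx
    refine (allOut_foldList (fun x l => IsValid x ∧ l.Nodup ∧ ∀ p ∈ keys x, p ∉ l) ?_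
      ⟨hx.1, List.nodup_range', fun p hp hpl => ?_⟩).mono fun x hx => hx.1
    · rintro x p l ⟨h1, h2, h3⟩
      rw [List.nodup_cons] at h2
      refine (allOut_pay (Q := fun b => b = decide p.Prime) rfl).bind ?_
      rintro _ rfl
      by_cases hp : p.Prime
      · simp only [hp, decide_true, if_true]
        refine (allOut_multiplySmall hp h1 fun h => h3 p h (by simp)).mono fun y hy =>
          ⟨hy.1, h2.2, fun q hq hql => ?_⟩
        rcases hy.2 q hq with h | rfl
        · exact h3 q h (by simp [hql])
        · exact h2.1 hql
      · simp only [hp, decide_false, Bool.false_eq_true, if_false]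
        exact allOut_ret ⟨h1, h2.2, fun q hq hql => h3 q hq (by simp [hql])⟩
    · have := hx.2 p hp
      have := List.mem_range'_1.1 hpl
      omega

end FactoredIdeals

namespace FactoredIdeals

universe u v w

/-! ## One round -/

section

variable {K : Type u} [Field K] [NumberField K]

theorem prod_primeFactors_eq {d M r : ℕ} (hd : d ≤ M) (hr : r ≠ 0) (hrM : r ≤ M) (f g : ℕ → ℝ) :
    r.factorization.prod (fun p e => (if p ≤ d then f p else g p) ^ e) =
      (∏ p ∈ primesIoc 0 d, f p ^ r.factorization p) *
        ∏ p ∈ primesIoc d M, g p ^ r.factorization p := by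
  have h0 : ∏ p ∈ primesIoc 0 M, (if p ≤ d then f p else g p) ^ r.factorization p =
      r.factorization.prod (fun p e => (if p ≤ d then f p else g p) ^ e) := by
    rw [Finsupp.prod, Nat.support_factorization]
    refine (Finset.prod_subset (fun p hp => ?_) fun p _ hp => ?_).symm
    · have hpp := Nat.prime_of_mem_primeFactors hp
      exact mem_primesIoc.2 ⟨⟨hpp.pos, (Nat.le_of_dvd (Nat.pos_of_ne_zero hr)
        (Nat.dvd_of_mem_primeFactors hp)).trans hrM⟩, hpp⟩
    · rw [← Nat.support_factorization, Finsupp.notMem_support_iff] at hp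
      simp [hp]
  rw [← h0, ← Finset.prod_filter_mul_prod_filter_not (primesIoc 0 M) (fun p => p ≤ d)]
  congr 1
  · have : (primesIoc 0 M).filter (fun p => p ≤ d) = primesIoc 0 d := by
      ext p; simp only [Finset.mem_filter, mem_primesIoc]; constructor
      · rintro ⟨h, h'⟩; exact ⟨⟨h.1.1, h'⟩, h.2⟩
      · rintro h; exact ⟨⟨⟨h.1.1, h.1.2.trans hd⟩, h.2⟩, h.1.2⟩
    rw [this]
    refine Finset.prod_congr rfl fun p hp => ?_
    rw [if_pos (mem_primesIoc.1 hp).1.2]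
  · have : (primesIoc 0 M).filter (fun p => ¬ p ≤ d) = primesIoc d M := by
      ext p; simp only [Finset.mem_filter, mem_primesIoc]; constructor
      · rintro ⟨h, h'⟩; exact ⟨⟨by omega, h.1.2⟩, h.2⟩
      · rintro h; exact ⟨⟨⟨by omega, h.1.2⟩, h.2⟩, by omega⟩
    rw [this]
    refine Finset.prod_congr rfl fun p hp => ?_
    rw [if_neg (by have := (mem_primesIoc.1 hp).1.1; omega)]

theorem primesIoc_eq_empty {a b : ℕ} (h : b ≤ a) : primesIoc a b = ∅ := by
  rw [primesIoc, Finset.Ioc_eq_empty (by omega), Finset.filter_empty]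

/-- For `N < d` one has `N' = d - 1 < d`, so the interval is empty. Replacing `N'` by the maximum
makes `d ≤ M` available without a case distinction. -/
theorem primesIoc_max (d M : ℕ) : primesIoc d M = primesIoc d (max d M) := by
  rcases le_total d M with h | h
  · rw [max_eq_right h]
  · rw [max_eq_left h, primesIoc_eq_empty h, primesIoc_eq_empty le_rfl]

theorem cast_keepBase_of_lt {d p : ℕ} (h : d < p) :
    ((p - residue d p + 1 : ℕ) : ℝ) = (p : ℝ) - residue d p + 1 := by
  have := residue_add_div_mul d p (by omega)
  push_cast [Nat.cast_sub (show residue d p ≤ p by omega)]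
  ring

theorem stepProb_eq_of_lt {d p : ℕ} (h : d < p) :
    stepProb d p = d / ((p : ℝ) - residue d p + 1) := by
  rw [stepProb, if_neg (by omega)]

/-- The cancellation that fixes the form of the acceptance probability: prime by prime, `stepProb ^
v_p(r)` meets its inverse, and only the factors `1 - stepProb` and `α`, the `1 / N` and `D(r)`
survive. Here `r ≤ N ≤ N'` ensures that all primes of `r` can be generated. -/
theorem geometricWeight_mul_acceptProb {N r : ℕ} (hr : 1 ≤ r) (hrN : r ≤ N) :
    geometricWeight (Module.finrank ℚ K) (primesIoc 0 (Module.finrank ℚ K) ∪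
      primesIoc (Module.finrank ℚ K) (roundUp (Module.finrank ℚ K) N)) r * acceptProb K N r =
      roundFactor (Module.finrank ℚ K) N * idealCount K r := by
  have hd0 : 0 < Module.finrank ℚ K := finrank_pos' K
  dsimp only [acceptProb]
  set d := Module.finrank ℚ K
  have hr0 : r ≠ 0 := by omega
  set M := max d (roundUp d N) with hM
  have hdM : d ≤ M := le_max_left _ _
  have hrM : r ≤ M := hrN.trans ((le_roundUp hd0).trans (le_max_right _ _))
  have hsub : r.primeFactors ⊆ primesIoc 0 d ∪ primesIoc d M := fun p hp => by
    have hpp := Nat.prime_of_mem_primeFactors hp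
    have hpr := Nat.le_of_dvd (by omega) (Nat.dvd_of_mem_primeFactors hp)
    rw [Finset.mem_union, mem_primesIoc, mem_primesIoc]
    have := hpp.pos
    rcases Nat.lt_or_ge d p with h | h
    · exact Or.inr ⟨⟨h, hpr.trans hrM⟩, hpp⟩
    · exact Or.inl ⟨⟨this, h⟩, hpp⟩
  have hdisj : Disjoint (primesIoc 0 d) (primesIoc d M) := Finset.disjoint_left.2 fun p h1 h2 => by
    have := (mem_primesIoc.1 h1).1.2
    have := (mem_primesIoc.1 h2).1.1
    omega
  have hpsi : (psi d r : ℝ) = (∏ p ∈ primesIoc 0 d, (p : ℝ) ^ r.factorization p) *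
      ∏ p ∈ primesIoc d M, ((p - residue d p + 1 : ℕ) : ℝ) ^ r.factorization p := by
    rw [← prod_primeFactors_eq hdM hr0 hrM (fun p => (p : ℝ))
      fun p => ((p - residue d p + 1 : ℕ) : ℝ), psi, Nat.cast_finsuppProd]
    refine Finsupp.prod_congr fun p _ => ?_
    split_ifs <;> push_cast <;> rfl
  have hOm : (d : ℝ) ^ bigOmegaAbove d r = ∏ p ∈ primesIoc d M, (d : ℝ) ^ r.factorization p := by
    have := prod_primeFactors_eq hdM hr0 hrM (fun _ => 1) fun p => (d : ℝ)
    simp only [one_pow, Finset.prod_const_one, one_mul] at this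
    rw [← this, bigOmegaAbove, ← Finset.prod_pow_eq_pow_sum, Finsupp.prod,
      Nat.support_factorization, Finset.prod_filter]
    refine Finset.prod_congr rfl fun p _ => ?_
    split_ifs <;> first | omega | simp
  rw [roundFactor, primesIoc_max d (roundUp d N), ← hM, geometricWeight, if_pos hsub, Finset.prod_union hdisj,
    smallPrimeFactor, hpsi, hOm]
  have hsmall : (∏ p ∈ primesIoc 0 d, alpha d N / (p : ℝ)) =
      (∏ p ∈ primesIoc 0 d, (1 - stepProb d p) * stepProb d p ^ r.factorization p) *
      (∏ p ∈ primesIoc 0 d, alpha d N * (1 / ((p : ℝ) - 1)) ^ r.factorization p) *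
      ∏ p ∈ primesIoc 0 d, (p : ℝ) ^ r.factorization p := by
    rw [← Finset.prod_mul_distrib, ← Finset.prod_mul_distrib]
    refine Finset.prod_congr rfl fun p hp => ?_
    have h := mem_primesIoc.1 hp
    have h2 : (2 : ℝ) ≤ p := by exact_mod_cast h.2.two_le
    have h3 : (p : ℝ) - 1 ≠ 0 := by linarith
    have h4 : (p : ℝ) ≠ 0 := by linarith
    rw [stepProb, if_pos h.1.2]
    have h5 : (((p : ℝ) - 1) / p) ^ r.factorization p * (1 / ((p : ℝ) - 1)) ^ r.factorization p *
        (p : ℝ) ^ r.factorization p = 1 := by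
      rw [← mul_pow, ← mul_pow]
      have : ((p : ℝ) - 1) / p * (1 / ((p : ℝ) - 1)) * p = 1 := by field_simp
      rw [this, one_pow]
    have h6 : (1 : ℝ) - (p - 1) / p = 1 / p := by field_simp; ring
    rw [h6]
    linear_combination (-(alpha d N / (p : ℝ))) * h5
  have hlarge : (∏ p ∈ primesIoc d M, (1 - d / ((p : ℝ) - residue d p + 1))) *
      (∏ p ∈ primesIoc d M, (d : ℝ) ^ r.factorization p) =
      (∏ p ∈ primesIoc d M, (1 - stepProb d p) * stepProb d p ^ r.factorization p) *
      ∏ p ∈ primesIoc d M, ((p - residue d p + 1 : ℕ) : ℝ) ^ r.factorization p := by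
    rw [← Finset.prod_mul_distrib, ← Finset.prod_mul_distrib]
    refine Finset.prod_congr rfl fun p hp => ?_
    have h := mem_primesIoc.1 hp
    have h1 : ((p - residue d p + 1 : ℕ) : ℝ) ≠ 0 := by positivity
    rw [stepProb_eq_of_lt h.1.1, ← cast_keepBase_of_lt h.1.1, mul_assoc, ← mul_pow,
      div_mul_cancel₀ _ h1]
  have hOm0 : (∏ p ∈ primesIoc d M, (d : ℝ) ^ r.factorization p) ≠ 0 := by
    rw [← hOm]; positivity
  rw [hsmall]
  have hN0 : (N : ℝ) ≠ 0 := by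
    have : 0 < N := by omega
    positivity
  field_simp
  linear_combination (-((∏ p ∈ primesIoc 0 d, (1 - stepProb d p) *
    stepProb d p ^ r.factorization p) * (∏ p ∈ primesIoc 0 d, alpha d N *
    (1 / ((p : ℝ) - 1)) ^ r.factorization p) * (∏ p ∈ primesIoc 0 d,
    (p : ℝ) ^ r.factorization p) * idealCount K r)) * hlarge

theorem roundFactor_pos {d N : ℕ} (hd : 0 < d) (hN : 1 ≤ N) : 0 < roundFactor d N := by
  unfold roundFactor
  have ha : 0 < alpha d N := by
    have : 0 < alphaInvValue d N := alphaInvValue_pos hd N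
    rw [alphaInvValue] at this
    unfold alpha
    positivity
  refine mul_pos (mul_pos ?_ (Finset.prod_pos fun p hp => ?_)) (Finset.prod_pos fun p hp => ?_)
  · have : 0 < N := by omega
    positivity
  · have := (mem_primesIoc.1 hp).2.pos
    positivity
  · have h := mem_primesIoc.1 hp
    rw [← stepProb_eq_of_lt h.1.1]
    linarith [(stepProb_mem h.2.pos hd).2]

variable (P : Prices)

theorem mean_round (N : ℕ) (φ : Option (FactoredNorm K) → ℝ≥0∞) :
    (round K P N).mean φ = (generate P (Module.finrank ℚ K) N).mean fun x =>
      if x.1 ≤ N then ENNReal.ofReal (acceptProb K N x.1) * φ (some (acceptedValue K x)) +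
        ENNReal.ofReal (1 - acceptProb K N x.1) * φ none else φ none := by
  rw [round, mean_bind]
  refine (allOut_generate P (finrank_pos' K) N).mean_congr fun x hx => ?_
  split_ifs with h
  · exact mean_acceptStep hx h φ
  · exact mean_acceptStep_of_lt (by omega) φ

theorem mean_round_eq (N r : ℕ) (hr : 1 ≤ r) (hrN : r ≤ N) :
    (round K P N).mean (fun x => x.elim 0 fun y => if y.norm = r then 1 else 0) =
      ENNReal.ofReal (roundFactor (Module.finrank ℚ K) N * idealCount K r) := by
  have hd0 := finrank_pos' K
  rw [mean_round]
  have h1 : (fun x : ℕ × List (ℕ × ℕ) => if x.1 ≤ N then ENNReal.ofReal (acceptProb K N x.1) *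
      ((some (acceptedValue K x)).elim 0 fun y => if y.norm = r then 1 else 0) +
        ENNReal.ofReal (1 - acceptProb K N x.1) * (none : Option (FactoredNorm K)).elim 0
          (fun y => if y.norm = r then 1 else 0)
      else (none : Option (FactoredNorm K)).elim 0 (fun y => if y.norm = r then 1 else 0)) =
      fun x => ENNReal.ofReal (acceptProb K N r) * if x.1 = r then 1 else 0 := by
    funext x
    simp only [Option.elim, acceptedValue]
    by_cases h : x.1 = r
    · simp [h, hrN]
    · simp [h]
  rw [h1, mean_const_mul, mean_generate P hd0 (hr.trans hrN) (by omega), reachProb,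
    if_pos (one_dvd r), Nat.div_one, mul_comm, ← ENNReal.ofReal_mul,
    geometricWeight_mul_acceptProb hr hrN]
  refine (geometricWeight_mem hd0 (fun p hp => ?_) r).1
  rcases Finset.mem_union.1 hp with h | h <;> exact (mem_primesIoc.1 h).2

theorem mean_round_one (N : ℕ) : (round K P N).mean (fun _ => 1) = 1 := by
  refine Eq.trans ?_ (mean_generate_one P (finrank_pos' K) N)
  rw [round, mean_bind]
  refine (allOut_generate P (finrank_pos' K) N).mean_congr fun x hx => ?_
  rcases Nat.lt_or_ge N x.1 with h | h
  · exact mean_acceptStep_of_lt (K := K) h _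
  · have hx1 : 1 ≤ x.1 := Nat.one_le_iff_ne_zero.2 (IsFactorizationOf.ne_zero hx)
    have := acceptProb_mem (K := K) hx1 h
    have h1 := mean_acceptStep (K := K) (P := P) hx h fun _ => 1
    rw [mul_one, mul_one, ← ENNReal.ofReal_add this.1 (by linarith [this.2]),
      add_sub_cancel, ENNReal.ofReal_one] at h1
    exact h1

/-- Converts a vanishing expectation into impossibility: a result of positive weight with `φ ≠ 0`
would contribute a positive term. -/
theorem _root_.FactoredIdeals.RandComp.allOut_of_mean_eq_zero {α : Type u} {m : RandComp α}
    {Q : α → Prop} {φ : α → ℝ≥0∞} (h : m.mean φ = 0) (hφ : ∀ a, ¬ Q a → φ a ≠ 0) :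
    m.AllOut Q := by
  intro a c hac
  by_contra hQ
  simp only [mean, lexp, ENNReal.tsum_eq_zero] at h
  exact (mul_ne_zero hac (hφ a hQ)) (h a c)

/-- `y` is a factored integer that step 4 accepts with positive probability. -/
def IsAcceptable (N : ℕ) (y : FactoredNorm K) : Prop :=
  ∃ x : ℕ × List (ℕ × ℕ), IsValid x ∧ x.1 ≤ N ∧ 0 < acceptProb K N x.1 ∧ y = acceptedValue K x

theorem IsAcceptable.isFactoredNorm {N : ℕ} {y : FactoredNorm K} (h : IsAcceptable N y) :
    IsFactoredNorm y.norm y := by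
  obtain ⟨x, hx, -, -, rfl⟩ := h
  exact isFactoredNorm_acceptedValue hx

theorem IsAcceptable.norm_mem {N : ℕ} {y : FactoredNorm K} (h : IsAcceptable N y) :
    1 ≤ y.norm ∧ y.norm ≤ N := by
  obtain ⟨x, hx, h1, -, rfl⟩ := h
  exact ⟨Nat.one_le_iff_ne_zero.2 (IsFactorizationOf.ne_zero hx), h1⟩

/-- Besides validity this records a positive acceptance probability. It forces `D(r) ≠ 0`, so the
later uniform choice is never made from an empty list of solutions. -/
theorem allOut_round (N : ℕ) :
    (round K P N).AllOut fun x => ∀ y, x = some y → IsAcceptable N y := by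
  classical
  refine allOut_of_mean_eq_zero (φ := fun x => x.elim 0 fun y => if IsAcceptable N y then 0 else 1)
    ?_ ?_
  · rw [mean_round]
    refine Eq.trans ?_ (mean_zero (generate P (Module.finrank ℚ K) N))
    refine (allOut_generate P (finrank_pos' K) N).mean_congr fun x hx => ?_
    simp only [Option.elim, mul_zero, add_zero, ite_eq_right_iff]
    intro h
    by_cases h0 : 0 < acceptProb K N x.1
    · rw [if_pos ⟨x, hx, h, h0, rfl⟩, mul_zero]
    · rw [ENNReal.ofReal_of_nonpos (by linarith), zero_mul]
  · rintro (_ | y) h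
    · simp at h
    · have : ¬ IsAcceptable N y := fun h' => h fun z hz => by cases hz; exact h'
      simp [this]

theorem pr_round (N r : ℕ) (hr : 1 ≤ r) (hrN : r ≤ N) :
    (round K P N).pr (fun x => ∃ y, x = some y ∧ IsFactoredNorm r y) =
      ENNReal.ofReal (roundFactor (Module.finrank ℚ K) N * idealCount K r) := by
  classical
  rw [pr_eq_mean, ← mean_round_eq P N r hr hrN]
  refine (allOut_round P N).mean_congr fun x hx => ?_
  rcases x with _ | y
  · simp
  · have hy := (hx y rfl).isFactoredNorm
    simp only [Option.some.injEq, exists_eq_left', Option.elim]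
    by_cases h : y.norm = r
    · rw [if_pos h, if_pos (h ▸ hy)]
    · rw [if_neg h, if_neg fun h' => h h'.1]

/-! ## Repeating the round -/

/-- The probability that one round accepts. -/
noncomputable def acceptRate (K : Type u) [Field K] [NumberField K] (N : ℕ) : ℝ≥0∞ :=
  ENNReal.ofReal (roundFactor (Module.finrank ℚ K) N) * ∑ s ∈ Finset.Icc 1 N, (idealCount K s : ℝ≥0∞)

theorem acceptRate_pos {N : ℕ} (hN : 1 ≤ N) : acceptRate K N ≠ 0 := by
  refine mul_ne_zero (ENNReal.ofReal_pos.2 (roundFactor_pos (finrank_pos' K) hN)).ne' ?_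
  refine (Finset.sum_pos_iff_of_nonneg (fun _ _ => zero_le) |>.2
    ⟨1, Finset.mem_Icc.2 ⟨le_rfl, hN⟩, ?_⟩).ne'
  simp [idealCount_one]

theorem mean_round_accept (N : ℕ) :
    (round K P N).mean (fun x => x.elim 0 fun _ => 1) = acceptRate K N := by
  have h : (round K P N).mean (fun x => x.elim 0 fun _ => 1) = (round K P N).mean fun x =>
      ∑ r ∈ Finset.Icc 1 N, x.elim 0 fun y => if y.norm = r then 1 else 0 := by
    refine (allOut_round P N).mean_congr fun x hx => ?_
    rcases x with _ | y
    · simp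
    · have := (hx y rfl).norm_mem
      simp [this]
  rw [h, mean, lexp_sum, acceptRate, Finset.mul_sum]
  refine Finset.sum_congr rfl fun r hr => ?_
  rw [Finset.mem_Icc] at hr
  have := mean_round_eq (K := K) P N r hr.1 hr.2
  rw [ENNReal.ofReal_mul (by
    have := roundFactor_pos (N := N) (finrank_pos' K) (hr.1.trans hr.2)
    exact this.le), ENNReal.ofReal_natCast] at this
  exact this

theorem mean_round_split (N : ℕ) (t : ℝ≥0∞) (φ : FactoredNorm K → ℝ≥0∞) :
    (round K P N).mean (fun x => x.elim t φ) =
      (round K P N).mean (fun x => x.elim 1 fun _ => 0) * t +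
        (round K P N).mean (fun x => x.elim 0 φ) := by
  rw [mul_comm, ← mean_const_mul, ← mean_add]
  congr 1
  funext x
  rcases x with _ | y <;> simp

theorem mean_round_reject (N : ℕ) :
    (round K P N).mean (fun x => x.elim 1 fun _ => 0) + acceptRate K N = 1 := by
  refine Eq.trans ?_ (mean_round_one (K := K) P N)
  rw [← mean_round_accept P, ← mean_add]
  congr 1
  funext x
  rcases x with _ | y <;> simp

theorem sub_randomNormBody (N : ℕ) : ((round K P N).bind fun x =>
    ret (x.elim (Sum.inl ()) fun r => Sum.inr r : Unit ⊕ FactoredNorm K)).IsSub :=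
  IsSub.bind (mean_round_one P N).le fun _ => sub_ret _

theorem sub_randomNorm (N : ℕ) : (randomNorm K P N).IsSub :=
  sub_loop (fun _ => sub_randomNormBody P N) _

theorem allOut_randomNorm (N : ℕ) : (randomNorm K P N).AllOut (IsAcceptable N) := by
  refine allOut_loop (fun _ => True) (fun _ _ => ?_) trivial
  refine (allOut_round P N).bind fun x hx => allOut_ret ?_
  rcases x with _ | y
  · trivial
  · exact hx y rfl

/-- With rejection probability `ρ`, the mean `t` satisfies `t = ρ t + (mean over one accepting
round)`, and `1 - ρ` is the acceptance rate. So repetition is conditioning on acceptance. -/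
theorem mean_randomNorm_mul (N : ℕ) {φ : FactoredNorm K → ℝ≥0∞} (hφ : ∀ y, φ y ≤ 1) :
    (randomNorm K P N).mean φ * acceptRate K N = (round K P N).mean fun x => x.elim 0 φ := by
  set t := (randomNorm K P N).mean φ with ht
  have h1 : t = (round K P N).mean fun x => x.elim t φ := by
    conv_lhs => rw [ht, randomNorm, mean_loop, mean_bind]
    congr 1
    funext x
    rcases x with _ | y
    · simp [ht, randomNorm]
    · simp
  have ht1 : t ≤ 1 := (sub_randomNorm P N).mean_le hφ
  rw [mean_round_split] at h1
  set ρ := (round K P N).mean (fun x => x.elim 1 fun _ => 0) with hρ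
  have h2 : ρ + acceptRate K N = 1 := mean_round_reject P N
  have hρt : ρ * t ≠ ⊤ := by
    refine ENNReal.mul_ne_top (ne_top_of_le_ne_top ENNReal.one_ne_top ?_)
      (ne_top_of_le_ne_top ENNReal.one_ne_top ht1)
    rw [← h2]; exact le_self_add
  -- Subtracting `ρ * t` is legitimate because it is finite.
  refine (ENNReal.add_right_inj hρt).1 ?_
  rw [← h1, mul_comm t, ← add_mul, h2, one_mul]

theorem acceptRate_ne_top (N : ℕ) : acceptRate K N ≠ ⊤ :=
  ENNReal.mul_ne_top ENNReal.ofReal_ne_top (ENNReal.sum_ne_top.2 fun _ _ => ENNReal.natCast_ne_top _)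

theorem mean_randomNorm_one {N : ℕ} (hN : 1 ≤ N) : (randomNorm K P N).mean (fun _ => 1) = 1 := by
  have h := mean_randomNorm_mul (K := K) P N (φ := fun _ => 1) fun _ => le_rfl
  rw [mean_round_accept] at h
  exact (ENNReal.mul_eq_right (acceptRate_pos hN) (acceptRate_ne_top N)).1 h

theorem halts_randomNorm {N : ℕ} (hN : 1 ≤ N) : (randomNorm K P N).Halts := by
  classical
  rw [Halts, pr_eq_mean]
  simpa using mean_randomNorm_one P hN

theorem mean_randomNorm_eq {N r : ℕ} (hr : 1 ≤ r) (hrN : r ≤ N) :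
    (randomNorm K P N).mean (fun y => if y.norm = r then 1 else 0) =
      (idealCount K r : ℝ≥0∞) / ∑ s ∈ Finset.Icc 1 N, (idealCount K s : ℝ≥0∞) := by
  have h := mean_randomNorm_mul (K := K) P N (φ := fun y => if y.norm = r then 1 else 0)
    fun y => by split_ifs <;> simp
  have hc := roundFactor_pos (N := N) (finrank_pos' K) (hr.trans hrN)
  rw [mean_round_eq P N r hr hrN, ENNReal.ofReal_mul hc.le, ENNReal.ofReal_natCast, acceptRate,
    mul_left_comm] at h
  have hc0 : ENNReal.ofReal (roundFactor (Module.finrank ℚ K) N) ≠ 0 :=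
    (ENNReal.ofReal_pos.2 hc).ne'
  have h' := (ENNReal.mul_right_inj hc0 ENNReal.ofReal_ne_top).1 h
  refine (ENNReal.eq_div_iff (fun h0 => ?_)
    (ENNReal.sum_ne_top.2 fun _ _ => ENNReal.natCast_ne_top _)).2 ((mul_comm _ _).trans h')
  exact acceptRate_pos (K := K) (hr.trans hrN) (by rw [acceptRate, h0, mul_zero])

theorem pr_randomNorm {N r : ℕ} (hr : 1 ≤ r) (hrN : r ≤ N) :
    (randomNorm K P N).pr (IsFactoredNorm r) =
      (idealCount K r : ℝ≥0∞) / ∑ s ∈ Finset.Icc 1 N, (idealCount K s : ℝ≥0∞) := by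
  classical
  rw [pr_eq_mean, ← mean_randomNorm_eq P hr hrN]
  refine (allOut_randomNorm P N).mean_congr fun y hy => ?_
  by_cases h : y.norm = r
  · rw [if_pos h, if_pos (h ▸ hy.isFactoredNorm)]
  · rw [if_neg h, if_neg fun h' => h h'.1]

end

end FactoredIdeals

namespace FactoredIdeals

universe u v w

/-! ## The random ideal -/

section

variable {K : Type u} [Field K] [NumberField K]

/-- The prime ideals above `p` with the exponents that are positive. -/
noncomputable def idealPairs (K : Type u) [Field K] [NumberField K] (p : ℕ) (cs : List ℕ) :
    List (Ideal (𝓞 K) × ℕ) :=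
  ((primesAbove K p).zip cs).filter fun y => decide (0 < y.2)

theorem prod_idealPairs (p : ℕ) (cs : List ℕ) :
    ((idealPairs K p cs).map fun q => q.1 ^ q.2).prod =
      idealOfExponents (primesAbove K p) cs := by
  unfold idealPairs idealOfExponents
  induction (primesAbove K p).zip cs with
  | nil => simp
  | cons y l ih =>
    by_cases h : 0 < y.2
    · simp [h, ih]
    · have : y.2 = 0 := by omega
      simp [ih, this]

theorem mem_of_mem_idealPairs {p : ℕ} {cs : List ℕ} {y : Ideal (𝓞 K) × ℕ}
    (h : y ∈ idealPairs K p cs) : y.1 ∈ primesAbove K p ∧ 0 < y.2 := by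
  obtain ⟨h1, h2⟩ := List.mem_filter.1 h
  exact ⟨(List.of_mem_zip h1).1, by simpa using h2⟩

theorem nodup_idealPairs (p : ℕ) (cs : List ℕ) : ((idealPairs K p cs).map Prod.fst).Nodup := by
  refine List.Nodup.sublist ?_ (nodup_primesAbove (K := K) p)
  refine (List.filter_sublist.map _).trans ?_
  rw [List.zip_eq_zip_take_min, List.map_fst_zip (by simp)]
  exact List.take_sublist _ _

theorem isFactorizationOf_append {p : ℕ} (hp : p.Prime) {acc : List (Ideal (𝓞 K) × ℕ)}
    {A : Ideal (𝓞 K)} (hA : IsFactorizationOf acc A) (hacc : ∀ y ∈ acc, (p : 𝓞 K) ∉ y.1)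
    (cs : List ℕ) : IsFactorizationOf (idealPairs K p cs ++ acc)
      (A * idealOfExponents (primesAbove K p) cs) := by
  refine ⟨?_, ?_, ?_⟩
  · rw [List.map_append, List.nodup_append]
    refine ⟨nodup_idealPairs p cs, hA.1, ?_⟩
    rintro a ha b hb rfl
    obtain ⟨y, hy, rfl⟩ := List.mem_map.1 ha
    obtain ⟨z, hz, hzy⟩ := List.mem_map.1 hb
    exact hacc z hz (hzy ▸ ((mem_primesAbove hp.ne_zero).1 (mem_of_mem_idealPairs hy).1).2)
  · intro y hy
    rcases List.mem_append.1 hy with h | h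
    · have h1 := mem_of_mem_idealPairs h
      exact ⟨prime_of_mem_primesAbove hp _ h1.1, h1.2⟩
    · exact hA.2.1 y h
  · rw [List.map_append, List.prod_append, prod_idealPairs, hA.2.2, mul_comm]

/-- Two distinct rational primes generate the unit ideal. This keeps the ideals chosen for different
`p` distinct in the output list. -/
theorem natCast_notMem_of_mem_primesAbove {p q : ℕ} (hp : p.Prime) (hq : q.Prime) (hpq : p ≠ q)
    {𝔭 : Ideal (𝓞 K)} (h : 𝔭 ∈ primesAbove K p) : (q : 𝓞 K) ∉ 𝔭 := by
  intro hq'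
  obtain ⟨h1, h2⟩ := (mem_primesAbove hp.ne_zero).1 h
  have htop := span_natCast_sup_span_natCast (K := K) ((Nat.coprime_primes hp hq).2 hpq)
  have : Ideal.span {(p : 𝓞 K)} ⊔ Ideal.span {(q : 𝓞 K)} ≤ 𝔭 :=
    sup_le ((Ideal.span_singleton_le_iff_mem _).2 h2) ((Ideal.span_singleton_le_iff_mem _).2 hq')
  rw [htop, top_le_iff] at this
  exact (Ideal.isPrime_of_prime h1).ne_top this

theorem degreesAbove_mem {p : ℕ} (hp : p.Prime) :
    ∀ f ∈ degreesAbove K p, 0 < f ∧ f ≤ Module.finrank ℚ K := fun f hf =>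
  ⟨degreesAbove_pos hp f hf, (List.le_sum_of_mem hf).trans (sum_degreesAbove_le hp)⟩

/-- One step of `pickIdeal`. -/
noncomputable def pickStep (acc : List (Ideal (𝓞 K) × ℕ)) (q : PrimePower K) :
    RandComp (List (Ideal (𝓞 K) × ℕ)) :=
  (charge q.above.length (q.above.map PrimeAbove.degree)).bind fun fs =>
    (solutions fs q.exponent).bind fun sols =>
    (uniform sols.length).bind fun i =>
    charge (i.size + q.above.length + 1)
      ((((q.above.map PrimeAbove.ideal).zip (sols.getD i [])).filter fun y => decide (0 < y.2))
        ++ acc)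

theorem mean_pickStep {p : ℕ} (hp : p.Prime) (e : ℕ) (acc : List (Ideal (𝓞 K) × ℕ))
    (φ : List (Ideal (𝓞 K) × ℕ) → ℝ≥0∞) :
    (pickStep acc (toPrimePower K (p, e))).mean φ =
      (numSolutions (degreesAbove K p) e : ℝ≥0∞)⁻¹ *
        ∑ i ∈ Finset.range (numSolutions (degreesAbove K p) e),
          φ (idealPairs K p ((solutionList (degreesAbove K p) e).getD i []) ++ acc) := by
  have h : Runs 0 (solutions (degreesAbove K p) e) _ _ :=
    (takes_solutions (degreesAbove_mem hp) le_rfl).runs (w := 0) (by simp)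
  rw [pickStep, mean_bind, mean_charge, mean_bind]
  refine (h.mean _).trans ?_
  rw [mean_bind, mean_uniform, length_solutionList (degreesAbove_pos hp)]
  simp only [mean_charge]
  rfl

open Classical in
-- Induction with the ideal `A` built so far. A target `I = A * J` is hit only if each prime power
-- picks the one solution given by the component of `J` of that norm, which has probability `1 / D(p
-- ^ e)`.
theorem mean_foldList_pickStep (F : List (ℕ × ℕ)) (hF : ∀ q ∈ F, q.1.Prime)
    (hnd : (F.map Prod.fst).Nodup) {acc : List (Ideal (𝓞 K) × ℕ)} {A : Ideal (𝓞 K)}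
    (hA : IsFactorizationOf acc A) (hacc : ∀ y ∈ acc, ∀ q ∈ F, (q.1 : 𝓞 K) ∉ y.1)
    (I : Ideal (𝓞 K)) :
    (foldList pickStep acc (F.map (toPrimePower K))).mean
      (fun L => if IsFactorizationOf L I then 1 else 0) =
      if ∃ J, Ideal.absNorm J = (F.map fun q => q.1 ^ q.2).prod ∧ A * J = I then
        (F.map fun q => (numSolutions (degreesAbove K q.1) q.2 : ℝ≥0∞)⁻¹).prod else 0 := by
  classical
  induction F generalizing acc A with
  | nil =>
    simp only [List.map_nil, foldList, mean_charge, List.prod_nil]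
    refine if_congr ⟨fun h => ⟨⊤, by simp, ?_⟩, ?_⟩ rfl rfl
    · rw [Ideal.mul_top, ← hA.2.2, ← h.2.2]
    · rintro ⟨J, hJ, rfl⟩
      rw [Ideal.absNorm_eq_one_iff.1 hJ, Ideal.mul_top]
      exact hA
  | cons q F ih =>
    obtain ⟨p, e⟩ := q
    have hp : p.Prime := hF (p, e) (by simp)
    rw [List.map_cons, List.nodup_cons] at hnd
    have hF' : ∀ q ∈ F, q.1.Prime := fun q hq => hF q (by simp [hq])
    have hne : ∀ q ∈ F, p ≠ q.1 := fun q hq h => hnd.1 (List.mem_map.2 ⟨q, hq, h.symm⟩)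
    set n := (F.map fun q => q.1 ^ q.2).prod with hn
    have hco : (p ^ e).Coprime n := by
      refine Nat.Coprime.pow_left e ?_
      rw [hn, Nat.coprime_list_prod_right_iff]
      intro m hm
      obtain ⟨q, hq, rfl⟩ := List.mem_map.1 hm
      exact Nat.Coprime.pow_right _ ((Nat.coprime_primes hp (hF' q hq)).2 (hne q hq))
    have hA0 : A ≠ 0 := by
      rw [← hA.2.2]
      refine List.prod_ne_zero fun h => ?_
      obtain ⟨y, hy, h0⟩ := List.mem_map.1 h
      exact pow_ne_zero _ (hA.2.1 y hy).1.ne_zero h0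
    set sols := solutionList (degreesAbove K p) e with hsols
    set W := (F.map fun q => (numSolutions (degreesAbove K q.1) q.2 : ℝ≥0∞)⁻¹).prod with hW
    have hlen : sols.length = numSolutions (degreesAbove K p) e :=
      length_solutionList (degreesAbove_pos hp) e
    have hget : ∀ i, i < numSolutions (degreesAbove K p) e → sols.getD i [] ∈ sols := fun i hi => by
      rw [List.getD_eq_getElem _ _ (hlen ▸ hi)]
      exact List.getElem_mem _
    rw [List.map_cons, foldList, mean_bind, mean_charge, mean_bind, mean_pickStep hp]
    have hstep : ∀ i ∈ Finset.range (numSolutions (degreesAbove K p) e),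
        (foldList pickStep (idealPairs K p (sols.getD i []) ++ acc)
          (F.map (toPrimePower K))).mean (fun L => if IsFactorizationOf L I then 1 else 0) =
        if ∃ J, Ideal.absNorm J = n ∧
          A * idealOfExponents (primesAbove K p) (sols.getD i []) * J = I then W else 0 := by
      intro i _
      refine ih hF' hnd.2 (isFactorizationOf_append hp hA (fun y hy => hacc y hy (p, e) (by simp)) _)
        fun y hy q hq => ?_
      rcases List.mem_append.1 hy with h | h
      · exact natCast_notMem_of_mem_primesAbove hp (hF' q hq) (hne q hq)
          (mem_of_mem_idealPairs h).1
      · exact hacc y h q (by simp [hq])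
    rw [Finset.sum_congr rfl hstep, List.map_cons, List.prod_cons, List.map_cons, List.prod_cons,
      ← hn, ← hW]
    by_cases hJ : ∃ J, Ideal.absNorm J = p ^ e * n ∧ A * J = I
    · rw [if_pos hJ]
      obtain ⟨J, hJ, rfl⟩ := hJ
      congr 1
      have hJp := absNorm_sup_span hco hJ
      have hJn := absNorm_sup_span hco.symm (hJ.trans (mul_comm _ _))
      obtain ⟨i, hi, hi'⟩ := List.getElem_of_mem (exponentsIn_mem_solutionList hp hJp)
      have hgi : sols.getD i [] = exponentsIn (primesAbove K p)
          (J ⊔ Ideal.span {((p ^ e : ℕ) : 𝓞 K)}) := by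
        rw [List.getD_eq_getElem _ _ hi]; exact hi'
      -- The index `i` belongs to the exponents of `J + (p ^ e)`. Any other successful index would
      -- have the same ideal as its `p`-part, hence the same exponents, and the solution list has no
      -- repetitions.
      rw [Finset.sum_eq_single i]
      · rw [if_pos]
        refine ⟨J ⊔ Ideal.span {(n : 𝓞 K)}, hJn, ?_⟩
        rw [hgi, idealOfExponents_exponentsIn hp hJp, mul_assoc, sup_span_mul_sup_span hco hJ]
      · intro k hk hki
        rw [if_neg]
        rintro ⟨J', hJ', h⟩
        have hk' := Finset.mem_range.1 hk
        rw [mul_assoc] at h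
        have h1 := mul_left_cancel₀ hA0 h
        have h2 := mul_sup_span_eq hco (absNorm_of_mem_solutionList hp (hget k hk')) hJ'
        rw [h1] at h2
        have h3 := exponentsIn_of_mem_solutionList hp (hget k hk')
        have hk2 : k < sols.length := hlen ▸ hk'
        rw [← h2, ← hgi, List.getD_eq_getElem _ _ hk2, List.getD_eq_getElem _ _ hi] at h3
        exact hki ((nodup_solutionList _ _).getElem_inj_iff.1 h3).symm
      · intro h
        exact absurd (Finset.mem_range.2 (hlen ▸ hi)) h
    · rw [if_neg hJ, Finset.sum_eq_zero, mul_zero]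
      intro i hi
      rw [if_neg]
      rintro ⟨J', hJ', rfl⟩
      refine hJ ⟨idealOfExponents (primesAbove K p) (sols.getD i []) * J', ?_, by rw [mul_assoc]⟩
      rw [map_mul, hJ', absNorm_of_mem_solutionList hp (hget i (Finset.mem_range.1 hi))]

theorem mean_foldList_pickStep_one (F : List (ℕ × ℕ)) (hF : ∀ q ∈ F, q.1.Prime)
    (hpos : ∀ q ∈ F, numSolutions (degreesAbove K q.1) q.2 ≠ 0) (acc : List (Ideal (𝓞 K) × ℕ)) :
    (foldList pickStep acc (F.map (toPrimePower K))).mean (fun _ => 1) = 1 := by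
  induction F generalizing acc with
  | nil => simp [foldList]
  | cons q F ih =>
    have ih := ih (fun q hq => hF q (by simp [hq])) fun q hq => hpos q (by simp [hq])
    rw [List.map_cons, foldList, mean_bind, mean_charge, mean_bind, mean_pickStep (hF q (by simp))]
    simp only [ih, Finset.sum_const, Finset.card_range, nsmul_eq_mul, mul_one]
    exact ENNReal.inv_mul_cancel (by exact_mod_cast hpos q (by simp)) (ENNReal.natCast_ne_top _)

theorem prod_numSolutions {l : List (ℕ × ℕ)} {r : ℕ} (hl : IsFactorizationOf l r) :
    (l.map fun q => numSolutions (degreesAbove K q.1) q.2).prod = idealCount K r := by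
  rw [idealCount_eq_prod hl.ne_zero, ← hl.prod_map]

theorem idealCount_pos_of_acceptProb_pos {N r : ℕ} (h : 0 < acceptProb K N r) :
    idealCount K r ≠ 0 := by
  rintro h0
  simp [acceptProb, h0] at h

theorem acceptedValue_factors (x : ℕ × List (ℕ × ℕ)) :
    (acceptedValue K x).factors = x.2.reverse.map (toPrimePower K) := by
  simp [acceptedValue]

theorem sub_pickIdeal_of_isAcceptable {N : ℕ} {y : FactoredNorm K} (hy : IsAcceptable N y) :
    (pickIdeal K y.factors).mean (fun _ => 1) = 1 := by
  obtain ⟨x, hx, -, h0, rfl⟩ := hy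
  have hx' := hx.reverse
  rw [acceptedValue_factors]
  refine mean_foldList_pickStep_one _ (fun q hq => hx'.prime hq) (fun q hq hq0 => ?_) []
  have := prod_numSolutions (K := K) hx'
  rw [List.prod_eq_zero (List.mem_map.2 ⟨q, hq, hq0⟩)] at this
  exact idealCount_pos_of_acceptProb_pos h0 this.symm

open Classical in
theorem mean_pickIdeal {N : ℕ} {y : FactoredNorm K} (hy : IsAcceptable N y) (I : Ideal (𝓞 K)) :
    (pickIdeal K y.factors).mean (fun L => if IsFactorizationOf L I then 1 else 0) =
      if Ideal.absNorm I = y.norm then (idealCount K y.norm : ℝ≥0∞)⁻¹ else 0 := by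
  classical
  obtain ⟨x, hx, -, h0, rfl⟩ := hy
  have hx' := hx.reverse
  have hprod : (x.2.reverse.map fun q =>
      (numSolutions (degreesAbove K q.1) q.2 : ℝ≥0∞)⁻¹).prod = (idealCount K x.1 : ℝ≥0∞)⁻¹ := by
    rw [← prod_numSolutions hx', Nat.cast_list_prod]
    induction x.2.reverse with
    | nil => simp
    | cons q l ih =>
      simp only [List.map_cons, List.prod_cons, ih]
      rw [ENNReal.mul_inv (Or.inr ?_) (Or.inl (ENNReal.natCast_ne_top _))]
      rw [← Nat.cast_list_prod]
      exact ENNReal.natCast_ne_top _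
  rw [acceptedValue_factors]
  refine (mean_foldList_pickStep _ (fun q hq => hx'.prime hq) hx'.1
    (acc := []) (A := 1) ⟨by simp, by simp, by simp⟩ (by simp) I).trans ?_
  rw [hprod, hx'.2.2]
  refine if_congr ⟨?_, fun h => ⟨I, h, one_mul I⟩⟩ rfl rfl
  rintro ⟨J, hJ, rfl⟩
  rw [one_mul, hJ]
  rfl

theorem finite_absNorm_eq (r : ℕ) :
    Finite {I : Ideal (𝓞 K) // Ideal.absNorm I = r} :=
  (Ideal.finite_setOfPred_absNorm_eq (S := 𝓞 K) r).to_subtype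

theorem idealCountLE_eq_sum (N : ℕ) :
    idealCountLE K N = ∑ s ∈ Finset.Icc 1 N, idealCount K s := by
  have h : ∀ s : Finset.Icc 1 N, Finite {I : Ideal (𝓞 K) // Ideal.absNorm I = s} := fun s =>
    finite_absNorm_eq _
  rw [← Finset.sum_coe_sort]
  unfold idealCount
  rw [← Nat.card_sigma]
  refine Nat.card_congr ⟨fun I => ⟨⟨Ideal.absNorm I.1, Finset.mem_Icc.2 ⟨?_, I.2.2⟩⟩, I.1, rfl⟩,
    fun x => ⟨x.2.1, ?_, ?_⟩, fun I => rfl, ?_⟩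
  · exact Nat.one_le_iff_ne_zero.2 fun h => I.2.1 (Ideal.absNorm_eq_zero_iff.1 h)
  · intro h
    have h1 := x.2.2
    rw [h, Ideal.absNorm_bot] at h1
    have := (Finset.mem_Icc.1 x.1.2).1
    omega
  · rw [x.2.2]
    exact (Finset.mem_Icc.1 x.1.2).2
  · rintro ⟨⟨s, hs⟩, ⟨I, hI⟩⟩
    change Ideal.absNorm I = s at hI
    subst hI
    rfl

variable (P : Prices)

theorem halts_randomIdeal {N : ℕ} (hN : 1 ≤ N) : (randomIdeal K P N).Halts := by
  classical
  rw [Halts, pr_eq_mean]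
  simp only [if_true]
  refine Eq.trans ?_ (mean_randomNorm_one (K := K) P hN)
  rw [randomIdeal, mean_bind]
  refine (allOut_randomNorm P N).mean_congr fun y hy => ?_
  simp only [mean_bind, mean_ret]
  exact sub_pickIdeal_of_isAcceptable hy

/-- With `r` the norm of `I`, the probability is `D(r) / ∑ D(s)` for the norm times `1 / D(r)` for
the ideal. `D(r) ≠ 0` because `I` itself is counted. -/
theorem pr_randomIdeal {N : ℕ} {I : Ideal (𝓞 K)} (hI : I ≠ ⊥) (hIN : Ideal.absNorm I ≤ N) :
    (randomIdeal K P N).pr (fun x => x.1 = Ideal.absNorm I ∧ IsFactorizationOf x.2 I) =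
      1 / (idealCountLE K N : ℝ≥0∞) := by
  classical
  have hr : Ideal.absNorm I ≠ 0 := fun h => hI (Ideal.absNorm_eq_zero_iff.1 h)
  set r := Ideal.absNorm I with hr'
  have hfin := finite_absNorm_eq (K := K) r
  have hD : idealCount K r ≠ 0 := (Nat.card_pos_iff.2 ⟨⟨⟨I, rfl⟩⟩, hfin⟩).ne'
  rw [pr_eq_mean, randomIdeal, mean_bind]
  have h1 : ∀ y, IsAcceptable N y → ((pickIdeal K y.factors).bind fun I => ret (y.norm, I)).mean
      (fun x => if x.1 = r ∧ IsFactorizationOf x.2 I then 1 else 0) =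
      (idealCount K r : ℝ≥0∞)⁻¹ * if y.norm = r then 1 else 0 := by
    intro y hy
    simp only [mean_bind, mean_ret]
    by_cases h : y.norm = r
    · simp only [h, true_and, if_true, mul_one]
      rw [mean_pickIdeal hy, if_pos (by rw [h]), h]
    · simp [h]
  rw [(allOut_randomNorm P N).mean_congr h1, mean_const_mul,
    mean_randomNorm_eq P (Nat.one_le_iff_ne_zero.2 hr) hIN, idealCountLE_eq_sum, ← mul_div_assoc,
    ENNReal.inv_mul_cancel (by exact_mod_cast hD) (ENNReal.natCast_ne_top _)]
  push_cast
  rfl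

end

end FactoredIdeals

namespace FactoredIdeals

universe u v w

/-! ## The sum of the reciprocals of the primes -/

/-- Chebyshev's argument: the primes in `(2 ^ k, 2 ^ (k + 1)]` all divide the central binomial
coefficient, which is at most `4 ^ (2 ^ k)`. -/
theorem mul_card_primesIoc_two_pow_le (k : ℕ) :
    k * (primesIoc (2 ^ k) (2 ^ (k + 1))).card ≤ 2 ^ (k + 1) := by
  set S := primesIoc (2 ^ k) (2 ^ (k + 1)) with hS
  have h1 : ∏ p ∈ S, p ∣ (2 ^ k + 2 ^ k).choose (2 ^ k) :=
    Finset.prod_primes_dvd _ (fun p hp => (mem_primesIoc.1 hp).2.prime) fun p hp => by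
      obtain ⟨⟨h1, h2⟩, h3⟩ := mem_primesIoc.1 hp
      exact h3.dvd_choose_add h1 h1 (by rw [pow_succ] at h2; omega)
  have h2 : (2 ^ k + 2 ^ k).choose (2 ^ k) ≤ 4 ^ 2 ^ k := by
    rw [← two_mul, ← Nat.centralBinom_eq_two_mul_choose]
    exact Nat.centralBinom_le_four_pow _
  have h3 : (2 ^ k) ^ S.card ≤ ∏ p ∈ S, p :=
    Finset.pow_card_le_prod _ _ _ fun p hp => (mem_primesIoc.1 hp).1.1.le
  have h4 : 2 ^ (k * S.card) ≤ 2 ^ (2 ^ (k + 1)) := by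
    rw [pow_mul]
    refine h3.trans ((Nat.le_of_dvd (Nat.choose_pos (Nat.le_add_left _ _)) h1).trans (h2.trans (le_of_eq ?_)))
    rw [show 4 = 2 ^ 2 by norm_num, ← pow_mul, pow_succ, mul_comm]
  exact (Nat.pow_le_pow_iff_right (by norm_num)).1 h4

theorem sum_primesIoc_two_pow_le {k : ℕ} (hk : 0 < k) :
    ∑ p ∈ primesIoc (2 ^ k) (2 ^ (k + 1)), (p : ℝ)⁻¹ ≤ 2 * (k : ℝ)⁻¹ := by
  have hk' : (0 : ℝ) < k := by exact_mod_cast hk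
  have h := mul_card_primesIoc_two_pow_le k
  calc ∑ p ∈ primesIoc (2 ^ k) (2 ^ (k + 1)), (p : ℝ)⁻¹
      ≤ ∑ p ∈ primesIoc (2 ^ k) (2 ^ (k + 1)), ((2 : ℝ) ^ k)⁻¹ := by
        refine Finset.sum_le_sum fun p hp => inv_anti₀ (by positivity) ?_
        exact_mod_cast (mem_primesIoc.1 hp).1.1.le
    _ = (primesIoc (2 ^ k) (2 ^ (k + 1))).card * ((2 : ℝ) ^ k)⁻¹ := by simp
    _ ≤ 2 * (k : ℝ)⁻¹ := by
        have h' : (k : ℝ) * (primesIoc (2 ^ k) (2 ^ (k + 1))).card ≤ 2 * 2 ^ k := by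
          rw [← pow_succ']; exact_mod_cast h
        rw [← div_eq_mul_inv, ← div_eq_mul_inv, div_le_div_iff₀ (by positivity) hk']
        linarith

theorem primesIoc_union {a b c : ℕ} (hab : a ≤ b) (hbc : b ≤ c) :
    primesIoc a c = primesIoc a b ∪ primesIoc b c := by
  ext p
  simp only [Finset.mem_union, mem_primesIoc]
  constructor
  · rintro ⟨h, hp⟩
    rcases le_or_gt p b with hpb | hpb
    · exact Or.inl ⟨⟨h.1, hpb⟩, hp⟩
    · exact Or.inr ⟨⟨hpb, h.2⟩, hp⟩
  · rintro (⟨h, hp⟩ | ⟨h, hp⟩)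
    · exact ⟨⟨h.1, h.2.trans hbc⟩, hp⟩
    · exact ⟨⟨hab.trans_lt h.1, h.2⟩, hp⟩

/-- Sum the dyadic bounds `2 / k`. The constant `2` instead of the `1` in Mertens' theorem is
affordable: it leads to the exponent `2d` below. -/
theorem sum_inv_primes_le_harmonic (m : ℕ) :
    ∑ p ∈ primesIoc 0 (2 ^ (m + 1)), (p : ℝ)⁻¹ ≤ 1 / 2 + 2 * (harmonic m : ℝ) := by
  induction m with
  | zero =>
    have : primesIoc 0 (2 ^ (0 + 1)) = {2} := by decide
    rw [this]
    simp
  | succ m ih =>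
    rw [primesIoc_union (Nat.zero_le _) (Nat.pow_le_pow_right (n := 2) (by norm_num)
      (Nat.le_succ (m + 1))), harmonic_succ]
    rw [Finset.sum_union (Finset.disjoint_left.2 fun p h1 h2 => by
      have := (mem_primesIoc.1 h1).1.2
      have := (mem_primesIoc.1 h2).1.1
      omega)]
    have := sum_primesIoc_two_pow_le (Nat.succ_pos m)
    push_cast at this ⊢
    linarith

theorem sum_inv_primes_le {m : ℕ} :
    ∑ p ∈ primesIoc 0 (2 ^ m), (p : ℝ)⁻¹ ≤ 5 / 2 + 2 * Real.log m := by
  have h1 : ∑ p ∈ primesIoc 0 (2 ^ m), (p : ℝ)⁻¹ ≤ ∑ p ∈ primesIoc 0 (2 ^ (m + 1)), (p : ℝ)⁻¹ := by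
    refine Finset.sum_le_sum_of_subset_of_nonneg (fun p hp => ?_) fun _ _ _ => by positivity
    obtain ⟨h, hp⟩ := mem_primesIoc.1 hp
    exact mem_primesIoc.2 ⟨⟨h.1, h.2.trans (Nat.pow_le_pow_right (by norm_num) (Nat.le_succ m))⟩,
      hp⟩
  have h2 := sum_inv_primes_le_harmonic m
  have h3 := harmonic_le_one_add_log m
  linarith

/-! ## The probability of acceptance -/

/-- For `p > 4d`, `1 - q ≥ (p - 2d) / (p - d) ≥ exp (-d / (p - 2d))`, and `d / (p - 2d) ≤ d / p +
4d² / p²`. The finitely many `p` in `(d, 4d]` are absorbed into `B`, since `q < 1` there. -/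
theorem exists_exp_le_one_sub_stepProb {d : ℕ} (hd : 0 < d) :
    ∃ B : ℝ, 0 ≤ B ∧ ∀ p : ℕ, d < p →
      Real.exp (-(d * (p : ℝ)⁻¹ + B * ((p : ℝ) ^ 2)⁻¹)) ≤ 1 - stepProb d p := by
  obtain ⟨B₀, hB₀⟩ := ((Finset.Icc (d + 1) (4 * d)).image fun p : ℕ =>
    -Real.log (1 - stepProb d p) * (p : ℝ) ^ 2).exists_le
  have hd' : (0 : ℝ) < d := by exact_mod_cast hd
  refine ⟨max B₀ (4 * d ^ 2), le_max_of_le_right (by positivity), fun p hp => ?_⟩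
  have hq := stepProb_mem (d := d) (show 0 < p by omega) hd
  have hp0 : (0 : ℝ) < p := by exact_mod_cast (show 0 < p by omega)
  rcases le_or_gt p (4 * d) with h | h
  · have hp1 := hB₀ _ (Finset.mem_image_of_mem _ (Finset.mem_Icc.2 ⟨hp, h⟩))
    rw [← Real.le_log_iff_exp_le (by linarith)]
    have h1 : -Real.log (1 - stepProb d p) ≤ max B₀ (4 * d ^ 2) * ((p : ℝ) ^ 2)⁻¹ := by
      rw [← div_eq_mul_inv, le_div_iff₀ (by positivity)]
      exact hp1.trans (le_max_left _ _)
    have h2 : 0 ≤ d * (p : ℝ)⁻¹ := by positivity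
    linarith
  · have h4 : (4 : ℝ) * d < p := by exact_mod_cast h
    have hres : (residue d p : ℝ) ≤ d := by exact_mod_cast residue_le hd p
    have h1 : stepProb d p ≤ d / (p - d) := by
      rw [stepProb_eq_of_lt hp]
      gcongr
      · linarith
      · linarith
    have h2 : (p - 2 * d : ℝ) / (p - d) ≤ 1 - stepProb d p := by
      have : (p - 2 * d : ℝ) / (p - d) = 1 - d / (p - d) := by
        have : (p - d : ℝ) ≠ 0 := by linarith
        field_simp; ring
      linarith
    refine le_trans ?_ h2
    have h3 : d / (p - 2 * d : ℝ) ≤ d * (p : ℝ)⁻¹ + max B₀ (4 * d ^ 2) * ((p : ℝ) ^ 2)⁻¹ := by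
      have h5 : (4 * d ^ 2 : ℝ) * ((p : ℝ) ^ 2)⁻¹ ≤ max B₀ (4 * d ^ 2) * ((p : ℝ) ^ 2)⁻¹ := by
        gcongr; exact le_max_right _ _
      have h6 : d / (p - 2 * d : ℝ) ≤ d * (p : ℝ)⁻¹ + (4 * d ^ 2 : ℝ) * ((p : ℝ) ^ 2)⁻¹ := by
        have : d * (p : ℝ)⁻¹ + (4 * d ^ 2 : ℝ) * ((p : ℝ) ^ 2)⁻¹ = d * (p + 4 * d) / p ^ 2 := by
          field_simp
        rw [this, div_le_div_iff₀ (by linarith) (by positivity)]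
        nlinarith [mul_pos hd' hd']
      linarith
    have h7 : (p - d : ℝ) / (p - 2 * d) ≤ Real.exp (d / (p - 2 * d)) := by
      have h8 := Real.add_one_le_exp (d / (p - 2 * d) : ℝ)
      have : (p - d : ℝ) / (p - 2 * d) = d / (p - 2 * d) + 1 := by
        rw [div_add_one (by linarith : (p - 2 * d : ℝ) ≠ 0)]
        congr 1
        ring
      linarith
    have h9 : 0 < (p - d : ℝ) / (p - 2 * d) := div_pos (by linarith) (by linarith)
    calc Real.exp (-(d * (p : ℝ)⁻¹ + max B₀ (4 * d ^ 2) * ((p : ℝ) ^ 2)⁻¹))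
        ≤ Real.exp (-(d / (p - 2 * d))) := Real.exp_le_exp.2 (by linarith)
      _ = (Real.exp (d / (p - 2 * d)))⁻¹ := Real.exp_neg _
      _ ≤ ((p - d : ℝ) / (p - 2 * d))⁻¹ := inv_anti₀ h9 h7
      _ = _ := inv_div _ _

/-- Exponentiating `∑ 1 / p ≤ 5 / 2 + 2 log (Z + d)`, with `Z` the bit length of `N`, yields `(Z +
d) ^ (-2d)`; the terms with `1 / p²` sum to at most `1`. Finally `Z + d ≤ (1 + d) Z`. -/
theorem exists_le_prod_one_sub {d : ℕ} (hd : 0 < d) :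
    ∃ c : ℝ, 0 < c ∧ ∀ N : ℕ, 1 ≤ N →
      c ≤ (N.size : ℝ) ^ (2 * d) * ∏ p ∈ primesIoc d (roundUp d N), (1 - stepProb d p) := by
  obtain ⟨B, hB, hexp⟩ := exists_exp_le_one_sub_stepProb hd
  have hd' : (0 : ℝ) < d := by exact_mod_cast hd
  refine ⟨Real.exp (-(d * (5 / 2) + B)) * ((1 + d : ℝ) ^ (2 * d))⁻¹, by positivity, fun N hN => ?_⟩
  set Z := N.size with hZ
  have hZ1 : 1 ≤ Z := Nat.size_pos.2 hN
  have hZ' : (1 : ℝ) ≤ Z := by exact_mod_cast hZ1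
  have hprod : Real.exp (-(d * ∑ p ∈ primesIoc d (roundUp d N), (p : ℝ)⁻¹ +
      B * ∑ p ∈ primesIoc d (roundUp d N), ((p : ℝ) ^ 2)⁻¹)) ≤
      ∏ p ∈ primesIoc d (roundUp d N), (1 - stepProb d p) := by
    rw [Finset.mul_sum, Finset.mul_sum, ← Finset.sum_add_distrib, ← Finset.sum_neg_distrib,
      Real.exp_sum]
    exact Finset.prod_le_prod (fun _ _ => (Real.exp_pos _).le)
      fun p hp => hexp p (mem_primesIoc.1 hp).1.1
  have h1 : ∑ p ∈ primesIoc d (roundUp d N), (p : ℝ)⁻¹ ≤ 5 / 2 + 2 * Real.log (Z + d : ℕ) := by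
    refine le_trans (Finset.sum_le_sum_of_subset_of_nonneg (fun p hp => ?_)
      fun _ _ _ => by positivity) sum_inv_primes_le
    obtain ⟨h, hp⟩ := mem_primesIoc.1 hp
    refine mem_primesIoc.2 ⟨⟨by omega, h.2.trans ((roundUp_le d N).trans ?_)⟩, hp⟩
    have h2 : N < 2 ^ Z := Nat.lt_size_self N
    have h3 : d < 2 ^ d := Nat.lt_two_pow_self
    have h4 : 2 ≤ 2 ^ Z := by
      calc 2 = 2 ^ 1 := rfl
        _ ≤ 2 ^ Z := Nat.pow_le_pow_right (by norm_num) hZ1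
    rw [pow_add]
    nlinarith
  have h2 : ∑ p ∈ primesIoc d (roundUp d N), ((p : ℝ) ^ 2)⁻¹ ≤ 1 := by
    rw [primesIoc_max]
    calc _ ≤ ∑ p ∈ Finset.Ioc d (max d (roundUp d N)), ((p : ℝ) ^ 2)⁻¹ :=
          Finset.sum_le_sum_of_subset_of_nonneg (Finset.filter_subset _ _)
            fun _ _ _ => by positivity
      _ ≤ (d : ℝ)⁻¹ - ((max d (roundUp d N) : ℕ) : ℝ)⁻¹ :=
          sum_Ioc_inv_sq_le_sub hd.ne' (le_max_left _ _)
      _ ≤ (d : ℝ)⁻¹ := by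
          have : (0 : ℝ) ≤ ((max d (roundUp d N) : ℕ) : ℝ)⁻¹ := by positivity
          linarith
      _ ≤ 1 := inv_le_one_of_one_le₀ (by exact_mod_cast hd)
  have h3 : Real.exp (-(d * (5 / 2) + B)) * (((Z + d : ℕ) : ℝ) ^ (2 * d))⁻¹ ≤
      ∏ p ∈ primesIoc d (roundUp d N), (1 - stepProb d p) := by
    refine le_trans (le_of_eq ?_) ((Real.exp_le_exp.2 (?_ : -(d * (5 / 2) + B) +
      -((2 * d : ℕ) * Real.log (Z + d : ℕ)) ≤ _)).trans hprod)
    · rw [Real.exp_add, Real.exp_neg ((2 * d : ℕ) * _), Real.exp_nat_mul,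
        Real.exp_log (by positivity)]
    · have h4 := mul_le_mul_of_nonneg_left h1 hd'.le
      have h5 := mul_le_mul_of_nonneg_left h2 hB
      push_cast at h4 ⊢
      linarith
  have h4 : ((1 + d : ℝ) ^ (2 * d))⁻¹ ≤ (Z : ℝ) ^ (2 * d) * (((Z + d : ℕ) : ℝ) ^ (2 * d))⁻¹ := by
    rw [inv_eq_one_div, ← div_eq_mul_inv, div_le_div_iff₀ (by positivity) (by positivity), one_mul,
      ← mul_pow]
    gcongr
    push_cast
    nlinarith
  calc _ ≤ Real.exp (-(d * (5 / 2) + B)) *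
        ((Z : ℝ) ^ (2 * d) * (((Z + d : ℕ) : ℝ) ^ (2 * d))⁻¹) := by gcongr
    _ = (Z : ℝ) ^ (2 * d) *
        (Real.exp (-(d * (5 / 2) + B)) * (((Z + d : ℕ) : ℝ) ^ (2 * d))⁻¹) := by ring
    _ ≤ _ := by gcongr

/-- In contrast to `multichoose_le_pow`, polynomial in `L`: choose `d` of the multiplicities, each
at most `L`. So `α⁻¹` is at most the bit length of `N` to the power `d - 1`. -/
theorem multichoose_succ_le_pow (d L : ℕ) : (d + 1).multichoose L ≤ (L + 1) ^ d := by
  induction d generalizing L with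
  | zero => simp
  | succ d ih =>
    induction L with
    | zero => simp
    | succ L ih' =>
      rw [Nat.multichoose_succ_succ]
      have h1 := ih (L + 1)
      calc _ ≤ (L + 1 + 1) ^ d + (L + 1) ^ (d + 1) := add_le_add h1 ih'
        _ ≤ (L + 1 + 1) ^ d + (L + 1 + 1) ^ d * (L + 1) := by
            rw [pow_succ (L + 1)]
            gcongr
            omega
        _ = _ := by ring

theorem size_eq_log_succ {N : ℕ} (hN : 1 ≤ N) : N.size = Nat.log 2 N + 1 :=
  le_antisymm (Nat.size_le.2 (Nat.lt_pow_succ_log_self (by omega) N))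
    (Nat.succ_le_of_lt (Nat.lt_size.2 (Nat.pow_log_le_self 2 (by omega))))

theorem alphaInvValue_le {d N : ℕ} (hd : 0 < d) (hN : 1 ≤ N) :
    alphaInvValue d N ≤ N.size ^ (d - 1) := by
  obtain ⟨d, rfl⟩ := Nat.exists_eq_succ_of_ne_zero hd.ne'
  rw [alphaInvValue_eq_multichoose, size_eq_log_succ hN]
  exact multichoose_succ_le_pow d _

/-- Each factor is at least `x = 1 / (Z ^ (d - 1) d) ≤ 1`, with `Z` the bit length of `N`, and there
are at most `d - 1` primes up to `d`. -/
theorem le_prod_alpha_div {d N : ℕ} (hd : 0 < d) (hN : 1 ≤ N) :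
    ((d : ℝ) ^ (d - 1))⁻¹ ≤
      (N.size : ℝ) ^ ((d - 1) * (d - 1)) * ∏ p ∈ primesIoc 0 d, alpha d N / p := by
  have hd' : (1 : ℝ) ≤ d := by exact_mod_cast hd
  have hZ : (1 : ℝ) ≤ N.size := by exact_mod_cast Nat.size_pos.2 hN
  have ha0 : (0 : ℝ) < alphaInvValue d N := by exact_mod_cast alphaInvValue_pos hd N
  have ha : (alphaInvValue d N : ℝ) ≤ (N.size : ℝ) ^ (d - 1) := by
    exact_mod_cast alphaInvValue_le hd hN
  set x : ℝ := ((N.size : ℝ) ^ (d - 1) * d)⁻¹ with hx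
  have hx1 : x ≤ 1 := inv_le_one_of_one_le₀ (one_le_mul_of_one_le_of_one_le (one_le_pow₀ hZ) hd')
  have hx0 : 0 ≤ x := by positivity
  have h1 : x ^ (d - 1) ≤ ∏ p ∈ primesIoc 0 d, alpha d N / p := by
    calc x ^ (d - 1) ≤ x ^ (primesIoc 0 d).card :=
          pow_le_pow_of_le_one hx0 hx1 (card_primesIoc_zero_le d)
      _ = ∏ p ∈ primesIoc 0 d, x := by rw [Finset.prod_const]
      _ ≤ _ := by
          refine Finset.prod_le_prod (fun _ _ => hx0) fun p hp => ?_
          have h := mem_primesIoc.1 hp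
          have hpos : (0 : ℝ) < p := by exact_mod_cast h.2.pos
          have hpd : (p : ℝ) ≤ d := by exact_mod_cast h.1.2
          change x ≤ (alphaInvValue d N : ℝ)⁻¹ / p
          rw [hx, div_eq_mul_inv, ← mul_inv]
          exact inv_anti₀ (by positivity) (by gcongr)
  have h2 : ((d : ℝ) ^ (d - 1))⁻¹ = (N.size : ℝ) ^ ((d - 1) * (d - 1)) * x ^ (d - 1) := by
    rw [hx, inv_pow, mul_pow, ← pow_mul, mul_inv, ← mul_assoc, mul_inv_cancel₀ (by positivity),
      one_mul]
  rw [h2]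
  gcongr

section

variable (K : Type u) [Field K] [NumberField K]

/-- The number of ideals divided by `N` tends to the positive residue of the Dedekind zeta function.
Below the threshold `N₀` the unit ideal alone suffices. -/
theorem exists_mul_le_idealCountLE :
    ∃ c : ℝ, 0 < c ∧ ∀ N : ℕ, 1 ≤ N → c * N ≤ idealCountLE K N := by
  have h1 := (NumberField.Ideal.tendsto_norm_le_div_atTop₀ K).comp tendsto_natCast_atTop_atTop
  rw [← NumberField.dedekindZeta_residue_def] at h1
  have hpos := NumberField.dedekindZeta_residue_pos K
  have hcount : ∀ N : ℕ, (Nat.card {I : nonZeroDivisors (Ideal (𝓞 K)) //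
      (Ideal.absNorm (I : Ideal (𝓞 K)) : ℝ) ≤ (N : ℝ)} : ℝ) = idealCountLE K N := by
    intro N
    congr 1
    refine Nat.card_congr ⟨fun I => ⟨I.1.1, mem_nonZeroDivisors_iff_ne_zero.1 I.1.2,
      by exact_mod_cast I.2⟩, fun I => ⟨⟨I.1, mem_nonZeroDivisors_iff_ne_zero.2 I.2.1⟩,
      by exact_mod_cast I.2.2⟩, fun _ => rfl, fun _ => rfl⟩
  have h2 := h1.eventually (lt_mem_nhds (half_lt_self hpos))
  obtain ⟨N₀, hN₀⟩ := eventually_atTop.1 h2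
  set ρ := NumberField.dedekindZeta_residue K
  refine ⟨min (ρ / 2) ((N₀ : ℝ) + 1)⁻¹, by positivity, fun N hN => ?_⟩
  have hN' : (0 : ℝ) < N := by exact_mod_cast hN
  rcases le_total N₀ N with h | h
  · have h3 := hN₀ N h
    simp only [Function.comp_def] at h3
    rw [hcount, lt_div_iff₀ hN'] at h3
    calc min (ρ / 2) ((N₀ : ℝ) + 1)⁻¹ * N ≤ ρ / 2 * N := by gcongr; exact min_le_left _ _
      _ ≤ _ := h3.le
  · have h4 : 1 ≤ idealCountLE K N := by
      rw [idealCountLE_eq_sum]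
      calc 1 = idealCount K 1 := idealCount_one.symm
        _ ≤ _ := Finset.single_le_sum (f := fun s => idealCount K s) (fun _ _ => Nat.zero_le _)
          (Finset.mem_Icc.2 ⟨le_rfl, hN⟩)
    calc min (ρ / 2) ((N₀ : ℝ) + 1)⁻¹ * N ≤ ((N₀ : ℝ) + 1)⁻¹ * (N₀ + 1) := by
          gcongr
          · exact min_le_right _ _
          · have : (N : ℝ) ≤ N₀ := by exact_mod_cast h
            linarith
      _ = 1 := inv_mul_cancel₀ (by positivity)
      _ ≤ _ := by exact_mod_cast h4

theorem exists_inv_acceptRate_le :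
    ∃ C : ℝ, 0 < C ∧ ∀ N : ℕ, 1 ≤ N → (acceptRate K N)⁻¹ ≤ ENNReal.ofReal
      (C * (N.size : ℝ) ^ (Module.finrank ℚ K ^ 2 + Module.finrank ℚ K)) := by
  have hd := finrank_pos' K
  set d := Module.finrank ℚ K with hdef
  obtain ⟨c₁, hc₁, h₁⟩ := exists_le_prod_one_sub hd
  obtain ⟨c₂, hc₂, h₂⟩ := exists_mul_le_idealCountLE K
  refine ⟨(c₁ * c₂ * ((d : ℝ) ^ (d - 1))⁻¹)⁻¹, by positivity, fun N hN => ?_⟩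
  have hN' : (0 : ℝ) < N := by exact_mod_cast hN
  have hZ : (1 : ℝ) ≤ N.size := by exact_mod_cast Nat.size_pos.2 hN
  have hrate : acceptRate K N = ENNReal.ofReal (roundFactor d N * idealCountLE K N) := by
    rw [acceptRate, ENNReal.ofReal_mul (roundFactor_pos hd hN).le, ENNReal.ofReal_natCast,
      idealCountLE_eq_sum]
    push_cast
    rfl
  have hprod : ∏ p ∈ primesIoc d (roundUp d N), (1 - d / ((p : ℝ) - residue d p + 1)) =
      ∏ p ∈ primesIoc d (roundUp d N), (1 - stepProb d p) :=
    Finset.prod_congr rfl fun p hp => by rw [stepProb_eq_of_lt (mem_primesIoc.1 hp).1.1]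
  have key : c₁ * c₂ * ((d : ℝ) ^ (d - 1))⁻¹ ≤
      (N.size : ℝ) ^ (d ^ 2 + d) * (roundFactor d N * idealCountLE K N) := by
    have h1 := h₁ N hN
    have h2 := h₂ N hN
    have h3 := le_prod_alpha_div hd hN
    set X := ∏ p ∈ primesIoc d (roundUp d N), (1 - stepProb d p)
    set Y := ∏ p ∈ primesIoc 0 d, alpha d N / (p : ℝ)
    have hX : 0 ≤ (N.size : ℝ) ^ (2 * d) * X := hc₁.le.trans h1
    have hY : 0 ≤ (N.size : ℝ) ^ ((d - 1) * (d - 1)) * Y := le_trans (by positivity) h3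
    have hXY : 0 ≤ X * Y := mul_nonneg (nonneg_of_mul_nonneg_right hX (by positivity))
      (nonneg_of_mul_nonneg_right hY (by positivity))
    calc c₁ * c₂ * ((d : ℝ) ^ (d - 1))⁻¹
        ≤ ((N.size : ℝ) ^ (2 * d) * X) * (idealCountLE K N / N) *
          ((N.size : ℝ) ^ ((d - 1) * (d - 1)) * Y) := by
          gcongr
          rwa [le_div_iff₀ hN']
      _ = (N.size : ℝ) ^ (2 * d + (d - 1) * (d - 1)) * ((X * Y) * (idealCountLE K N / N)) := by
          rw [pow_add]; ring
      _ ≤ (N.size : ℝ) ^ (d ^ 2 + d) * ((X * Y) * (idealCountLE K N / N)) := by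
          refine mul_le_mul_of_nonneg_right (pow_le_pow_right₀ hZ ?_) (by positivity)
          -- The exponents satisfy `2d + (d - 1)² = d² + 1 ≤ d² + d`.
          obtain ⟨e, he⟩ := Nat.exists_eq_succ_of_ne_zero hd.ne'
          rw [he, Nat.succ_sub_one]
          nlinarith
      _ = _ := by rw [roundFactor, hprod]; ring
  have hpos : 0 < roundFactor d N * idealCountLE K N := by
    refine pos_of_mul_pos_right (a := (N.size : ℝ) ^ (d ^ 2 + d)) ?_ (by positivity)
    exact lt_of_lt_of_le (by positivity) key
  rw [hrate, ← ENNReal.ofReal_inv_of_pos hpos]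
  refine ENNReal.ofReal_le_ofReal ?_
  rw [inv_mul_eq_div, inv_eq_one_div, div_le_div_iff₀ hpos (by positivity), one_mul]
  exact key

end

end FactoredIdeals

namespace FactoredIdeals

universe u v w

namespace RandComp

variable {α : Type u} {β : Type v} {g : Cost →+ ℝ≥0∞}

/-! ## Computations with a bounded cost -/

/-- Every possible result satisfies `Q`, and the cost, measured by `g`, is at most `k`. -/
def Bounded (g : Cost →+ ℝ≥0∞) (m : RandComp α) (Q : α → Prop) (k : ℝ≥0∞) : Prop :=
  ∀ a c, m a c ≠ 0 → Q a ∧ g c ≤ k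

theorem Bounded.mono {m : RandComp α} {Q R : α → Prop} {k k' : ℝ≥0∞} (h : Bounded g m Q k)
    (hQ : ∀ a, Q a → R a) (hk : k ≤ k') : Bounded g m R k' := fun a c hc =>
  ⟨hQ a (h a c hc).1, (h a c hc).2.trans hk⟩

theorem Bounded.and {m : RandComp α} {Q R : α → Prop} {k : ℝ≥0∞} (h : Bounded g m Q k)
    (h' : m.AllOut R) : Bounded g m (fun a => Q a ∧ R a) k := fun a c hc =>
  ⟨⟨(h a c hc).1, h' a c hc⟩, (h a c hc).2⟩

theorem bounded_pay {c : Cost} {a : α} {Q : α → Prop} (h : Q a) : Bounded g (pay c a) Q (g c) := by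
  intro x c' hx
  have : x = a ∧ c' = c := by
    by_contra hn; exact hx (by simp [pay, hn])
  exact ⟨this.1 ▸ h, this.2 ▸ le_rfl⟩

theorem bounded_uniform {w : ℝ≥0∞} (hw : ∀ t, g ⟨0, 0, t⟩ ≤ w * t) {n s : ℕ} (hn : n < 2 ^ s) :
    Bounded g (uniform n) (fun x => x < n) (w * (s + 1 : ℕ)) := by
  intro x c hx
  have : x < n ∧ c = ⟨0, 0, n.size + 1⟩ := by
    by_contra hn; exact hx (by simp [uniform, hn])
  refine ⟨this.1, this.2 ▸ (hw _).trans ?_⟩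
  have := Nat.size_le.2 hn
  gcongr

theorem Runs.bounded {m : RandComp α} {a : α} {k : ℝ≥0∞} (h : Runs g m a k) :
    Bounded g m (fun x => x = a) k := by
  obtain ⟨c, rfl, hc⟩ := h
  exact (bounded_pay (Q := fun x => x = a) rfl).mono (fun _ h => h) hc

theorem Takes.bounded {w : ℝ≥0∞} (hw : ∀ t, g ⟨0, 0, t⟩ ≤ w * t) {m : RandComp α} {a : α} {t : ℕ}
    (h : Takes m a t) : Bounded g m (fun x => x = a) (w * t) := (h.runs hw).bounded

theorem Bounded.bind {m : RandComp α} {f : α → RandComp β} {Q : α → Prop} {R : β → Prop}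
    {k k' : ℝ≥0∞} (hm : Bounded g m Q k) (hf : ∀ a, Q a → Bounded g (f a) R k') :
    Bounded g (m.bind f) R (k + k') := by
  intro b c hb
  by_contra hR
  refine hb ?_
  unfold RandComp.bind
  simp only [ENNReal.tsum_eq_zero]
  intro a c₁ c₂
  split_ifs with hc
  · by_contra h0
    obtain ⟨h1, h2⟩ := mul_ne_zero_iff.1 h0
    have h3 := hm a c₁ h1
    have h4 := hf a h3.1 b c₂ h2
    exact hR ⟨h4.1, by rw [← hc, map_add]; exact add_le_add h3.2 h4.2⟩
  · rfl

theorem bounded_foldList {w : ℝ≥0∞} (hw : ∀ t, g ⟨0, 0, t⟩ ≤ w * t) {f : β → α → RandComp β}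
    {k : ℝ≥0∞} {l : List α} (h : ∀ a ∈ l, ∀ b, Bounded g (f b a) (fun _ => True) k) (b : β) :
    Bounded g (foldList f b l) (fun _ => True) (l.length * (w + k) + w) := by
  have h1 : ∀ b : β, Bounded g (charge 1 b) (fun _ => True) w := fun b =>
    (Takes.bounded hw (takes_charge le_rfl b)).mono (fun _ _ => trivial) (by simp)
  induction l generalizing b with
  | nil => exact (h1 b).mono (fun _ h => h) (by simp)
  | cons a l ih =>
    have ih := ih fun a ha => h a (by simp [ha])
    refine ((h1 b).bind fun b _ => (h a (by simp) b).bind fun b' _ => ih b').mono (fun _ h => h) ?_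
    rw [List.length_cons]
    push_cast
    refine le_of_eq ?_
    ring

/-- Separates the cost of a computation from the potential left behind, so that the exact means
computed above can be reused. -/
theorem ert_eq_add (m : RandComp α) (Φ : α → ℝ≥0∞) :
    ert g m Φ = ert g m (fun _ => 0) + m.mean Φ := by
  simp only [ert, mean, ← lexp_add, add_zero]

theorem Bounded.ert_le {m : RandComp α} {Q : α → Prop} {k : ℝ≥0∞} (h : Bounded g m Q k)
    (hm : m.IsSub) (Φ : α → ℝ≥0∞) : ert g m Φ ≤ k + m.mean Φ := by
  rw [ert_eq_add]
  gcongr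
  calc ert g m (fun _ => 0) ≤ lexp m fun _ _ => k * 1 :=
        lexp_mono_of m fun a c hc => by simpa using (h a c hc).2
    _ = k * m.mean fun _ => 1 := lexp_const_mul ..
    _ ≤ k := mul_le_of_le_one_right' hm

/-- Needed where the mass bound of the continuation is known only for the results that can occur,
such as valid factorizations. -/
theorem ert_bind_le_of_allOut {m : RandComp α} {Q : α → Prop} (hm : m.AllOut Q)
    {f : α → RandComp β} (hf : ∀ a, Q a → (f a).IsSub) (Φ : β → ℝ≥0∞) :
    ert g (m.bind f) Φ ≤ ert g m fun a => ert g (f a) Φ := by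
  rw [ert, lexp_bind]
  refine lexp_mono_of m fun a c hc => ?_
  simp only [map_add]
  exact lexp_le_ert (hf a (hm a c hc)) _ _

end RandComp

/-! ## The expected length of a list -/

/-- A bound for the expected number of entries of a list with `J + 1` possible values. -/
noncomputable def lengthBound (d J : ℕ) : ℝ≥0∞ :=
  1 + ∑ i ∈ Finset.range J, 2 * (d : ℝ≥0∞) / ((i * d + 1 : ℕ) : ℝ≥0∞)

/-- The potential inequality for the list loop, multiplied by the denominator `J d + 1`; `m` is the
number of entries so far. The value of index `J + 1` occurs `d / (J d + 1)` times on average.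
`lengthBound` takes twice that, and the slack pays for the square term and for the cost `κ` per
pass. -/
theorem lengthBound_recursion {d : ℕ} (κ B C A : ℝ≥0∞) (m J : ℕ) :
    (((J * d + 1 : ℕ) : ℝ≥0∞) * κ + (C * (m + 1) ^ 2 + B * (m + 1) + A) +
      d * ∑ i ∈ Finset.range J, (C * (m + 1 + lengthBound d (i + 1)) ^ 2 +
        (B + κ) * (m + 1 + lengthBound d (i + 1)) + A)) ≤
      ((J * d + 1 : ℕ) : ℝ≥0∞) *
        (C * (m + lengthBound d J) ^ 2 + (B + κ) * (m + lengthBound d J) + A) := by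
  induction J with
  | zero =>
    simp only [Nat.zero_mul, zero_add, Nat.cast_one, one_mul, Finset.range_zero,
      Finset.sum_empty, mul_zero, add_zero, lengthBound]
    calc κ + (C * (m + 1) ^ 2 + B * (m + 1) + A)
        ≤ κ + (C * (m + 1) ^ 2 + B * (m + 1) + A) + κ * m := le_self_add
      _ = _ := by ring
  | succ J ih =>
    rw [Finset.sum_range_succ]
    set k : ℝ≥0∞ := ((J * d + 1 : ℕ) : ℝ≥0∞) with hk
    have hk' : (((J + 1) * d + 1 : ℕ) : ℝ≥0∞) = k + d := by rw [hk]; push_cast; ring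
    set δ : ℝ≥0∞ := 2 * (d : ℝ≥0∞) / k with hδ
    have hu : lengthBound d (J + 1) = lengthBound d J + δ := by
      rw [lengthBound, lengthBound, Finset.sum_range_succ, add_assoc]
    have hkδ : k * δ = 2 * d := ENNReal.mul_div_cancel (by simp [hk]) (ENNReal.natCast_ne_top _)
    have hy1 : 1 ≤ (m : ℝ≥0∞) + lengthBound d J :=
      le_add_left (by rw [lengthBound]; exact le_self_add)
    rw [hk', hu]
    set y : ℝ≥0∞ := m + lengthBound d J with hy
    have e1 : (m : ℝ≥0∞) + 1 + (lengthBound d J + δ) = y + δ + 1 := by rw [hy]; ring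
    have e2 : (m : ℝ≥0∞) + (lengthBound d J + δ) = y + δ := by rw [hy]; ring
    rw [e1, e2]
    set S := ∑ i ∈ Finset.range J, (C * (m + 1 + lengthBound d (i + 1)) ^ 2 +
        (B + κ) * (m + 1 + lengthBound d (i + 1)) + A) with hS
    -- The term `C` from the square of the new entry is absorbed because the length bound, hence
    -- `y`, is at least `1`.
    have h1 : C ≤ 2 * C * y :=
      calc C = 1 * C * 1 := by ring
        _ ≤ 2 * C * y := by gcongr; norm_num
    calc (k + d) * κ + (C * (m + 1) ^ 2 + B * (m + 1) + A) +
          d * (S + (C * (y + δ + 1) ^ 2 + (B + κ) * (y + δ + 1) + A))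
        = (k * κ + (C * (m + 1) ^ 2 + B * (m + 1) + A) + d * S) +
          (d * (C * (y + δ) ^ 2 + (B + κ) * (y + δ) + A) + d * C +
            (2 * d * C * y + 2 * d * C * δ + d * B + 2 * d * κ)) := by ring
      _ ≤ (k * (C * y ^ 2 + (B + κ) * y + A)) +
          (d * (C * (y + δ) ^ 2 + (B + κ) * (y + δ) + A) + d * (2 * C * y) +
            (2 * d * C * y + 2 * d * C * δ + d * B + 2 * d * κ)) := by gcongr
      _ ≤ (k * (C * y ^ 2 + (B + κ) * y + A)) +
          (d * (C * (y + δ) ^ 2 + (B + κ) * (y + δ) + A) + d * (2 * C * y) +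
            (2 * d * C * y + 2 * d * C * δ + d * B + 2 * d * κ)) + d * B := le_self_add
      _ = k * (C * y ^ 2 + (B + κ) * y + A) + d * (C * (y + δ) ^ 2 + (B + κ) * (y + δ) + A) +
            (2 * d) * (2 * C * y + C * δ + (B + κ)) := by ring
      _ = k * (C * y ^ 2 + (B + κ) * y + A) + d * (C * (y + δ) ^ 2 + (B + κ) * (y + δ) + A) +
            (k * δ) * (2 * C * y + C * δ + (B + κ)) := by rw [hkδ]
      _ = _ := by ring

theorem mean_listBody {d : ℕ} (hd : 0 < d) (b J : ℕ) (acc : List ℕ)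
    (Φ : ℕ × List ℕ ⊕ List ℕ → ℝ≥0∞) :
    (listBody d b (J, acc)).mean Φ = ((J * d + 1 : ℕ) : ℝ≥0∞)⁻¹ *
      (Φ (Sum.inr (1 :: acc)) + d * ∑ i ∈ Finset.range J,
        Φ (Sum.inl (i + 1, ((i + 1) * d + b) :: acc))) := by
  rw [listBody, mean_bind, mean_nextIndex hd]
  simp [mul, add]

/-- The final value is quadratic in the length, because multiplying the prime entries together costs
time quadratic in their number. The potential is that quadratic evaluated at entries so far plus
`lengthBound`. -/
theorem ert_listLoop_le {g : Cost →+ ℝ≥0∞} {d b J : ℕ} (hd : 0 < d) (hb : 0 < b)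
    {κ κ' B C A : ℝ≥0∞} (hκ : g ⟨0, 0, 1⟩ + κ' ≤ κ)
    (hbody : ∀ j ≤ J, ∀ acc, Bounded g (listBody d b (j, acc)) (fun _ => True) κ') :
    ert g (loop (listBody d b) (J, [])) (fun l => C * (l.length : ℝ≥0∞) ^ 2 + B * l.length + A) ≤
      C * lengthBound d J ^ 2 + (B + κ) * lengthBound d J + A := by
  have key := ert_loop_le (g := g) (sub_listBody d b)
    (Φ := fun st => C * (st.2.length + lengthBound d st.1) ^ 2 +
      (B + κ) * (st.2.length + lengthBound d st.1) + A)
    (Ψ := fun l => C * (l.length : ℝ≥0∞) ^ 2 + B * l.length + A)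
    (fun st => st.1 ≤ J ∧ st.2.Pairwise (· ≤ ·) ∧
      ∀ s ∈ st.2, ∃ i, st.1 ≤ i ∧ 1 ≤ i ∧ i ≤ J ∧ s = i * d + b)
    (fun st hst => (allOut_listBody hd hb hst).mono fun x hx => by
      rcases x with st | l
      · exact hx
      · trivial) ?_ (s := (J, [])) ⟨le_rfl, by simp, by simp⟩
  · simpa using key
  · rintro ⟨j, acc⟩ ⟨hj, -⟩
    refine (add_le_add_right ((hbody j hj acc).ert_le (sub_listBody d b _) _) _).trans ?_
    rw [← add_assoc]
    refine (add_le_add_left hκ _).trans ?_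
    rw [mean_listBody hd]
    simp only [Sum.elim_inr, Sum.elim_inl, List.length_cons]
    set k : ℝ≥0∞ := ((j * d + 1 : ℕ) : ℝ≥0∞) with hk
    have hk0 : k ≠ 0 := by simp [hk]
    have hkt : k ≠ ⊤ := ENNReal.natCast_ne_top _
    have h1 := lengthBound_recursion (d := d) κ B C A acc.length j
    rw [← hk] at h1
    rw [← ENNReal.mul_le_mul_iff_right hk0 hkt]
    refine le_trans (le_of_eq ?_) h1
    rw [mul_add, ← mul_assoc, ENNReal.mul_inv_cancel hk0 hkt, one_mul]
    push_cast
    ring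

end FactoredIdeals

/-! ### Logarithmic list length and the cost of one list -/

namespace FactoredIdeals

universe u v w

theorem sum_two_mul_div_le {d : ℕ} (hd : 0 < d) (J : ℕ) :
    ∑ i ∈ Finset.range J, 2 * (d : ℝ) / ((i * d + 1 : ℕ) : ℝ) ≤ 2 * d + 2 + 2 * Real.log J := by
  have hd' : (0 : ℝ) < d := by exact_mod_cast hd
  have h : ∑ i ∈ Finset.range (J + 1), 2 * (d : ℝ) / ((i * d + 1 : ℕ) : ℝ) ≤
      2 * d + 2 * (harmonic J : ℝ) := by
    induction J with
    | zero => simp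
    | succ J ih =>
      rw [Finset.sum_range_succ, harmonic_succ]
      have h1 : 2 * (d : ℝ) / (((J + 1) * d + 1 : ℕ) : ℝ) ≤ 2 * ((J + 1 : ℕ) : ℝ)⁻¹ := by
        rw [← div_eq_mul_inv, div_le_div_iff₀ (by positivity) (by positivity)]
        push_cast
        nlinarith
      push_cast at h1 ih ⊢
      linarith
  rw [Finset.sum_range_succ] at h
  have h2 := harmonic_le_one_add_log J
  have h3 : 0 ≤ 2 * (d : ℝ) / ((J * d + 1 : ℕ) : ℝ) := by positivity
  linarith

theorem lengthBound_le {d J s : ℕ} (hd : 0 < d) (hJ : J < 2 ^ s) (hs : d + 1 ≤ s) :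
    lengthBound d J ≤ (5 * s : ℕ) := by
  have h1 : ∀ i : ℕ, 2 * (d : ℝ≥0∞) / ((i * d + 1 : ℕ) : ℝ≥0∞) =
      ENNReal.ofReal (2 * (d : ℝ) / ((i * d + 1 : ℕ) : ℝ)) := fun i => by
    rw [ENNReal.ofReal_div_of_pos (by positivity), ENNReal.ofReal_natCast,
      ENNReal.ofReal_mul (by norm_num), ENNReal.ofReal_natCast]
    simp
  have hlog : Real.log J ≤ s := by
    rcases Nat.eq_zero_or_pos J with rfl | h0
    · simp
    · have h2 : (J : ℝ) ≤ (2 : ℝ) ^ s := by exact_mod_cast hJ.le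
      have h3 := Real.log_le_log (by exact_mod_cast h0) h2
      rw [Real.log_pow] at h3
      have h4 : Real.log 2 ≤ 1 := by linarith [Real.log_two_lt_d9]
      nlinarith [Nat.cast_nonneg (α := ℝ) s]
  rw [lengthBound]
  simp only [h1]
  rw [← ENNReal.ofReal_sum_of_nonneg fun i _ => by positivity, ← ENNReal.ofReal_one,
    ← ENNReal.ofReal_add (by norm_num) (Finset.sum_nonneg fun i _ => by positivity),
    ← ENNReal.ofReal_natCast]
  refine ENNReal.ofReal_le_ofReal ?_
  have h2 := sum_two_mul_div_le hd J
  have h3 : (d : ℝ) + 1 ≤ s := by exact_mod_cast hs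
  have h4 : (1 : ℝ) ≤ d := by exact_mod_cast hd
  push_cast at h2 ⊢
  linarith

/-- The bit length that suffices for the numbers in the generation of the lists. -/
def wordSize (d N : ℕ) : ℕ := N.size + d + 1

theorem lt_two_pow_wordSize {d N x : ℕ} (hN : 1 ≤ N) (hx : x ≤ 2 * (N + d)) :
    x < 2 ^ wordSize d N := by
  have h2 : N < 2 ^ N.size := Nat.lt_size_self N
  have h3 : d < 2 ^ d := Nat.lt_two_pow_self
  have h4 : 2 ≤ 2 ^ N.size := Nat.le_self_pow (Nat.size_pos.2 hN).ne' 2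
  rw [wordSize, pow_succ, pow_add]
  nlinarith

section

variable {P : Prices} {g : Cost →+ ℝ≥0∞} {w τ σ : ℝ≥0∞} {d N : ℕ}

theorem bounded_nextIndex (hw : ∀ t : ℕ, g ⟨0, 0, t⟩ ≤ w * t) (hd : 0 < d) {j s : ℕ}
    (hs : ∀ x ≤ j * d + 2 * d, x < 2 ^ s) :
    Bounded g (nextIndex d j) (fun i => i ≤ j) (w * (2 * (s + 1) ^ 2 + 5 * (s + 1) : ℕ)) := by
  have hj : j ≤ j * d := Nat.le_mul_of_pos_right j hd
  have h1 := (takes_mul (hs j (by omega)) (hs d (by omega))).bounded hw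
  have h2 := (takes_add (hs (j * d) (by omega)) (hs 1 (by omega))).bounded hw
  have h3 := bounded_uniform (g := g) hw (hs (j * d + 1) (by omega))
  have key : Bounded g (nextIndex d j) (fun _ => True)
      (w * ((s + 1) ^ 2 : ℕ) + (w * (2 * s + 1 : ℕ) + (w * (s + 1 : ℕ) + (w * (2 * s + 1 : ℕ) +
        w * ((s + 1) ^ 2 : ℕ))))) := by
    refine h1.bind ?_
    rintro _ rfl
    refine h2.bind ?_
    rintro _ rfl
    refine h3.bind fun x hx => ?_
    refine ((takes_add (hs x (by omega)) (hs (d - 1) (by omega))).bounded hw).bind ?_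
    rintro _ rfl
    exact ((takes_div (hs (x + (d - 1)) (by omega)) (hs d (by omega))).bounded hw).mono
      (fun _ _ => trivial) le_rfl
  refine (key.and (allOut_nextIndex hd j)).mono (fun _ h => h.2) ?_
  have hle : (s + 1) ^ 2 + (2 * s + 1 + (s + 1 + (2 * s + 1 + (s + 1) ^ 2))) ≤
      2 * (s + 1) ^ 2 + 5 * (s + 1) := by omega
  simp only [← mul_add, ← Nat.cast_add]
  gcongr

theorem bounded_listBody (hw : ∀ t : ℕ, g ⟨0, 0, t⟩ ≤ w * t) (hd : 0 < d) {b j s : ℕ} (hb : b ≤ d)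
    (hs : ∀ x ≤ j * d + 2 * d, x < 2 ^ s) (acc : List ℕ) :
    Bounded g (listBody d b (j, acc)) (fun _ => True) (w * (10 * (s + 1) ^ 2 : ℕ)) := by
  have hj : j ≤ j * d := Nat.le_mul_of_pos_right j hd
  have key : Bounded g (listBody d b (j, acc)) (fun _ => True)
      (w * (2 * (s + 1) ^ 2 + 5 * (s + 1) : ℕ) + w * ((s + 1) ^ 2 + (2 * s + 1) + 1 : ℕ)) := by
    refine (bounded_nextIndex hw hd hs).bind fun i hi => ?_
    by_cases h0 : i = 0
    · rw [if_pos h0]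
      refine ((takes_charge le_rfl _).bounded hw).mono (fun _ _ => trivial) ?_
      gcongr
      omega
    · rw [if_neg h0]
      have hi' := Nat.mul_le_mul_right d hi
      push_cast
      rw [mul_add, mul_add, mul_one, add_assoc]
      have h1 := (takes_mul (hs i (by omega)) (hs d (by omega))).bounded hw
      have h2 := (takes_add (hs (i * d) (by omega)) (hs b (by omega))).bounded hw
      push_cast at h1 h2
      refine h1.bind ?_
      rintro _ rfl
      refine h2.bind ?_
      rintro _ rfl
      exact ((takes_charge le_rfl _).bounded hw).mono (fun _ _ => trivial) (by simp)
  refine key.mono (fun _ h => h) ?_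
  rw [← mul_add, ← Nat.cast_add]
  gcongr
  nlinarith

theorem ert_generateList_le (hw : ∀ t : ℕ, g ⟨0, 0, t⟩ ≤ w * t) (hd : 0 < d) (hN : 1 ≤ N) {b : ℕ}
    (hb : b ∈ residues d) (A B C : ℝ≥0∞) :
    ert g (generateList d N b) (fun l => C * (l.length : ℝ≥0∞) ^ 2 + B * l.length + A) ≤
      w * (5 * (wordSize d N + 1) ^ 2 : ℕ) + (C * (5 * wordSize d N : ℕ) ^ 2 +
        (B + w * (11 * (wordSize d N + 1) ^ 2 : ℕ)) * (5 * wordSize d N : ℕ) + A) := by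
  set s := wordSize d N with hs
  have hlt : ∀ x ≤ 2 * (N + d), x < 2 ^ s := fun x hx => lt_two_pow_wordSize hN hx
  have hup := roundUp_le d N
  have hb0 := pos_of_mem_residues hb
  have hbd := le_of_mem_residues hd hb
  have hdiv := Nat.div_mul_le_self N d
  have hdiv' := Nat.div_le_self N d
  have hJ := Nat.div_mul_le_self (roundUp d N - b) d
  have hJ' := Nat.div_le_self (roundUp d N - b) d
  set J := (roundUp d N - b) / d with hJdef
  have hloop : ert g (loop (listBody d b) (J, []))
      (fun l => C * (l.length : ℝ≥0∞) ^ 2 + B * l.length + A) ≤ C * (5 * s : ℕ) ^ 2 +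
        (B + w * (11 * (s + 1) ^ 2 : ℕ)) * (5 * s : ℕ) + A := by
    have hu : lengthBound d J ≤ (5 * s : ℕ) :=
      lengthBound_le hd (hlt J (by omega)) (by
        have := Nat.size_pos.2 hN
        rw [hs, wordSize]; omega)
    refine (ert_listLoop_le hd hb0 (κ := w * (11 * (s + 1) ^ 2 : ℕ))
      (κ' := w * (10 * (s + 1) ^ 2 : ℕ)) ?_ fun j hj acc => ?_).trans (by gcongr)
    · refine (add_le_add_left (hw 1) _).trans ?_
      rw [← mul_add, ← Nat.cast_add]
      gcongr
      nlinarith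
    · refine bounded_listBody hw hd hbd (fun x hx => hlt x ?_) acc
      have := Nat.mul_le_mul_right d hj
      -- For `N < d` one has `N' = d - 1`, so only the index `0` is possible; otherwise `j d ≤ N +
      -- d` is good enough.
      rcases lt_or_ge N d with h | h
      · have h0 : J = 0 := by
          rw [hJdef, roundUp, Nat.div_eq_of_lt h]
          exact Nat.div_eq_of_lt (by omega)
        rw [h0] at this
        omega
      · omega
  have h1 := (takes_div (hlt N (by omega)) (hlt d (by omega))).runs hw
  have h2 := (takes_mul (hlt (N / d) (by omega)) (hlt d (by omega))).runs hw
  have h3 := (takes_add (hlt (N / d * d) (by omega)) (hlt (d - 1) (by omega))).runs hw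
  have h4 := (takes_sub (hlt (roundUp d N) (by omega)) (hlt b (by omega))).runs hw
  have h5 := (takes_div (hlt (roundUp d N - b) (by omega)) (hlt d (by omega))).runs hw
  have hsub := sub_loop (sub_listBody d b) (J, [])
  have e5 := h5.ert_bind_le (f := fun J => loop (listBody d b) (J, [])) hsub
    (fun l => C * (l.length : ℝ≥0∞) ^ 2 + B * l.length + A)
  have s5 : ((div (roundUp d N - b) d).bind fun J => loop (listBody d b) (J, [])).IsSub :=
    (sub_charge _ _).bind fun _ => sub_loop (sub_listBody d b) _
  have e4 := h4.ert_bind_le (f := fun x => (div x d).bind fun J => loop (listBody d b) (J, [])) s5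
    (fun l => C * (l.length : ℝ≥0∞) ^ 2 + B * l.length + A)
  have s4 := IsSub.bind (m := RandComp.sub (roundUp d N) b)
    (f := fun x => (div x d).bind fun J => loop (listBody d b) (J, [])) (sub_charge _ _)
    fun _ => (sub_charge _ _).bind fun _ => sub_loop (sub_listBody d b) _
  have e3 := h3.ert_bind_le (f := fun N' => (RandComp.sub N' b).bind fun x =>
    (div x d).bind fun J => loop (listBody d b) (J, [])) s4
    (fun l => C * (l.length : ℝ≥0∞) ^ 2 + B * l.length + A)
  have s3 := IsSub.bind (m := add (N / d * d) (d - 1)) (f := fun N' => (RandComp.sub N' b).bind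
    fun x => (div x d).bind fun J => loop (listBody d b) (J, [])) (sub_charge _ _)
    fun _ => (sub_charge _ _).bind fun _ => (sub_charge _ _).bind fun _ =>
      sub_loop (sub_listBody d b) _
  have e2 := h2.ert_bind_le (f := fun kd => (add kd (d - 1)).bind fun N' =>
    (RandComp.sub N' b).bind fun x => (div x d).bind fun J => loop (listBody d b) (J, [])) s3
    (fun l => C * (l.length : ℝ≥0∞) ^ 2 + B * l.length + A)
  have s2 := IsSub.bind (m := mul (N / d) d) (f := fun kd => (add kd (d - 1)).bind fun N' =>
    (RandComp.sub N' b).bind fun x => (div x d).bind fun J => loop (listBody d b) (J, []))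
    (sub_charge _ _) fun _ => (sub_charge _ _).bind fun _ => (sub_charge _ _).bind fun _ =>
      (sub_charge _ _).bind fun _ => sub_loop (sub_listBody d b) _
  have e1 := h1.ert_bind_le (f := fun k => (mul k d).bind fun kd => (add kd (d - 1)).bind fun N' =>
    (RandComp.sub N' b).bind fun x => (div x d).bind fun J => loop (listBody d b) (J, [])) s2
    (fun l => C * (l.length : ℝ≥0∞) ^ 2 + B * l.length + A)
  refine e1.trans ((add_le_add_right (e2.trans (add_le_add_right (e3.trans (add_le_add_right
    (e4.trans (add_le_add_right (e5.trans (add_le_add_right hloop _)) _)) _)) _)) _).trans ?_)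
  simp only [← add_assoc, ← mul_add, ← Nat.cast_add]
  gcongr
  nlinarith

/-! ## Multiplying by the prime entries -/

/-- The result of `multiplyByPrimes`. -/
def multiplyByPrimesValue (x : ℕ × List (ℕ × ℕ)) (l : List ℕ) : ℕ × List (ℕ × ℕ) :=
  l.foldl (fun x s => if s.Prime then multiplyByValue x s else x) x

theorem bitLength_multiplyByPrimesValue_le {s : ℕ} {l : List ℕ} (hl : ∀ p ∈ l, p < 2 ^ s)
    (x : ℕ × List (ℕ × ℕ)) :
    bitLength (multiplyByPrimesValue x l) ≤ bitLength x + l.length * (2 * s + 1) := by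
  induction l generalizing x with
  | nil => simp [multiplyByPrimesValue]
  | cons p l ih =>
    have ih := ih (fun q hq => hl q (by simp [hq])) (if p.Prime then multiplyByValue x p else x)
    have h1 : bitLength (if p.Prime then multiplyByValue x p else x) ≤
        bitLength x + (2 * s + 1) := by
      split_ifs
      · have := Nat.size_le.2 (hl p (by simp))
        exact (bitLength_multiplyByValue_le x p).trans (by omega)
      · omega
    rw [List.length_cons, add_mul]
    change bitLength (multiplyByPrimesValue (if p.Prime then multiplyByValue x p else x) l) ≤ _
    omega

/-- The product may far exceed `N`, but each factor adds only `O(s)` bits. Measuring the state by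
`bitLength` therefore gives a cost quadratic in the length of the list. -/
theorem runs_multiplyByPrimes {M : ℕ} (h : CostBound P g M w τ σ) {s : ℕ} {l : List ℕ}
    (hl : ∀ p ∈ l, p ≤ M) (hl' : ∀ p ∈ l, p < 2 ^ s) (x : ℕ × List (ℕ × ℕ)) :
    Runs g (multiplyByPrimes P x l) (multiplyByPrimesValue x l)
      (l.length * (w + (τ + w * ((bitLength x + l.length * (2 * s + 1) + 4) * (s + 2) : ℕ))) +
        w) := by
  have key := runs_foldList h.time (k := τ + w *
      ((bitLength x + l.length * (2 * s + 1) + 4) * (s + 2) : ℕ))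
    (f := fun x s => (primalityTest P s).bind fun isPrime =>
      if isPrime then multiplyBy x s else ret x) l (fun i => multiplyByPrimesValue x (l.take i)) ?_
  · simpa [multiplyByPrimes, multiplyByPrimesValue] using key
  intro i hi
  have hmem : l[i] ∈ l := List.getElem_mem hi
  have htake : multiplyByPrimesValue x (l.take (i + 1)) =
      if l[i].Prime then multiplyByValue (multiplyByPrimesValue x (l.take i)) l[i]
      else multiplyByPrimesValue x (l.take i) := by
    rw [List.take_succ_eq_append_getElem hi, multiplyByPrimesValue, List.foldl_append]
    rfl
  have hlen : bitLength (multiplyByPrimesValue x (l.take i)) ≤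
      bitLength x + l.length * (2 * s + 1) := by
    refine (bitLength_multiplyByPrimesValue_le
      (fun p hp => hl' p (List.mem_of_mem_take hp)) x).trans ?_
    gcongr
    simp
  rw [htake]
  refine (h.runs_primalityTest (hl _ hmem)).bind ?_
  by_cases hp : l[i].Prime
  · simp only [hp, decide_true, if_true]
    refine ((takes_multiplyBy _ _).runs h.time).mono ?_
    have := Nat.size_le.2 (hl' _ hmem)
    gcongr
  · simp only [hp, decide_false, Bool.false_eq_true, if_false]
    exact (runs_ret _).mono zero_le

/-- The effect of one list on an affine bound for the remaining cost. -/
theorem ert_listStep_le (h : CostBound P g (N + d) w τ σ) (hd : 0 < d) (hN : 1 ≤ N) {b : ℕ}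
    (hb : b ∈ residues d) (x : ℕ × List (ℕ × ℕ)) (A B : ℝ≥0∞) :
    ert g ((generateList d N b).bind fun l => multiplyByPrimes P x l)
      (fun y => A + B * bitLength y) ≤
      (A + (w * (140 * (wordSize d N + 2) ^ 4 : ℕ) + τ * (5 * (wordSize d N + 2) : ℕ)) +
        (10 * (wordSize d N + 2) ^ 2 : ℕ) * B) +
        (B + w * (5 * (wordSize d N + 2) ^ 2 : ℕ)) * bitLength x := by
  set s := wordSize d N with hs
  have hlt : ∀ x ≤ 2 * (N + d), x < 2 ^ s := fun x hx => lt_two_pow_wordSize hN hx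
  have h1 := ert_bind_le (g := g) (generateList d N b) (f := fun l => multiplyByPrimes P x l)
    (fun l => sub_multiplyByPrimes P x l) (fun y => A + B * bitLength y)
  -- Collect the cost and the remaining affine bound into a quadratic polynomial in the list length,
  -- the form that `ert_generateList_le` integrates.
  have h2 : ert g (generateList d N b)
      (fun l => ert g (multiplyByPrimes P x l) fun y => A + B * bitLength y) ≤
      ert g (generateList d N b) fun l => (w * ((2 * s + 1) * (s + 2) : ℕ)) * (l.length : ℝ≥0∞) ^ 2 +
        (w + τ + w * ((bitLength x + 4) * (s + 2) : ℕ) + B * (2 * s + 1 : ℕ)) * l.length +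
        (w + A + B * bitLength x) := by
    refine ert_mono (allOut_generateList hd N (pos_of_mem_residues hb)) fun l hl => ?_
    have hl1 : ∀ p ∈ l, p ≤ N + d := fun p hp =>
      (hl.le hd hN hb p hp).trans (roundUp_le d N)
    have hl2 : ∀ p ∈ l, p < 2 ^ s := fun p hp => hlt p (by have := hl1 p hp; omega)
    refine ((runs_multiplyByPrimes h hl1 hl2 x).ert_le _).trans ?_
    have h3 : (bitLength (multiplyByPrimesValue x l) : ℝ≥0∞) ≤
        (bitLength x + l.length * (2 * s + 1) : ℕ) := by
      exact_mod_cast bitLength_multiplyByPrimesValue_le hl2 x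
    refine (add_le_add_right (add_le_add_right (mul_le_mul_right h3 B) A) _).trans (le_of_eq ?_)
    push_cast
    ring
  refine h1.trans (h2.trans ((ert_generateList_le h.time hd hN hb _ _ _).trans ?_))
  rw [← hs]
  calc _ = (A + (w * (5 * (s + 1) ^ 2 + (2 * s + 1) * (s + 2) * (5 * s) ^ 2 +
          (1 + 4 * (s + 2) + 11 * (s + 1) ^ 2) * (5 * s) + 1 : ℕ) + τ * (5 * s : ℕ)) +
        ((2 * s + 1) * (5 * s) : ℕ) * B) +
        (B + w * ((s + 2) * (5 * s) : ℕ)) * bitLength x := by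
        push_cast
        ring
    _ ≤ _ := by
        have hw' : 5 * (s + 1) ^ 2 + (2 * s + 1) * (s + 2) * (5 * s) ^ 2 +
            (1 + 4 * (s + 2) + 11 * (s + 1) ^ 2) * (5 * s) + 1 ≤ 140 * (s + 2) ^ 4 := by
          obtain ⟨S, hS⟩ : ∃ S, S = s + 2 := ⟨_, rfl⟩
          have a1 : s ≤ S := by omega
          have a2 : 1 ≤ S := by omega
          have b3 : S ^ 2 ≤ S ^ 4 := Nat.pow_le_pow_right a2 (by omega)
          have b4 : S ^ 3 ≤ S ^ 4 := Nat.pow_le_pow_right a2 (by omega)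
          have b1 : 1 ≤ S ^ 4 := Nat.one_le_pow _ _ a2
          have b2 : S ≤ S ^ 4 := Nat.le_self_pow (by omega) S
          calc _ ≤ 5 * S ^ 2 + (2 * S) * S * (5 * S) ^ 2 +
                (1 + 4 * S + 11 * S ^ 2) * (5 * S) + 1 := by
                gcongr <;> omega
            _ = 50 * S ^ 4 + 55 * S ^ 3 + 25 * S ^ 2 + 5 * S + 1 := by ring
            _ ≤ 140 * S ^ 4 := by omega
            _ = _ := by rw [hS]
        have hτ' : 5 * s ≤ 5 * (s + 2) := by omega
        have hB' : (2 * s + 1) * (5 * s) ≤ 10 * (s + 2) ^ 2 := by nlinarith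
        have hb' : (s + 2) * (5 * s) ≤ 5 * (s + 2) ^ 2 := by nlinarith
        gcongr

end

end FactoredIdeals

namespace FactoredIdeals

universe u v w

section

variable {P : Prices} {g : Cost →+ ℝ≥0∞} {w τ σ : ℝ≥0∞} {d N : ℕ}

/-! ## The expected cost of steps 1 to 3 -/

/-- The class of bounds `A + B * len` is stable under each step: backwards, `B` grows by `θ` and `A`
by `ε + η * B`. With at most `n` steps all slopes stay below `Bmax`. -/
theorem ert_foldList_affine {α : Type*} {β : Type*} (hw : ∀ t : ℕ, g ⟨0, 0, t⟩ ≤ w * t)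
    {f : β → α → RandComp β} (hf : ∀ b a, (f b a).IsSub) (len : β → ℕ) {l : List α} {n : ℕ}
    (hn : l.length ≤ n) {ε η θ β₀ Bmax : ℝ≥0∞} (hB : β₀ + n * θ ≤ Bmax)
    (h : ∀ a ∈ l, ∀ x A B, B ≤ Bmax → ert g (f x a) (fun y => A + B * len y) ≤
      (A + ε + η * B) + (B + θ) * len x) (x : β) (A : ℝ≥0∞) :
    ert g (foldList f x l) (fun y => A + β₀ * len y) ≤
      (A + w + n * (w + ε + η * Bmax)) + (β₀ + n * θ) * len x := by
  have key : ert g (foldList f x l) (fun y => A + β₀ * len y) ≤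
      (A + w + l.length * (w + ε + η * Bmax)) + (β₀ + l.length * θ) * len x := by
    induction l generalizing x with
    | nil =>
      refine (ert_pay ..).trans_le ((add_le_add_left (hw 1) _).trans (le_of_eq ?_))
      simp only [List.length_nil, Nat.cast_zero, Nat.cast_one]
      ring
    | cons a l ih =>
      have hn' : l.length ≤ n := le_trans (by simp) hn
      have ih := fun x => ih hn' (fun a ha => h a (by simp [ha])) x
      rw [foldList, charge]
      refine (ert_bind_pay (f := fun b => (f b a).bind fun b' => foldList f b' l) _ _
        ((hf x a).bind fun b' => sub_foldList hf l b') _).trans ?_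
      have h1 := (ert_bind_le (g := g) (f x a) (fun b' => sub_foldList hf l b')
        (fun y => A + β₀ * len y)).trans (ert_mono' _ ih)
      have hB' : β₀ + l.length * θ ≤ Bmax := le_trans (by gcongr) hB
      have h2 := h1.trans (h a (by simp) x _ _ hB')
      refine (add_le_add (hw 1) h2).trans ?_
      rw [List.length_cons]
      push_cast
      calc _ ≤ w * 1 + ((A + w + l.length * (w + ε + η * Bmax)) + ε + η * Bmax +
            (β₀ + l.length * θ + θ) * len x) := by gcongr
        _ = _ := by ring
  exact key.trans (by gcongr)

/-- The expected number of passes is `p ≤ d`. The slope `γ` charges each bit for `p` passes, and the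
last term of the constant pays for the at most `2 * d + 1` bits added per pass. -/
theorem ert_multiplySmall_le (hw : ∀ t : ℕ, g ⟨0, 0, t⟩ ≤ w * t) {p : ℕ} (hp : p.Prime)
    (hpd : p ≤ d) (x : ℕ × List (ℕ × ℕ)) (A B : ℝ≥0∞) :
    ert g (multiplySmall p x) (fun y => A + B * bitLength y) ≤
      (A + p * (w * (7 * d + 11 : ℕ)) + p * (B + p * (w * (d + 2 : ℕ))) * (2 * d + 1 : ℕ)) +
        (B + p * (w * (d + 2 : ℕ))) * bitLength x := by
  set γ : ℝ≥0∞ := B + p * (w * (d + 2 : ℕ)) with hγ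
  set a : ℝ≥0∞ := A + p * (w * (7 * d + 11 : ℕ)) + p * γ * (2 * d + 1 : ℕ) with ha
  have hp2 : p < 2 ^ d := hpd.trans_lt Nat.lt_two_pow_self
  have hsub : ∀ x : ℕ × List (ℕ × ℕ), ((uniform p).bind fun y => (RandComp.eq y 0).bind fun failure =>
      if failure then ret (Sum.inr x) else (multiplyBy x p).bind fun x' =>
        ret (Sum.inl x' : (ℕ × List (ℕ × ℕ)) ⊕ (ℕ × List (ℕ × ℕ)))).IsSub := fun x =>
    (sub_uniform p).bind fun _ => (sub_charge _ _).bind fun _ =>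
      sub_ite (sub_ret _) ((sub_multiplyBy x p).bind fun _ => sub_ret _)
  refine ert_loop_le (Φ := fun x => a + γ * bitLength x) hsub (fun _ => True)
    (fun x _ => fun y c _ => by rcases y with y | y <;> trivial) (fun x _ => ?_) trivial
  have hbound : Bounded g ((uniform p).bind fun y => (RandComp.eq y 0).bind fun failure =>
      if failure then ret (Sum.inr x) else (multiplyBy x p).bind fun x' =>
        ret (Sum.inl x' : (ℕ × List (ℕ × ℕ)) ⊕ (ℕ × List (ℕ × ℕ)))) (fun _ => True)
      (w * (d + 1 : ℕ) + (w * (2 * d + 1 : ℕ) + w * ((bitLength x + 4) * (d + 2) : ℕ))) := by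
    refine (bounded_uniform hw hp2).bind fun y hy => ?_
    refine ((takes_eq (hy.trans hp2) (Nat.two_pow_pos d)).bounded hw).bind fun b _ => ?_
    rcases b with _ | _
    · simp only [Bool.false_eq_true, if_false]
      have := Nat.size_le.2 hp2
      rw [← add_zero (w * ((bitLength x + 4) * (d + 2) : ℕ))]
      refine (((takes_multiplyBy x p).mono (t' := (bitLength x + 4) * (d + 2)) (by gcongr)).bounded
        hw).bind fun y _ => ?_
      exact (runs_ret _).bounded.mono (fun _ _ => trivial) le_rfl
    · simp only [if_true]
      exact (runs_ret _).bounded.mono (fun _ _ => trivial) zero_le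
  refine (add_le_add (hw 1) (hbound.ert_le (hsub x) _)).trans ?_
  obtain ⟨n, rfl⟩ : ∃ n, p = n + 1 := ⟨p - 1, by have := hp.pos; omega⟩
  simp only [mean_bind, mean_uniform, RandComp.eq, mean_charge]
  rw [Finset.sum_range_succ']
  simp only [Nat.add_eq_zero_iff, one_ne_zero, and_false, decide_false, Bool.false_eq_true,
    if_false, mean_bind, mean_multiplyBy, mean_ret, Sum.elim_inl, decide_true, if_true,
    Sum.elim_inr, Finset.sum_const, Finset.card_range, nsmul_eq_mul]
  have hk0 : ((n + 1 : ℕ) : ℝ≥0∞) ≠ 0 := by simp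
  have hkt : ((n + 1 : ℕ) : ℝ≥0∞) ≠ ⊤ := ENNReal.natCast_ne_top _
  rw [← ENNReal.mul_le_mul_iff_right hk0 hkt, mul_add, mul_add, ← mul_assoc _ _⁻¹,
    ENNReal.mul_inv_cancel hk0 hkt, one_mul]
  have hlen : (bitLength (multiplyByValue x (n + 1)) : ℝ≥0∞) ≤ (bitLength x + (2 * d + 1) : ℕ) := by
    have h1 := bitLength_multiplyByValue_le x (n + 1)
    have h2 := Nat.size_le.2 hp2
    exact_mod_cast h1.trans (by omega)
  calc _ ≤ ((n + 1 : ℕ) : ℝ≥0∞) * (w * (1 : ℕ)) + (((n + 1 : ℕ) : ℝ≥0∞) * (w * (d + 1 : ℕ) +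
        (w * (2 * d + 1 : ℕ) + w * ((bitLength x + 4) * (d + 2) : ℕ))) +
        (n * (a + γ * (bitLength x + (2 * d + 1) : ℕ)) + (A + B * bitLength x))) := by gcongr
    _ ≤ _ + γ * (2 * d + 1 : ℕ) := le_self_add
    _ = n * (a + γ * bitLength x) + ((A + (n + 1 : ℕ) * (w * (7 * d + 11 : ℕ)) +
        (n + 1 : ℕ) * γ * (2 * d + 1 : ℕ)) + (B + (n + 1 : ℕ) * (w * (d + 2 : ℕ))) *
        bitLength x) := by
      push_cast
      ring
    _ = n * (a + γ * bitLength x) + (a + γ * bitLength x) := by rw [← ha, ← hγ]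
    _ = _ := by push_cast; ring

theorem ert_smallStep_le (h : CostBound P g (N + d) w τ σ) {p : ℕ} (hpd : p ≤ d)
    (x : ℕ × List (ℕ × ℕ)) (A B : ℝ≥0∞) :
    ert g ((primalityTest P p).bind fun isPrime => if isPrime then multiplySmall p x else ret x)
      (fun y => A + B * bitLength y) ≤
      (A + (τ + w * (d * (7 * d + 11) + d * (d * (d + 2) * (2 * d + 1)) : ℕ)) +
        (d * (2 * d + 1) : ℕ) * B) + (B + w * (d * (d + 2) : ℕ)) * bitLength x := by
  refine ((h.runs_primalityTest (show p ≤ N + d by omega)).ert_bind_le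
    (sub_ite (sub_multiplySmall p x) (sub_ret x)) _).trans ?_
  by_cases hp : p.Prime
  · simp only [hp, decide_true, if_true]
    refine (add_le_add_right (ert_multiplySmall_le h.time hp hpd x A B) _).trans ?_
    have hp' : (p : ℝ≥0∞) ≤ d := by exact_mod_cast hpd
    calc _ ≤ τ + ((A + d * (w * (7 * d + 11 : ℕ)) + d * (B + d * (w * (d + 2 : ℕ))) *
          (2 * d + 1 : ℕ)) + (B + d * (w * (d + 2 : ℕ))) * bitLength x) := by gcongr
      _ = _ := by push_cast; ring
  · simp only [hp, decide_false, Bool.false_eq_true, if_false, ret, ert_pay, map_zero, zero_add]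
    calc _ ≤ (τ + (A + B * bitLength x)) + (w * (d * (7 * d + 11) + d * (d * (d + 2) *
          (2 * d + 1)) : ℕ) + (d * (2 * d + 1) : ℕ) * B + w * (d * (d + 2) : ℕ) *
          bitLength x) := le_self_add
      _ = _ := by ring

theorem length_residues_le (hd : 0 < d) : (residues d).length ≤ d := by
  refine (List.length_filter_le _ _).trans ?_
  rw [List.length_range']
  omega

/-- The final potential is affine in the bit length, to match the comparison `r ≤ N` in step 4. The
constant depends on `d` only and serves all prices and cost measures. -/
theorem exists_ert_generate_le (hd : 0 < d) : ∃ c : ℕ, ∀ {P : Prices} {g : Cost →+ ℝ≥0∞}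
    {w τ σ : ℝ≥0∞} {N : ℕ}, 1 ≤ N → CostBound P g (N + d) w τ σ → ∀ A : ℝ≥0∞,
    ert g (generate P d N) (fun y => A + w * bitLength y) ≤
      A + (w * (c * (wordSize d N + 2) ^ 4 : ℕ) + τ * (c * (wordSize d N + 2) : ℕ)) := by
  set e := d * (7 * d + 11) + d * (d * (d + 2) * (2 * d + 1)) with he
  set b := 1 + d * (d * (d + 2)) with hb
  refine ⟨(1 + d * (1 + e + d * (2 * d + 1) * b) + 1 + d + b) + (d * 10 * b + 5 * d) +
    (d * 140 + d * 50 * d) + 6 * d, fun {P g w τ σ N} hN h A => ?_⟩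
  set S := wordSize d N + 2 with hS
  have hS1 : 1 ≤ S := by omega
  have h2 : ∀ x, ert g (foldList (fun x p => (primalityTest P p).bind fun isPrime =>
      if isPrime then multiplySmall p x else ret x) x (List.range' 2 (d - 1)))
      (fun y => A + w * bitLength y) ≤
      (A + w + d * (w + (τ + w * (e : ℕ)) + (d * (2 * d + 1) : ℕ) * (w * b))) +
        (w + d * (w * (d * (d + 2) : ℕ))) * bitLength x := fun x => by
    refine ert_foldList_affine h.time (fun x p => sub_smallStep P p x) bitLength
      (by rw [List.length_range']; omega) (Bmax := w * b) (le_of_eq ?_) (fun p hp x A B _ => ?_) x A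
    · rw [hb]; push_cast; ring
    · exact ert_smallStep_le h (by have := List.mem_range'_1.1 hp; omega) x A B
  have h1 := ert_foldList_affine h.time (fun x b => sub_listStep P d N b x) bitLength
    (length_residues_le hd) (β₀ := w + d * (w * (d * (d + 2) : ℕ)))
    (ε := w * (140 * S ^ 4 : ℕ) + τ * (5 * S : ℕ))
    (η := (10 * S ^ 2 : ℕ)) (θ := w * (5 * S ^ 2 : ℕ)) (Bmax := w * (b + d * (5 * S ^ 2) : ℕ))
    (le_of_eq (by rw [hb]; push_cast; ring))
    (fun b hb x A B _ => ert_listStep_le h hd hN hb x A B) (1, [])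
    (A + w + d * (w + (τ + w * (e : ℕ)) + (d * (2 * d + 1) : ℕ) * (w * b)))
  have hlen : bitLength (1, []) = 1 := by simp [bitLength]
  rw [hlen] at h1
  refine (ert_bind_le _ (fun x => sub_foldList (fun x p => sub_smallStep P p x) _ x) _).trans
    ((ert_mono' _ h2).trans (h1.trans ?_))
  have b1 : 1 ≤ S ^ 4 := Nat.one_le_pow _ _ hS1
  have b2 : S ^ 2 ≤ S ^ 4 := Nat.pow_le_pow_right hS1 (by omega)
  have hw' : (1 + d * (1 + e + d * (2 * d + 1) * b) + 1 + d + b) + (d * 10 * b + 5 * d) * S ^ 2 +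
      (d * 140 + d * 50 * d) * S ^ 4 ≤
      ((1 + d * (1 + e + d * (2 * d + 1) * b) + 1 + d + b) + (d * 10 * b + 5 * d) +
        (d * 140 + d * 50 * d) + 6 * d) * S ^ 4 := by
    calc _ ≤ (1 + d * (1 + e + d * (2 * d + 1) * b) + 1 + d + b) * S ^ 4 +
          (d * 10 * b + 5 * d) * S ^ 4 + (d * 140 + d * 50 * d) * S ^ 4 := by
          gcongr
          exact Nat.le_mul_of_pos_right _ b1
      _ ≤ _ := by rw [add_mul _ (6 * d), add_mul _ (d * 140 + _), add_mul _ (d * 10 * b + _)]; omega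
  have hτ' : d + 5 * d * S ≤ ((1 + d * (1 + e + d * (2 * d + 1) * b) + 1 + d + b) +
      (d * 10 * b + 5 * d) + (d * 140 + d * 50 * d) + 6 * d) * S := by
    rw [add_mul _ (6 * d)]
    have : d ≤ d * S := Nat.le_mul_of_pos_right _ hS1
    nlinarith [Nat.zero_le (((1 + d * (1 + e + d * (2 * d + 1) * b) + 1 + d + b) +
      (d * 10 * b + 5 * d) + (d * 140 + d * 50 * d)) * S)]
  calc _ = A + (w * ((1 + d * (1 + e + d * (2 * d + 1) * b) + 1 + d + b) +
        (d * 10 * b + 5 * d) * S ^ 2 + (d * 140 + d * 50 * d) * S ^ 4 : ℕ) +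
        τ * (d + 5 * d * S : ℕ)) := by
        rw [hb]
        push_cast
        ring
    _ ≤ _ := by gcongr

end

end FactoredIdeals

namespace FactoredIdeals

universe u v w

section

variable {K : Type u} [Field K] [NumberField K] {P : Prices} {g : Cost →+ ℝ≥0∞}
  {w τ σ : ℝ≥0∞} {N : ℕ}

/-! ## The expected cost of one round -/

theorem IsFactorizationOf.length_le {l : List (ℕ × ℕ)} {r : ℕ} (hl : IsFactorizationOf l r)
    (hrN : r ≤ N) : l.length ≤ N.size := by
  have h1 : 2 ^ l.length ≤ (l.map fun q => q.1 ^ q.2).prod := by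
    have := List.pow_card_le_prod (l.map fun q => q.1 ^ q.2) 2 fun x hx => by
      obtain ⟨q, hq, rfl⟩ := List.mem_map.1 hx
      exact (hl.prime hq).two_le.trans (Nat.le_self_pow (hl.2.1 q hq).2.ne' _)
    simpa using this
  rw [hl.2.2] at h1
  exact (Nat.pow_lt_pow_iff_right (by norm_num)).1
    ((h1.trans hrN).trans_lt (Nat.lt_size_self N)) |>.le

theorem sub_acceptStep_of_isValid {x : ℕ × List (ℕ × ℕ)} (hx : IsValid x) :
    (acceptStep K P (Module.finrank ℚ K) N x).IsSub := by
  rw [IsSub]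
  rcases le_or_gt x.1 N with h | h
  · obtain ⟨r, l⟩ := x
    rw [mean_acceptStep hx h]
    have h1 := acceptProb_mem (K := K) (Nat.one_le_iff_ne_zero.2 (IsFactorizationOf.ne_zero hx)) h
    rw [mul_one, mul_one, ← ENNReal.ofReal_add h1.1 (by linarith [h1.2])]
    simp
  · rw [mean_acceptStep_of_lt h]

/-- Only the comparison with `N` sees a possibly huge `r`. After it `r ≤ N`, so there are at most
`N.size` prime factors, one factorization of `p𝓞_K` for each. -/
theorem ert_acceptStep_le (h : CostBound P g (N + Module.finrank ℚ K) w τ σ) (hN : 1 ≤ N)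
    {x : ℕ × List (ℕ × ℕ)} (hx : IsValid x) :
    ert g (acceptStep K P (Module.finrank ℚ K) N x) (fun _ => 0) ≤
      (w * (46 * ((Module.finrank ℚ K + 2) ^ 2 * N.size + 1) ^ 4 : ℕ) +
        Module.finrank ℚ K * τ + N.size * σ) + w * bitLength x := by
  set d := Module.finrank ℚ K with hd
  have hd0 : 0 < d := finrank_pos' K
  set s := (d + 2) ^ 2 * N.size with hs
  have hZs : N.size ≤ s := Nat.le_mul_of_pos_left _ (by positivity)
  obtain ⟨b1, b2, b3, b4⟩ := bit_bounds hd0 hN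
  rw [← hs] at b1 b2 b3 b4
  have hsize : x.1.size ≤ bitLength x := by rw [bitLength]; exact Nat.le_add_right _ _
  have hfit : Bounded g (le x.1 N) (fun y => y = decide (x.1 ≤ N))
      (w * (bitLength x + N.size + 1 : ℕ)) :=
    (takes_charge (by gcongr) _).bounded h.time
  have key : Bounded g (acceptStep K P d N x) (fun _ => True)
      (w * (bitLength x + N.size + 1 : ℕ) + ((w * (10 * (s + 1) ^ 3 : ℕ) + d * τ) +
        ((N.size * (w + (σ + w * (30 * (s + 1) ^ 3 : ℕ))) + w) +
          (w * (s + 1 : ℕ) + (w * (2 * s + 1 : ℕ) + 0))))) := by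
    refine hfit.bind ?_
    rintro _ rfl
    by_cases hxN : x.1 ≤ N
    · simp only [hxN, decide_true, if_true]
      refine (runs_baseDenominator h hd0 (Nat.le_add_left _ _) b1 b2 b3).bounded.bind ?_
      rintro _ rfl
      have hbase := baseValue_pos (K := K) (N := N) hN
      have hratio := (runs_acceptanceRatio (K := K) h hx hxN (Nat.le_add_right _ _) hbase b4).bounded
      have hlen : (x.2.length : ℝ≥0∞) ≤ N.size := by
        exact_mod_cast IsFactorizationOf.length_le hx hxN
      have hden : baseValue d N * (x.2.map (denominatorFactor K)).prod < 2 ^ s := by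
        refine lt_of_le_of_lt ?_ b4
        gcongr
        calc (x.2.map (denominatorFactor K)).prod ≤ (x.2.map fun q => q.1 ^ q.2).prod :=
              prod_map_le_prod_map _ fun q _ => Nat.pow_le_pow_left dropBase_le _
          _ = x.1 := hx.2.2
          _ ≤ N := hxN
          _ ≤ N ^ (d + 2) := Nat.le_self_pow (by omega) _
      refine (hratio.mono (fun _ h => h) (by gcongr)).bind ?_
      rintro _ rfl
      refine (bounded_uniform h.time hden).bind fun t ht => ?_
      refine ((takes_le ((prod_numeratorFactor_le hx hxN).trans_lt hden)
        (ht.trans hden)).bounded h.time).bind fun y _ => ?_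
      exact (runs_ret _).bounded.mono (fun _ _ => trivial) le_rfl
    · simp only [hxN, decide_false, Bool.false_eq_true, if_false]
      exact (runs_ret _).bounded.mono (fun _ _ => trivial) zero_le
  refine (key.ert_le (sub_acceptStep_of_isValid hx) _).trans ?_
  rw [show (fun _ : Option (FactoredNorm K) => (0 : ℝ≥0∞)) = fun _ => 0 * 1 by simp,
    mean_const_mul, zero_mul, add_zero]
  have harith : N.size + 1 + 10 * (s + 1) ^ 3 + N.size * (1 + 30 * (s + 1) ^ 3) + 1 + (s + 1) +
      (2 * s + 1) ≤ 46 * (s + 1) ^ 4 := by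
    obtain ⟨T, hT⟩ : ∃ T, T = s + 1 := ⟨_, rfl⟩
    have c1 : 1 ≤ T := by omega
    have c2 : N.size ≤ T := by omega
    have c3 : T ≤ T ^ 4 := Nat.le_self_pow (by omega) _
    have c4 : T ^ 3 ≤ T ^ 4 := Nat.pow_le_pow_right c1 (by omega)
    calc _ ≤ T + 10 * T ^ 3 + T * (1 + 30 * T ^ 3) + 1 + T + 2 * T := by
          rw [hT]; gcongr <;> omega
      _ = 30 * T ^ 4 + 10 * T ^ 3 + 5 * T + 1 := by ring
      _ ≤ 46 * T ^ 4 := by omega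
      _ = _ := by rw [hT]
  calc _ = (w * (N.size + 1 + 10 * (s + 1) ^ 3 + N.size * (1 + 30 * (s + 1) ^ 3) + 1 + (s + 1) +
        (2 * s + 1) : ℕ) + d * τ + N.size * σ) + w * bitLength x := by push_cast; ring
    _ ≤ _ := by gcongr

variable (K) in
theorem exists_ert_round_le : ∃ c : ℕ, ∀ {P : Prices} {g : Cost →+ ℝ≥0∞} {w τ σ : ℝ≥0∞} {N : ℕ},
    1 ≤ N → CostBound P g (N + Module.finrank ℚ K) w τ σ →
      ert g (round K P N) (fun _ => 0) ≤
        w * (c * (wordSize (Module.finrank ℚ K) N + 2) ^ 4 : ℕ) +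
          (τ + σ) * (c * (wordSize (Module.finrank ℚ K) N + 2) : ℕ) := by
  obtain ⟨c, hc⟩ := exists_ert_generate_le (finrank_pos' K)
  set d := Module.finrank ℚ K with hd
  refine ⟨c + 46 * (d + 2) ^ 8 + 1, fun {P g w τ σ N} hN h => ?_⟩
  have hd0 : 0 < d := finrank_pos' K
  set S := wordSize d N + 2 with hS
  have hSZ : S = N.size + d + 3 := by rw [hS, wordSize]
  refine (ert_bind_le_of_allOut (allOut_generate P hd0 N)
    (fun x hx => sub_acceptStep_of_isValid hx) _).trans ?_
  have hstep : ∀ x, IsValid x → ert g (acceptStep K P d N x) (fun _ => 0) ≤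
      (w * (46 * ((d + 2) ^ 2 * N.size + 1) ^ 4 : ℕ) + d * τ + N.size * σ) + w * bitLength x :=
    fun x hx => ert_acceptStep_le h hN hx
  refine (ert_mono (allOut_generate P hd0 N) hstep).trans ?_
  refine (hc hN h _).trans ?_
  rw [← hS]
  have h1 : 46 * ((d + 2) ^ 2 * N.size + 1) ^ 4 + c * S ^ 4 ≤
      (c + 46 * (d + 2) ^ 8 + 1) * S ^ 4 := by
    have : (d + 2) ^ 2 * N.size + 1 ≤ (d + 2) ^ 2 * S := by
      rw [hSZ]
      nlinarith [Nat.zero_le (d * N.size)]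
    calc _ ≤ 46 * ((d + 2) ^ 2 * S) ^ 4 + c * S ^ 4 := by gcongr
      _ = (c + 46 * (d + 2) ^ 8) * S ^ 4 := by ring
      _ ≤ _ := Nat.mul_le_mul_right _ (Nat.le_succ _)
  have h2 : d + c * S ≤ (c + 46 * (d + 2) ^ 8 + 1) * S := by nlinarith [Nat.zero_le ((d + 2) ^ 8 * S)]
  have h3 : N.size ≤ (c + 46 * (d + 2) ^ 8 + 1) * S := by
    nlinarith [Nat.zero_le ((d + 2) ^ 8 * S), Nat.zero_le (c * S)]
  calc _ = w * (46 * ((d + 2) ^ 2 * N.size + 1) ^ 4 + c * S ^ 4 : ℕ) + (τ * (d + c * S : ℕ) +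
        σ * (N.size : ℕ)) := by push_cast; ring
    _ ≤ w * ((c + 46 * (d + 2) ^ 8 + 1) * S ^ 4 : ℕ) +
        (τ * ((c + 46 * (d + 2) ^ 8 + 1) * S : ℕ) + σ * ((c + 46 * (d + 2) ^ 8 + 1) * S : ℕ)) := by
        gcongr
    _ = _ := by rw [add_mul τ]

/-! ## The expected cost of the repetition of rounds -/

/-- The constant potential `t` solves `t = w + R + ρ t + k a`, where `a = 1 - ρ` is the acceptance
rate: a geometric number of rounds, and `k` is paid once at the end. -/
theorem ert_randomNorm_le (h : ∀ t : ℕ, g ⟨0, 0, t⟩ ≤ w * t) (hN : 1 ≤ N) {R : ℝ≥0∞}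
    (hR : ert g (round K P N) (fun _ => 0) ≤ R) (k : ℝ≥0∞) :
    ert g (randomNorm K P N) (fun _ => k) ≤ (w + R) * (acceptRate K N)⁻¹ + k := by
  set a := acceptRate K N with ha
  set t := (w + R) * a⁻¹ + k with ht
  refine ert_loop_le (Φ := fun _ : Unit => t) (Ψ := fun _ => k) (fun _ => sub_randomNormBody P N)
    (fun _ => True) (fun s _ => fun x c _ => by rcases x with x | x <;> trivial)
    (fun s _ => ?_) trivial
  refine (add_le_add (h 1) (ert_bind_le _ (fun _ => sub_ret _) _)).trans ?_
  have h0 : ∀ x : Option (FactoredNorm K), ert g (ret (x.elim (Sum.inl ()) fun r => Sum.inr r :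
      Unit ⊕ FactoredNorm K)) (Sum.elim (fun _ => t) fun _ => k) = x.elim t fun _ => k := by
    intro x
    rcases x with _ | x <;> simp [ret, ert_pay]
  have h2 : (round K P N).mean (fun x => x.elim 0 fun _ => k) = k * a := by
    rw [ha, ← mean_round_accept P N, ← mean_const_mul]
    congr 1
    funext x
    rcases x with _ | x <;> simp
  simp only [h0]
  rw [ert_eq_add, mean_round_split, h2]
  set ρ := (round K P N).mean fun x => x.elim 1 fun _ => 0 with hρ
  have h3 : ρ + a = 1 := mean_round_reject P N
  have h4 : a * a⁻¹ = 1 := ENNReal.mul_inv_cancel (acceptRate_pos hN) (acceptRate_ne_top N)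
  calc _ ≤ w * (1 : ℕ) + (R + (ρ * t + k * a)) := by gcongr
    _ = ρ * t + ((w + R) * 1 + k * a) := by push_cast; ring
    _ = ρ * t + ((w + R) * (a * a⁻¹) + k * a) := by rw [h4]
    _ = ρ * t + a * t := by rw [ht]; ring
    _ = t := by rw [← add_mul, h3, one_mul]

end

end FactoredIdeals

namespace FactoredIdeals

universe u v w

section

variable {K : Type u} [Field K] [NumberField K] {P : Prices} {g : Cost →+ ℝ≥0∞}
  {w τ σ : ℝ≥0∞} {N : ℕ}

/-! ## The cost of the choice of the ideal -/

theorem length_degreesAbove_le {p : ℕ} (hp : p.Prime) :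
    (degreesAbove K p).length ≤ Module.finrank ℚ K :=
  (List.length_le_sum_of_one_le _ (degreesAbove_pos hp)).trans (sum_degreesAbove_le hp)

theorem bounded_pickStep (hw : ∀ t : ℕ, g ⟨0, 0, t⟩ ≤ w * t) {p e S : ℕ} (hp : p.Prime)
    (hS : e + Module.finrank ℚ K + 2 ≤ S) (acc : List (Ideal (𝓞 K) × ℕ)) :
    Bounded g (pickStep acc (toPrimePower K (p, e))) (fun _ => True)
      (w * ((10 * Module.finrank ℚ K + 5) * S ^ (Module.finrank ℚ K + 2) : ℕ)) := by
  obtain ⟨d, hd⟩ : ∃ d, Module.finrank ℚ K = d := ⟨_, rfl⟩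
  rw [hd] at hS ⊢
  have hlen : (degreesAbove K p).length ≤ d := hd ▸ length_degreesAbove_le hp
  have hlen' : (splittingData K p).length ≤ d := by simpa [degreesAbove] using hlen
  have hS1 : 1 ≤ S := by omega
  have hsols : Takes (solutions (degreesAbove K p) e) (solutionList (degreesAbove K p) e)
      ((8 * d + 1) * S ^ (d + 2)) :=
    (takes_solutions (hd ▸ degreesAbove_mem hp) hS).mono (by gcongr)
  have hcard : (solutionList (degreesAbove K p) e).length < 2 ^ S ^ d := by
    rw [length_solutionList (degreesAbove_pos hp)]
    refine ((numSolutions_le_pow (degreesAbove_pos hp) e).trans ?_).trans_lt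
      (Nat.lt_two_pow_self (n := S ^ d))
    exact (Nat.pow_le_pow_left (by omega) _).trans (Nat.pow_le_pow_right hS1 hlen)
  have key : Bounded g (pickStep acc (toPrimePower K (p, e))) (fun _ => True)
      (w * d + (w * ((8 * d + 1) * S ^ (d + 2) : ℕ) + (w * (S ^ d + 1 : ℕ) +
        w * (S ^ d + d + 1 : ℕ)))) := by
    refine ((takes_charge hlen' _).bounded hw).bind ?_
    rintro _ rfl
    refine (hsols.bounded hw).bind ?_
    rintro _ rfl
    refine (bounded_uniform hw hcard).bind fun i hi => ?_
    have := Nat.size_le.2 (hi.trans hcard)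
    exact ((takes_charge (by gcongr; exact hlen') _).bounded hw).mono (fun _ _ => trivial) le_rfl
  refine key.mono (fun _ h => h) ?_
  have h1 : S ^ d ≤ S ^ (d + 2) := Nat.pow_le_pow_right hS1 (by omega)
  have h2 : 1 ≤ S ^ (d + 2) := Nat.one_le_pow _ _ hS1
  have h3 : d + (8 * d + 1) * S ^ (d + 2) + (S ^ d + 1) + (S ^ d + d + 1) ≤
      (10 * d + 5) * S ^ (d + 2) := by nlinarith
  calc _ = w * (d + (8 * d + 1) * S ^ (d + 2) + (S ^ d + 1) + (S ^ d + d + 1) : ℕ) := by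
        push_cast; ring
    _ ≤ _ := by gcongr

theorem bounded_pickIdeal (hw : ∀ t : ℕ, g ⟨0, 0, t⟩ ≤ w * t) {y : FactoredNorm K}
    (hy : IsAcceptable N y) :
    Bounded g (pickIdeal K y.factors) (fun _ => True) (w * ((10 * Module.finrank ℚ K + 7) *
      (wordSize (Module.finrank ℚ K) N + 2) ^ (Module.finrank ℚ K + 3) : ℕ)) := by
  obtain ⟨x, hx, hxN, -, rfl⟩ := hy
  have hx' := hx.reverse
  rw [acceptedValue_factors]
  have hstep : ∀ q ∈ x.2.reverse.map (toPrimePower K), ∀ acc : List (Ideal (𝓞 K) × ℕ),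
      Bounded g (pickStep acc q) (fun _ => True) (w * ((10 * Module.finrank ℚ K + 5) *
        (wordSize (Module.finrank ℚ K) N + 2) ^ (Module.finrank ℚ K + 2) : ℕ)) := by
    intro q hq acc
    obtain ⟨⟨p, e⟩, hpe, rfl⟩ := List.mem_map.1 hq
    have hp := hx'.prime hpe
    refine bounded_pickStep hw hp ?_ acc
    have h1 : p ^ e ≤ N :=
      (Nat.le_of_dvd (Nat.pos_of_ne_zero hx.ne_zero) (hx'.pow_dvd hpe)).trans hxN
    have h2 : e < N.size := Nat.lt_size.2 ((Nat.pow_le_pow_left hp.two_le e).trans h1)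
    rw [wordSize]
    omega
  refine (bounded_foldList hw hstep []).mono (fun _ h => h) ?_
  have hlen : x.2.length ≤ wordSize (Module.finrank ℚ K) N + 2 :=
    (IsFactorizationOf.length_le hx hxN).trans (by rw [wordSize]; omega)
  rw [List.length_map, List.length_reverse]
  have hS : 1 ≤ wordSize (Module.finrank ℚ K) N + 2 := by omega
  generalize wordSize (Module.finrank ℚ K) N + 2 = S at hlen hS ⊢
  generalize Module.finrank ℚ K = d
  have h1 : 1 ≤ S ^ (d + 3) := Nat.one_le_pow _ _ hS
  have h2 : S ≤ S ^ (d + 3) := Nat.le_self_pow (by omega) _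
  calc _ ≤ (S : ℝ≥0∞) * (w + w * ((10 * d + 5) * S ^ (d + 2) : ℕ)) + w := by gcongr
    _ = w * (S + (10 * d + 5) * S ^ (d + 3) + 1 : ℕ) := by push_cast; ring
    _ ≤ _ := by
      gcongr
      nlinarith

/-! ## The expected cost of the whole algorithm -/

variable (K) in
-- Only the cost of a round is multiplied by the expected number of rounds; the ideal is chosen
-- once, so its cost `S ^ (d + 3)` is added.
theorem exists_ert_randomIdeal_le : ∃ c : ℕ, ∀ {P : Prices} {g : Cost →+ ℝ≥0∞} {w τ σ : ℝ≥0∞}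
    {N : ℕ}, 1 ≤ N → CostBound P g (N + Module.finrank ℚ K) w τ σ →
      ert g (randomIdeal K P N) (fun _ => 0) ≤
        (w * (c * (wordSize (Module.finrank ℚ K) N + 2) ^ 4 : ℕ) +
          (τ + σ) * (c * (wordSize (Module.finrank ℚ K) N + 2) : ℕ)) * (acceptRate K N)⁻¹ +
        w * (c * (wordSize (Module.finrank ℚ K) N + 2) ^ (Module.finrank ℚ K + 3) : ℕ) := by
  obtain ⟨c, hc⟩ := exists_ert_round_le K
  refine ⟨c + 10 * Module.finrank ℚ K + 7, fun {P g w τ σ N} hN h => ?_⟩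
  set S := wordSize (Module.finrank ℚ K) N + 2 with hS
  have hS1 : 1 ≤ S := by omega
  have hsub : ∀ y, IsAcceptable N y → ((pickIdeal K y.factors).bind fun I =>
      ret (y.norm, I)).IsSub := by
    intro y hy
    rw [IsSub]
    simp only [mean_bind, mean_ret]
    exact (sub_pickIdeal_of_isAcceptable hy).le
  refine (ert_bind_le_of_allOut (allOut_randomNorm P N) hsub _).trans ?_
  have hpick : ∀ y, IsAcceptable N y → ert g ((pickIdeal K y.factors).bind fun I =>
      ret (y.norm, I)) (fun _ => 0) ≤ w * ((10 * Module.finrank ℚ K + 7) *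
        S ^ (Module.finrank ℚ K + 3) : ℕ) := by
    intro y hy
    have hb := (bounded_pickIdeal h.time hy).bind (f := fun I => ret (y.norm, I))
      (R := fun _ => True) fun I _ => (runs_ret _).bounded.mono (fun _ _ => trivial) le_rfl
    refine (hb.ert_le (hsub y hy) _).trans (le_of_eq ?_)
    simp [hS]
  refine (ert_mono (allOut_randomNorm P N) hpick).trans ?_
  refine (ert_randomNorm_le h.time hN (hc hN h) _).trans ?_
  have h1 : 1 + c * S ^ 4 ≤ (c + 10 * Module.finrank ℚ K + 7) * S ^ 4 := by
    have := Nat.one_le_pow 4 S hS1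
    nlinarith [Nat.zero_le (Module.finrank ℚ K * S ^ 4)]
  rw [← hS]
  calc _ = (w * (1 + c * S ^ 4 : ℕ) + (τ + σ) * (c * S : ℕ)) * (acceptRate K N)⁻¹ +
        w * ((10 * Module.finrank ℚ K + 7) * S ^ (Module.finrank ℚ K + 3) : ℕ) := by
        push_cast; ring
    _ ≤ _ := by
        gcongr <;> omega

end

end FactoredIdeals

namespace FactoredIdeals

universe u v w

/-! ## Asymptotic bounds -/

theorem size_le_log {N : ℕ} (hN : 2 ≤ N) : (N.size : ℝ) ≤ 3 * Real.log N := by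
  have h1 : (2 : ℝ) ^ Nat.log 2 N ≤ N := by
    exact_mod_cast Nat.pow_log_le_self 2 (by omega)
  have h2 := Real.log_le_log (by positivity) h1
  rw [Real.log_pow] at h2
  have h3 := Real.log_two_gt_d9
  have h4 : (1 : ℝ) ≤ Nat.log 2 N := by
    exact_mod_cast Nat.log_pos (by norm_num) hN
  rw [size_eq_log_succ (by omega)]
  push_cast
  nlinarith

theorem one_le_two_mul_log {N : ℕ} (hN : 2 ≤ N) : 1 ≤ 2 * Real.log N := by
  have h1 : Real.log 2 ≤ Real.log N := Real.log_le_log (by norm_num) (by exact_mod_cast hN)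
  linarith [Real.log_two_gt_d9]

/-- A bound `f = O((log m)^k)` is uniform over `m ≤ N + d`. -/
theorem exists_forall_le_log_pow {f : ℕ → ℕ} {k : ℕ}
    (hf : (fun m : ℕ => (f m : ℝ)) =O[atTop] fun m : ℕ => Real.log m ^ k) (d : ℕ) :
    ∃ C : ℝ, 0 ≤ C ∧ ∀ N : ℕ, 2 ≤ N → ∀ m ≤ N + d, (f m : ℝ) ≤ C * Real.log N ^ k := by
  obtain ⟨A, hA, h⟩ := hf.exists_pos
  obtain ⟨m₀, hm₀⟩ := eventually_atTop.1 h.bound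
  set B := ∑ m ∈ Finset.range m₀, f m with hB
  refine ⟨2 ^ k * B + A * (d + 2) ^ k, by positivity, fun N hN m hm => ?_⟩
  have h1 := one_le_two_mul_log hN
  have hlog : 0 ≤ Real.log N := by linarith
  rcases lt_or_ge m m₀ with hlt | hge
  · have h2 : (f m : ℝ) ≤ B := by
      exact_mod_cast Finset.single_le_sum (fun i _ => Nat.zero_le (f i)) (Finset.mem_range.2 hlt)
    calc (f m : ℝ) ≤ 1 * B := by linarith
      _ ≤ (2 * Real.log N) ^ k * B := by gcongr; exact one_le_pow₀ h1
      _ = 2 ^ k * B * Real.log N ^ k := by rw [mul_pow]; ring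
      _ ≤ _ := by gcongr; exact le_add_of_nonneg_right (by positivity)
  · have h2 := hm₀ m hge
    rw [Real.norm_natCast, Real.norm_eq_abs, abs_pow] at h2
    have h3 : |Real.log m| ≤ (d + 2) * Real.log N := by
      rcases Nat.eq_zero_or_pos m with rfl | hpos
      · simp only [Nat.cast_zero, Real.log_zero, abs_zero]; positivity
      · rw [abs_of_nonneg (Real.log_natCast_nonneg m)]
        -- Since `d < N ^ d`, one has `N + d ≤ N ^ (d + 1)`, which turns the shift by `d` into a
        -- constant factor of the logarithm.
        have h4 : (m : ℝ) ≤ (N : ℝ) ^ (d + 1) := by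
          have : N + d ≤ N ^ (d + 1) := by
            have h5 := Nat.lt_pow_self (n := d) (a := N) (by omega)
            rw [pow_succ]
            nlinarith
          exact_mod_cast hm.trans this
        have h5 := Real.log_le_log (by exact_mod_cast hpos) h4
        rw [Real.log_pow] at h5
        push_cast at h5
        linarith
    calc (f m : ℝ) ≤ A * |Real.log m| ^ k := h2
      _ ≤ A * ((d + 2) * Real.log N) ^ k := by gcongr
      _ = A * (d + 2) ^ k * Real.log N ^ k := by rw [mul_pow]; ring
      _ ≤ _ := by gcongr; exact le_add_of_nonneg_left (by positivity)

section

variable (K : Type u) [Field K] [NumberField K]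

/-- The expected cost for prices that are given by real numbers. -/
theorem exists_ert_randomIdeal_le_ofReal : ∃ C : ℝ, 0 ≤ C ∧ ∀ {P : Prices} {g : Cost →+ ℝ≥0∞}
    {w t : ℝ} {N : ℕ}, 2 ≤ N → 0 ≤ w → 0 ≤ t →
      CostBound P g (N + Module.finrank ℚ K) (ENNReal.ofReal w) (ENNReal.ofReal t)
        (ENNReal.ofReal t) →
      ert g (randomIdeal K P N) (fun _ => 0) ≤ ENNReal.ofReal (C * (t *
        Real.log N ^ (Module.finrank ℚ K ^ 2 + Module.finrank ℚ K + 1) +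
        w * Real.log N ^ (Module.finrank ℚ K ^ 2 + Module.finrank ℚ K + 7))) := by
  obtain ⟨c, hc⟩ := exists_ert_randomIdeal_le K
  obtain ⟨A, hA, hinv⟩ := exists_inv_acceptRate_le K
  set d := Module.finrank ℚ K with hd
  set q := d ^ 2 + d with hq
  -- From `N.size ≤ 3 log N` and `1 ≤ 2 log N`: the word size plus `2` is `N.size + d + 3`.
  set κ : ℝ := 3 + 2 * (d + 3) with hκ
  have hκ1 : 1 ≤ κ := by rw [hκ]; linarith [(Nat.cast_nonneg d : (0 : ℝ) ≤ d)]
  refine ⟨2 * c * (A + 1) * κ ^ (q + 7), by positivity, fun {P g w t N} hN hw ht h => ?_⟩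
  have h1 := one_le_two_mul_log hN
  have hlog : 0 ≤ Real.log N := by linarith
  set Y := κ * Real.log N with hY
  have hS : ((wordSize d N + 2 : ℕ) : ℝ) ≤ Y := by
    have := size_le_log hN
    rw [wordSize, hY, hκ]
    push_cast
    nlinarith [mul_nonneg (Nat.cast_nonneg d : (0 : ℝ) ≤ d) (sub_nonneg.2 h1)]
  have hZ : (N.size : ℝ) ≤ Y := le_trans (by rw [wordSize]; push_cast; linarith [(Nat.cast_nonneg d : (0 : ℝ) ≤ d)]) hS
  have hY1 : 1 ≤ Y := le_trans (by push_cast; linarith [(Nat.cast_nonneg (wordSize d N) : (0 : ℝ) ≤ _)]) hS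
  have hmono : ∀ {i j : ℕ}, i ≤ j → Y ^ i ≤ Y ^ j := fun hij => pow_le_pow_right₀ hY1 hij
  have hinv' : (acceptRate K N)⁻¹ ≤ ENNReal.ofReal (A * Y ^ q) :=
    (hinv N (by omega)).trans (ENNReal.ofReal_le_ofReal (by gcongr))
  have hpow : ∀ i : ℕ, ((c * (wordSize d N + 2) ^ i : ℕ) : ℝ≥0∞) ≤ ENNReal.ofReal (c * Y ^ i) := by
    intro i
    rw [← ENNReal.ofReal_natCast]
    refine ENNReal.ofReal_le_ofReal ?_
    rw [Nat.cast_mul, Nat.cast_pow]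
    gcongr
  have hpow1 := hpow 1
  rw [pow_one] at hpow1
  refine (hc (by omega) h).trans ?_
  refine (add_le_add (mul_le_mul' (add_le_add (mul_le_mul_right (hpow 4) _)
    (mul_le_mul_right hpow1 _)) hinv') (mul_le_mul_right (hpow (d + 3)) _)).trans ?_
  rw [← ENNReal.ofReal_add ht ht, ← ENNReal.ofReal_mul hw, ← ENNReal.ofReal_mul (by positivity),
    ← ENNReal.ofReal_add (by positivity) (by positivity), ← ENNReal.ofReal_mul (by positivity),
    ← ENNReal.ofReal_mul hw, ← ENNReal.ofReal_add (by positivity) (by positivity)]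
  refine ENNReal.ofReal_le_ofReal ?_
  have hκq : κ ^ (q + 1) ≤ κ ^ (q + 7) := pow_le_pow_right₀ hκ1 (by omega)
  calc _ = c * A * w * Y ^ (q + 4) + 2 * c * A * t * Y ^ (q + 1) + c * w * Y ^ (d + 3) := by ring
    _ ≤ c * A * w * Y ^ (q + 7) + 2 * c * A * t * Y ^ (q + 1) + c * w * Y ^ (q + 7) := by
      have a1 := hmono (show q + 4 ≤ q + 7 by omega)
      have a2 := hmono (show d + 3 ≤ q + 7 by rw [hq]; omega)
      gcongr
    _ ≤ (c * A * w * Y ^ (q + 7) + 2 * c * A * t * Y ^ (q + 1) + c * w * Y ^ (q + 7)) +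
        (2 * c * t * Y ^ (q + 1) + c * (A + 1) * w * Y ^ (q + 7)) :=
      le_add_of_nonneg_right (by positivity)
    _ = 2 * c * (A + 1) * (t * (κ ^ (q + 1) * Real.log N ^ (q + 1)) +
        w * (κ ^ (q + 7) * Real.log N ^ (q + 7))) := by rw [hY, mul_pow, mul_pow]; ring
    _ ≤ 2 * c * (A + 1) * (t * (κ ^ (q + 7) * Real.log N ^ (q + 1)) +
        w * (κ ^ (q + 7) * Real.log N ^ (q + 7))) := by gcongr
    _ = _ := by ring

/-- The part of the cost that `f` counts, as an additive map. -/
noncomputable def costCount (f : Cost → ℕ) (h0 : f 0 = 0) (hadd : ∀ a b, f (a + b) = f a + f b) :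
    Cost →+ ℝ≥0∞ where
  toFun c := f c
  map_zero' := by simp [h0]
  map_add' a b := by simp [hadd]

/-- Measure the cost by the number of calls: time is free (`w = 0`) and a call costs at most `1`.
Hence the constant does not depend on the prices. -/
theorem exists_expected_calls_le : ∃ C : ℝ, ∀ (P : Prices) (N : ℕ), 2 ≤ N →
    (randomIdeal K P N).expected Cost.tests ≤ ENNReal.ofReal
      (C * Real.log N ^ (Module.finrank ℚ K ^ 2 + Module.finrank ℚ K + 1)) ∧
    (randomIdeal K P N).expected Cost.splittings ≤ ENNReal.ofReal
      (C * Real.log N ^ (Module.finrank ℚ K ^ 2 + Module.finrank ℚ K + 1)) := by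
  obtain ⟨C, hC, h⟩ := exists_ert_randomIdeal_le_ofReal K
  refine ⟨C, fun P N hN => ⟨?_, ?_⟩⟩
  · rw [expected_eq_ert (g := costCount Cost.tests rfl fun _ _ => rfl) _ _ fun _ => rfl]
    refine (h hN le_rfl zero_le_one ⟨?_, ?_, ?_⟩).trans (le_of_eq ?_) <;> simp [costCount]
  · rw [expected_eq_ert (g := costCount Cost.splittings rfl fun _ _ => rfl) _ _ fun _ => rfl]
    refine (h hN le_rfl zero_le_one ⟨?_, ?_, ?_⟩).trans (le_of_eq ?_) <;> simp [costCount]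

/-- Measure the cost by time: `w = 1`, and a call costs `O((log N) ^ 6)` uniformly for arguments up
to `N + d`. The calls dominate with exponent `d² + d + 1 + 6`. -/
theorem exists_expected_time_le (P : Prices)
    (htest : (fun m : ℕ => (P.test m : ℝ)) =O[atTop] fun m : ℕ => Real.log m ^ 6)
    (hsplit : (fun p : ℕ => (P.split p : ℝ)) =O[atTop] fun p : ℕ => Real.log p ^ 6) :
    ∃ C : ℝ, ∀ N : ℕ, 2 ≤ N → (randomIdeal K P N).expected Cost.time ≤ ENNReal.ofReal
      (C * Real.log N ^ (Module.finrank ℚ K ^ 2 + Module.finrank ℚ K + 7)) := by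
  obtain ⟨C, hC, h⟩ := exists_ert_randomIdeal_le_ofReal K
  obtain ⟨A, hA, h1⟩ := exists_forall_le_log_pow htest (Module.finrank ℚ K)
  obtain ⟨B, hB, h2⟩ := exists_forall_le_log_pow hsplit (Module.finrank ℚ K)
  refine ⟨C * (A + B + 1), fun N hN => ?_⟩
  have hlog : 0 ≤ Real.log N := by linarith [one_le_two_mul_log hN]
  rw [expected_eq_ert (g := costCount Cost.time rfl fun _ _ => rfl) _ _ fun _ => rfl]
  refine (h (t := (A + B) * Real.log N ^ 6) hN zero_le_one (by positivity)
    ⟨by simp [costCount], fun m hm => ?_, fun m hm => ?_⟩).trans (ENNReal.ofReal_le_ofReal ?_)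
  · change ((P.test m : ℕ) : ℝ≥0∞) ≤ _
    rw [← ENNReal.ofReal_natCast]
    refine ENNReal.ofReal_le_ofReal ((h1 N hN m hm).trans ?_)
    gcongr
    linarith
  · change ((P.split m : ℕ) : ℝ≥0∞) ≤ _
    rw [← ENNReal.ofReal_natCast]
    refine ENNReal.ofReal_le_ofReal ((h2 N hN m hm).trans ?_)
    gcongr
    linarith
  · exact le_of_eq (by ring)

end

end FactoredIdeals

theorem mainTheorem1 (K : Type*) [Field K] [NumberField K] :
    -- One round: step 4 keeps a factored integer `r ≤ N` with the well-defined probability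
    -- `M_d(r) ψ(r) D(r) / (d ^ Ω_d(r) N)`, and the round accepts `r` with probability
    -- proportional to `D(r)`.
    (∀ (P : Prices) (N : ℕ), 1 ≤ N →
      0 < roundFactor (Module.finrank ℚ K) N ∧
      ∀ r : ℕ, 1 ≤ r → r ≤ N →
        (0 ≤ acceptProb K N r ∧ acceptProb K N r ≤ 1) ∧
        (∀ l : List (ℕ × ℕ), IsFactorizationOf l r →
          (acceptStep K P (Module.finrank ℚ K) N (r, l)).pr
            (fun x => ∃ y, x = some y ∧ IsFactoredNorm r y)
          = ENNReal.ofReal (acceptProb K N r)) ∧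
        (round K P N).pr (fun x => ∃ y, x = some y ∧ IsFactoredNorm r y)
          = ENNReal.ofReal (roundFactor (Module.finrank ℚ K) N * idealCount K r)) ∧
    -- The algorithm for factored norms outputs `r ≤ N` with probability `D(r) / ∑_{s ≤ N} D(s)`.
    (∀ (P : Prices) (N : ℕ), 1 ≤ N →
      (randomNorm K P N).Halts ∧
      ∀ r : ℕ, 1 ≤ r → r ≤ N →
        (randomNorm K P N).pr (IsFactoredNorm r)
          = (idealCount K r : ℝ≥0∞) / ∑ s ∈ Finset.Icc 1 N, (idealCount K s : ℝ≥0∞)) ∧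
    -- The whole algorithm outputs every nonzero ideal of norm at most `N`, with its norm and its
    -- prime factorization, with the same probability.
    (∀ (P : Prices) (N : ℕ), 1 ≤ N →
      (randomIdeal K P N).Halts ∧
      ∀ I : Ideal (𝓞 K), I ≠ ⊥ → Ideal.absNorm I ≤ N →
        (randomIdeal K P N).pr (fun x => x.1 = Ideal.absNorm I ∧ IsFactorizationOf x.2 I)
          = 1 / (idealCountLE K N : ℝ≥0∞)) ∧
    -- Expected numbers of primality tests and of factorizations of `p𝓞_K`.
    (∃ C : ℝ, ∀ (P : Prices) (N : ℕ), 2 ≤ N →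
      (randomIdeal K P N).expected Cost.tests ≤ ENNReal.ofReal
        (C * Real.log N ^ (Module.finrank ℚ K ^ 2 + Module.finrank ℚ K + 1)) ∧
      (randomIdeal K P N).expected Cost.splittings ≤ ENNReal.ofReal
        (C * Real.log N ^ (Module.finrank ℚ K ^ 2 + Module.finrank ℚ K + 1))) ∧
    -- Expected time, if the two subroutines take time `O((log m) ^ 6)`.
    (∀ P : Prices,
      (fun m : ℕ => (P.test m : ℝ)) =O[atTop] (fun m : ℕ => Real.log m ^ 6) →
      (fun p : ℕ => (P.split p : ℝ)) =O[atTop] (fun p : ℕ => Real.log p ^ 6) →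
      ∃ C : ℝ, ∀ N : ℕ, 2 ≤ N →
        (randomIdeal K P N).expected Cost.time ≤ ENNReal.ofReal
          (C * Real.log N ^ (Module.finrank ℚ K ^ 2 + Module.finrank ℚ K + 7))) := by
  refine ⟨fun P N hN => ⟨roundFactor_pos (finrank_pos' K) hN, fun r hr hrN =>
    ⟨acceptProb_mem hr hrN, fun l hl => pr_acceptStep hl hrN, pr_round P N r hr hrN⟩⟩,
    fun P N hN => ⟨halts_randomNorm P hN, fun r hr hrN => pr_randomNorm P hr hrN⟩,
    fun P N hN => ⟨halts_randomIdeal P hN, fun I hI hIN => pr_randomIdeal P hI hIN⟩,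
    exists_expected_calls_le K, fun P => exists_expected_time_le K P⟩
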